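/- **Setting.** Let $m$ be a positive integer, $T>0$, $\alpha_i,\beta_i>0$ $(1\le i\le m)$, and let $\{t_k\}_{k\in\mathbb Z}$ be a strictly increasing real sequence with $t_k\to\pm\infty$ as $k\to\pm\infty$. Consider the impulsive equation $$\dot x(t)=-a(t)x(t)+\sum_{i=1}^m\Big[\frac{b_i(t)}{1+x^{\alpha_i}(t-\tau_i(t))}+c_i(t)\int_0^T\frac{v_i(s)}{1+x^{\beta_i}(t-s)}\,ds-H_i\big(t,x(t-\sigma_i(t))\big)\Big],\quad t\ne t_k,$$ $$x(t_k^+)-x(t_k^-)=\gamma_kx(t_k^-)+\delta_k,\quad k\in\mathbb Z, \tag{1}$$ where $\tau_i,\sigma_i\ge 0$, and $v_i\ge 0$ is integrable on $[0,T]$ with $\int_0^Tv_i(s)\,ds=1$. A solution is a function $x:\mathbb R\to\mathbb R$ that is left continuous, is continuous except possibly at the $t_k$, has finite right limits at the $t_k$, satisfies the impulse conditions, and satisfies the differential equation at every $t\notin\{t_k\}$, where $\dot x$ denotes the left derivative and is the two-sided derivative whenever no $t-\tau_i(t)$ and no $t-\sigma_i(t)$ is one of the $t_k$. A set of reals (integers)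 is relatively dense if it meets every interval of some fixed length. The family $t_k^p=t_{k+p}-t_k$ is uniformly almost periodic if for every $\epsilon>0$ the set of $q\in\mathbb Z$ with $|t_{k+q}^p-t_k^p|<\epsilon$ for all $k,p\in\mathbb Z$ is relatively dense. A function $\phi$ with the continuity properties above is almost periodic if (i) $\{t_k^p\}$ is uniformly almost periodic; (ii) for every $\epsilon>0$ there is $d>0$ with $|\phi(t)-\phi(\bar t)|<\epsilon$ whenever $t,\bar t$ lie in the same interval $(t_k,t_{k+1}]$ and $|t-\bar t|<d$; (iii) for every $\epsilon>0$ there is a relatively dense set of $\omega$ such that $|\phi(t+\omega)-\phi(t)|<\epsilon$ for all $t$ with $|t-t_k|>\epsilon$ for all $k$. For a function or sequence $f$ write $f_L=\inf f$, $f_M=\sup f$; for $H_i$ these are taken over $\mathbb R\times[0,\infty)$. **Assumptions.** - (A1) $a$ is Bohr almost periodic and $a_L>0$. - (A2) $b_i,c_i$ are nonnegative and Bohr almost periodic. - (A3) On $\mathbb R\times[0,\infty)$, $H_i$ is bounded, nonnegative and almost periodic in $t$ in the sense of Bohr, uniformly for $x$ in compact subsets of $[0,\infty)$, and $|H_i(t,x)-H_i(t,y)|\le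 L_i|x-y|$ with $L_i>0$. - (A4) $\tau_i,\sigma_i$ are Bohr almost periodic and differentiable with bounded derivatives, $\inf_t(1-\dot\tau_i(t))>0$ and $\inf_t(1-\dot\sigma_i(t))>0$. - (A5) $\{\delta_k\}$ is almost periodic. - (A6) $\{\gamma_k\}$ is almost periodic, $\gamma_L>-1$, and the products $\prod_{i=q}^p(1+\gamma_i)$, $q\le p$, have supremum $\Gamma_M<\infty$ and infimum $\Gamma_L>0$. - (A7) $\{t_k^p\}$ is uniformly almost periodic and $\eta=\inf_k(t_{k+1}-t_k)>0$. **Constants.** Let $A=\max\{\Gamma_M,1\}$, $B=\min\{\Gamma_L,1\}$, $\bar\eta=\sup_k(t_{k+1}-t_k)$, $$M_1=\frac{A}{a_L}\sum_{i=1}^m(b_{iM}+c_{iM}-H_{iL})+\frac{A\max\{\delta_M,0\}}{1-e^{-a_L\eta}},$$ $$M_2=\frac{B}{a_M}\sum_{i=1}^m\Big(\frac{b_{iL}}{1+M_1^{\alpha_i}}+\frac{c_{iL}}{1+M_1^{\beta_i}}-H_{iM}\Big)+\begin{cases}\dfrac{B\delta_Le^{-a_M\bar\eta}}{1-e^{-a_M\bar\eta}},&\delta_L\ge0,\\[2mm]\dfrac{A\delta_L}{1-e^{-a_L\eta}},&\delta_L<0,\end{cases}$$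 and $K_i^*=\sup_{M_2\le x\le M_1}\alpha_ix^{\alpha_i-1}$, $G_i^*=\sup_{M_2\le x\le M_1}\beta_ix^{\beta_i-1}$. **Theorem.** Assume (A1)–(A7), $M_1\ge0$, $M_2>0$ and $$\frac{A}{a_L}\sum_{i=1}^m\big(b_{iM}K_i^*+c_{iM}G_i^*+L_i\big)<1 .$$ Then equation (1) has a unique positive almost periodic solution. -/

import Mathlib

open Set Filter Topology
open scoped NNReal

namespace Hematopoiesis

/-! ### Almost periodicity -/

/-- A set `S` of real numbers is relatively dense: some length `ℓ > 0` is such that every closed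
interval of length `ℓ` meets `S`. -/
def RelDenseReal (S : Set ℝ) : Prop :=
  ∃ ℓ : ℝ, 0 < ℓ ∧ ∀ r : ℝ, ∃ ω ∈ S, r ≤ ω ∧ ω ≤ r + ℓ

/-- A set `S` of integers is relatively dense. -/
def RelDenseInt (S : Set ℤ) : Prop :=
  ∃ N : ℕ, ∀ r : ℤ, ∃ p ∈ S, r ≤ p ∧ p ≤ r + N

/-- A real function is almost periodic in the sense of Bohr. -/
def BohrAP (f : ℝ → ℝ) : Prop :=
  Continuous f ∧ ∀ ε : ℝ, 0 < ε → RelDenseReal {ω | ∀ t, |f (t + ω) - f t| < ε}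

/-- `f t x` is almost periodic in `t` in the sense of Bohr, uniformly in `x ∈ D`: it is continuous
on `ℝ × D` and, on every compact subset `K` of `D`, its `ε`-almost periods common to all `x ∈ K`
form a relatively dense set. -/
def BohrAPUniformly (f : ℝ → ℝ → ℝ) (D : Set ℝ) : Prop :=
  ContinuousOn (fun z : ℝ × ℝ => f z.1 z.2) (univ ×ˢ D) ∧
    ∀ K ⊆ D, IsCompact K → ∀ ε : ℝ, 0 < ε →
      RelDenseReal {ω | ∀ t, ∀ x ∈ K, |f (t + ω) x - f t x| < ε}

/-- A two-sided real sequence is almost periodic. -/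
def SeqAP (z : ℤ → ℝ) : Prop :=
  ∀ ε : ℝ, 0 < ε → RelDenseInt {p | ∀ k, |z (k + p) - z k| < ε}

/-- The set of sequences `k ↦ θ (k + p) - θ k`, `p ∈ ℤ`, is uniformly almost periodic: for every
`ε > 0` the `ε`-almost periods `q` common to all these sequences form a relatively dense set. -/
def UniformlyAP (θ : ℤ → ℝ) : Prop :=
  ∀ ε : ℝ, 0 < ε → RelDenseInt
    {q | ∀ p k : ℤ, |(θ (k + q + p) - θ (k + q)) - (θ (k + p) - θ k)| < ε}

/-- The space `PLC(ℝ, ℝ)`: piecewise left continuous functions, whose only discontinuities are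
of the first kind and located at the points `θ k`. -/
structure PLC (θ : ℤ → ℝ) (φ : ℝ → ℝ) : Prop where
  continuousAt : ∀ t, t ∉ range θ → ContinuousAt φ t
  left_continuous : ∀ k, Tendsto φ (𝓝[<] (θ k)) (𝓝 (φ (θ k)))
  right_limit : ∀ k, ∃ l, Tendsto φ (𝓝[>] (θ k)) (𝓝 l)

/-- Almost periodicity of a function of `PLC(ℝ, ℝ)`. -/
structure PiecewiseAP (θ : ℤ → ℝ) (φ : ℝ → ℝ) : Prop where
  plc : PLC θ φ
  impulses : UniformlyAP θ
  uniform_continuity : ∀ ε : ℝ, 0 < ε → ∃ d : ℝ, 0 < d ∧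
    ∀ k : ℤ, ∀ t ∈ Ioc (θ k) (θ (k + 1)), ∀ t' ∈ Ioc (θ k) (θ (k + 1)),
      |t - t'| < d → |φ t - φ t'| < ε
  almost_periods : ∀ ε : ℝ, 0 < ε → RelDenseReal
    {ω | ∀ t, (∀ k, ε < |t - θ k|) → |φ (t + ω) - φ t| < ε}

/-! ### The impulsive model -/

/-- The data of the model with `m` production terms. `θ k` is the `k`-th impulse time and `L i` is
the Lipschitz constant of the harvesting term `H i`. The conditions on these data are stated in
`Model.Standing` and `Model.A1`, ..., `Model.A7`. -/
structure Model (m : ℕ) where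
  a : ℝ → ℝ
  b : Fin m → ℝ → ℝ
  c : Fin m → ℝ → ℝ
  v : Fin m → ℝ → ℝ
  H : Fin m → ℝ → ℝ → ℝ
  τ : Fin m → ℝ → ℝ
  σ : Fin m → ℝ → ℝ
  α : Fin m → ℝ
  β : Fin m → ℝ
  L : Fin m → ℝ
  T : ℝ
  θ : ℤ → ℝ
  γ : ℤ → ℝ
  δ : ℤ → ℝ

namespace Model

variable {m : ℕ} (P : Model m)

/-- The right-hand side of the differential equation, along the function `x`, at time `t`. -/
noncomputable def rhs (x : ℝ → ℝ) (t : ℝ) : ℝ :=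
  -P.a t * x t + ∑ i, (P.b i t / (1 + x (t - P.τ i t) ^ P.α i)
    + P.c i t * (∫ s in (0 : ℝ)..P.T, P.v i s / (1 + x (t - s) ^ P.β i))
    - P.H i t (x (t - P.σ i t)))

/-- `x` is a solution on `ℝ` of the impulsive delay equation. The function `x` is piecewise left
continuous, so `x (θ k)` is its left limit at `θ k`. The right-hand side of the equation is left
continuous, but jumps at the times `t` for which a delayed argument `t - τ i t` or `t - σ i t` is
an impulse time; there `x` has only one-sided derivatives. So the equation is required with the
left derivative at all `t` that are not impulse times, and with the two-sided derivative
if moreover no delayed argument is an impulse time. -/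
structure IsSolution (x : ℝ → ℝ) : Prop where
  plc : PLC P.θ x
  left_deriv : ∀ t, t ∉ range P.θ → HasDerivWithinAt x (P.rhs x t) (Iic t) t
  deriv : ∀ t, t ∉ range P.θ → (∀ i, t - P.τ i t ∉ range P.θ ∧ t - P.σ i t ∉ range P.θ) →
    HasDerivAt x (P.rhs x t) t
  jump : ∀ k, Tendsto x (𝓝[>] (P.θ k))
    (𝓝 (x (P.θ k) + (P.γ k * x (P.θ k) + P.δ k)))

/-! ### The constants -/

noncomputable def aL : ℝ := ⨅ t, P.a t
noncomputable def aM : ℝ := ⨆ t, P.a t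
noncomputable def bL (i : Fin m) : ℝ := ⨅ t, P.b i t
noncomputable def bM (i : Fin m) : ℝ := ⨆ t, P.b i t
noncomputable def cL (i : Fin m) : ℝ := ⨅ t, P.c i t
noncomputable def cM (i : Fin m) : ℝ := ⨆ t, P.c i t
noncomputable def HL (i : Fin m) : ℝ := ⨅ z : ℝ × ℝ≥0, P.H i z.1 (z.2 : ℝ)
noncomputable def HM (i : Fin m) : ℝ := ⨆ z : ℝ × ℝ≥0, P.H i z.1 (z.2 : ℝ)
noncomputable def γL : ℝ := ⨅ k, P.γ k
noncomputable def δL : ℝ := ⨅ k, P.δ k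
noncomputable def δM : ℝ := ⨆ k, P.δ k

/-- `η`, the infimum of the distances between consecutive impulse times. -/
noncomputable def η : ℝ := ⨅ k, (P.θ (k + 1) - P.θ k)

/-- The supremum of the distances between consecutive impulse times. -/
noncomputable def ηBar : ℝ := ⨆ k, (P.θ (k + 1) - P.θ k)

/-- The products `∏_{i=q}^{p} (1 + γ i)`, for `q ≤ p`. -/
def gammaProducts : Set ℝ :=
  {r | ∃ q p : ℤ, q ≤ p ∧ r = ∏ i ∈ Finset.Icc q p, (1 + P.γ i)}

noncomputable def ΓM : ℝ := sSup P.gammaProducts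
noncomputable def ΓL : ℝ := sInf P.gammaProducts

noncomputable def A : ℝ := max P.ΓM 1
noncomputable def B : ℝ := min P.ΓL 1

/-- The upper bound `M₁`. Only the positive part of `sup δ` can enter an upper bound of this
form. -/
noncomputable def M₁ : ℝ :=
  P.A / P.aL * ∑ i, (P.bM i + P.cM i - P.HL i)
    + P.A * max P.δM 0 / (1 - Real.exp (-P.aL * P.η))

/-- The lower bound `M₂`. -/
noncomputable def M₂ : ℝ :=
  P.B / P.aM * ∑ i, (P.bL i / (1 + P.M₁ ^ P.α i) + P.cL i / (1 + P.M₁ ^ P.β i) - P.HM i)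
    + if 0 ≤ P.δL then
        P.B * P.δL * Real.exp (-P.aM * P.ηBar) / (1 - Real.exp (-P.aM * P.ηBar))
      else P.A * P.δL / (1 - Real.exp (-P.aL * P.η))

noncomputable def KStar (i : Fin m) : ℝ :=
  sSup ((fun x : ℝ => P.α i * x ^ (P.α i - 1)) '' Icc P.M₂ P.M₁)

noncomputable def GStar (i : Fin m) : ℝ :=
  sSup ((fun x : ℝ => P.β i * x ^ (P.β i - 1)) '' Icc P.M₂ P.M₁)

/-! ### The assumptions -/

/-- The conditions under which the model is introduced. -/
structure Standing : Prop where
  τ_nonneg : ∀ i t, 0 ≤ P.τ i t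
  σ_nonneg : ∀ i t, 0 ≤ P.σ i t
  α_pos : ∀ i, 0 < P.α i
  β_pos : ∀ i, 0 < P.β i
  T_pos : 0 < P.T
  v_nonneg : ∀ i, ∀ s ∈ Icc 0 P.T, 0 ≤ P.v i s
  v_integrable : ∀ i, IntervalIntegrable (P.v i) MeasureTheory.volume 0 P.T
  v_integral : ∀ i, ∫ s in (0 : ℝ)..P.T, P.v i s = 1
  θ_strictMono : StrictMono P.θ
  θ_atTop : Tendsto P.θ atTop atTop
  θ_atBot : Tendsto P.θ atBot atBot

structure A1 : Prop where
  ap : BohrAP P.a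
  aL_pos : 0 < P.aL

structure A2 : Prop where
  b_nonneg : ∀ i t, 0 ≤ P.b i t
  c_nonneg : ∀ i t, 0 ≤ P.c i t
  b_ap : ∀ i, BohrAP (P.b i)
  c_ap : ∀ i, BohrAP (P.c i)

structure A3 : Prop where
  nonneg : ∀ i t x, 0 ≤ x → 0 ≤ P.H i t x
  bounded : ∀ i, ∃ C, ∀ t x, 0 ≤ x → P.H i t x ≤ C
  ap : ∀ i, BohrAPUniformly (P.H i) (Ici 0)
  L_pos : ∀ i, 0 < P.L i
  lipschitz : ∀ i t x y, 0 ≤ x → 0 ≤ y → |P.H i t x - P.H i t y| ≤ P.L i * |x - y|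

structure A4 : Prop where
  τ_ap : ∀ i, BohrAP (P.τ i)
  σ_ap : ∀ i, BohrAP (P.σ i)
  τ_differentiable : ∀ i, Differentiable ℝ (P.τ i)
  σ_differentiable : ∀ i, Differentiable ℝ (P.σ i)
  τ_deriv_bounded : ∀ i, ∃ C, ∀ t, |deriv (P.τ i) t| ≤ C
  σ_deriv_bounded : ∀ i, ∃ C, ∀ t, |deriv (P.σ i) t| ≤ C
  τ_deriv : ∀ i, 0 < ⨅ t, (1 - deriv (P.τ i) t)
  σ_deriv : ∀ i, 0 < ⨅ t, (1 - deriv (P.σ i) t)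

def A5 : Prop := SeqAP P.δ

structure A6 : Prop where
  ap : SeqAP P.γ
  γL_gt : -1 < P.γL
  ΓM_finite : BddAbove P.gammaProducts
  ΓL_pos : 0 < P.ΓL

structure A7 : Prop where
  ap : UniformlyAP P.θ
  η_pos : 0 < P.η

end Model

end Hematopoiesis

/-! The delays enter only through a bounded forcing term, so the equation is treated as the linear
impulsive equation `x' = -a x + f` with `f = production x`. A bounded solution on the whole line is
then given by variation of constants (`Mild`). Weighting the values at impulse times by `jumpProd`
and `decay` makes them telescope backwards (`mild_telescope`). The weights are at most `A * exp (-lo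
* (t - θ k))`, so whatever stays bounded along impulse times at `-∞` contributes nothing in the
limit. A solution is thus controlled by its `contribution`s, and comparing these with telescoping
majorants yields the explicit bounds.

Applied to the model, this puts every nonnegative recurrently bounded solution in `[M₂, M₁]`
(`mild_le_M₁`, `M₂_le_mild`). If the bound of the production term is negative, the factors `A` and
`B` point the wrong way. But then `0 < M₂` forces the impulses to outweigh the losses on each
interval (`grouped_nonneg`), and impulse and loss are estimated together.

On measurable functions with values in `[M₂, M₁]`, sending `x` to the bounded mild solution driven
by `production x` is a contraction for the supremum distance, by the mean value theorem for `hill`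
and the smallness hypothesis. This gives existence (`exists_mild_fixed_point`). Uniqueness follows
because a positive almost periodic solution is recurrently bounded, hence lies between the same
bounds (`unique_solution`).

Almost periodicity is proved afterwards, directly for the fixed point. Let `q` be an index shift
that is an almost period of all the data. A plain time translate of `x` jumps at slightly wrong
times, so `x` is composed with the piecewise affine map `align θ q`, which carries `θ k` to `θ (k +
q)`. The deviation `x ∘ align - x` is again a mild solution of the linear equation, with small
impulses (`mild_align_sub`). Its forcing is at most `lipschitzSum` times the supremum of the
deviation, plus a small constant, plus indicators of the times whose delayed arguments fall near an
impulse. Those times have small measure because the delays are bi-Lipschitz time changes, and the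
distributed delay sees little mass there because its kernel is integrable. The contraction constant
absorbs the supremum (`exists_abs_align_sub_le`). Away from impulses the aligned time and the
translated time lie close together in one interval, where `x` is Lipschitz (`piecewiseAP`). -/

namespace Hematopoiesis

/-! ### Exponential weights -/

/-- The propagator `exp (-∫ a)` of `x' = -a x` from time `s` to time `t`. -/
noncomputable def decay (a : ℝ → ℝ) (s t : ℝ) : ℝ := Real.exp (-∫ u in s..t, a u)

/-- The accumulated jump factor over the indices `i ≤ k < j`. -/
noncomputable def jumpProd (γ : ℤ → ℝ) (i j : ℤ) : ℝ := ∏ k ∈ Finset.Ico i j, (1 + γ k)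

lemma jumpProd_self (γ : ℤ → ℝ) (i : ℤ) : jumpProd γ i i = 1 := by simp [jumpProd]

lemma jumpProd_eq_mul_left (γ : ℤ → ℝ) {i j : ℤ} (h : i < j) :
    jumpProd γ i j = (1 + γ i) * jumpProd γ (i + 1) j := by
  unfold jumpProd
  have : Finset.Ico i j = insert i (Finset.Ico (i + 1) j) := by
    ext k; simp only [Finset.mem_insert, Finset.mem_Ico]; omega
  rw [this, Finset.prod_insert (by simp)]

lemma jumpProd_eq_mul_right (γ : ℤ → ℝ) {i j : ℤ} (h : i ≤ j) :
    jumpProd γ i (j + 1) = jumpProd γ i j * (1 + γ j) := by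
  unfold jumpProd
  have : Finset.Ico i (j + 1) = insert j (Finset.Ico i j) := by
    ext k; simp only [Finset.mem_insert, Finset.mem_Ico]; omega
  rw [this, Finset.prod_insert (by simp), mul_comm]

lemma decay_pos (a : ℝ → ℝ) (s t : ℝ) : 0 < decay a s t := Real.exp_pos _

lemma decay_self (a : ℝ → ℝ) (s : ℝ) : decay a s s = 1 := by simp [decay]

lemma decay_mul {a : ℝ → ℝ} (ha : Continuous a) (s t u : ℝ) :
    decay a s t * decay a t u = decay a s u := by
  unfold decay
  rw [← Real.exp_add, ← neg_add, intervalIntegral.integral_add_adjacent_intervals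
    (ha.intervalIntegrable _ _) (ha.intervalIntegrable _ _)]

lemma hasDerivAt_decay_right {a : ℝ → ℝ} (ha : Continuous a) (s t : ℝ) :
    HasDerivAt (fun t => decay a s t) (-a t * decay a s t) t := by
  have := ((intervalIntegral.integral_hasDerivAt_right (ha.intervalIntegrable s t)
    (ha.stronglyMeasurableAtFilter _ _) ha.continuousAt).neg).exp
  rw [mul_comm]; exact this

lemma continuous_decay_right {a : ℝ → ℝ} (ha : Continuous a) (s : ℝ) :
    Continuous (fun t => decay a s t) :=
  continuous_iff_continuousAt.2 fun t => (hasDerivAt_decay_right ha s t).continuousAt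

lemma decay_symm {a : ℝ → ℝ} (s t : ℝ) : decay a s t = (decay a t s)⁻¹ := by
  unfold decay
  rw [intervalIntegral.integral_symm, ← Real.exp_neg]

lemma continuous_decay_left {a : ℝ → ℝ} (ha : Continuous a) (t : ℝ) :
    Continuous (fun s => decay a s t) := by
  simp_rw [fun s => decay_symm (a := a) s t]
  exact (continuous_decay_right ha t).inv₀ fun s => (decay_pos a t s).ne'

lemma decay_le {a : ℝ → ℝ} (ha : Continuous a) {lo : ℝ} (h : ∀ t, lo ≤ a t) {s t : ℝ}
    (hst : s ≤ t) : decay a s t ≤ Real.exp (-lo * (t - s)) := by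
  unfold decay
  have := intervalIntegral.integral_mono_on hst (f := fun _ => lo) (g := a)
    (intervalIntegrable_const (μ := MeasureTheory.volume)) (ha.intervalIntegrable s t)
    (fun u _ => h u)
  rw [intervalIntegral.integral_const, smul_eq_mul] at this
  exact Real.exp_le_exp.2 (by linarith)

lemma le_decay {a : ℝ → ℝ} (ha : Continuous a) {hi : ℝ} (h : ∀ t, a t ≤ hi) {s t : ℝ}
    (hst : s ≤ t) : Real.exp (-hi * (t - s)) ≤ decay a s t := by
  unfold decay
  have := intervalIntegral.integral_mono_on hst (f := a) (g := fun _ => hi)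
    (ha.intervalIntegrable s t) (intervalIntegrable_const (μ := MeasureTheory.volume))
    (fun u _ => h u)
  rw [intervalIntegral.integral_const, smul_eq_mul] at this
  exact Real.exp_le_exp.2 (by linarith)

lemma intervalIntegrable_of_bounded {f : ℝ → ℝ} (hf : Measurable f) {K : ℝ}
    (hK : ∀ t, |f t| ≤ K) (s t : ℝ) : IntervalIntegrable f MeasureTheory.volume s t :=
  (intervalIntegrable_const (c := K)).mono_fun hf.aestronglyMeasurable
    (Eventually.of_forall fun u => by
      simpa using (hK u).trans (le_abs_self K))

lemma intervalIntegrable_decay_mul {a f : ℝ → ℝ} (ha : Continuous a) (hf : Measurable f) {K : ℝ}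
    (hK : ∀ t, |f t| ≤ K) (s t u : ℝ) :
    IntervalIntegrable (fun r => decay a r u * f r) MeasureTheory.volume s t :=
  (intervalIntegrable_of_bounded hf hK s t).continuousOn_mul
    (continuous_decay_left ha u).continuousOn

lemma integral_exp_scale {l : ℝ} (hl : l ≠ 0) (s r t : ℝ) :
    ∫ u in s..r, Real.exp (-l * (t - u)) =
      (Real.exp (-l * (t - r)) - Real.exp (-l * (t - s))) / l := by
  have hd : ∀ u ∈ uIcc s r, HasDerivAt (fun u => Real.exp (-l * (t - u)) / l)
      (Real.exp (-l * (t - u))) u := by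
    intro u _
    have h1 : HasDerivAt (fun u => -l * (t - u)) l u := by
      have := ((hasDerivAt_id u).const_sub t).const_mul (-l)
      simpa using this
    have := h1.exp.div_const l
    rwa [mul_div_assoc, div_self hl, mul_one] at this
  rw [intervalIntegral.integral_eq_sub_of_hasDerivAt hd
    ((by fun_prop : Continuous fun u => Real.exp (-l * (t - u))).intervalIntegrable _ _)]
  ring

/-! ### Linear impulsive equations -/

/-- The coefficients of a linear impulsive equation `x' = -a x + f`, with jumps
`x (θ k +) = (1 + γ k) x (θ k) + δ k`, together with the bounds that make it exponentially
stable. -/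
structure LinearImpulsive (a : ℝ → ℝ) (θ γ : ℤ → ℝ) (lo hi η η' A B : ℝ) : Prop where
  cont : Continuous a
  lo_pos : 0 < lo
  lo_le : ∀ t, lo ≤ a t
  le_hi : ∀ t, a t ≤ hi
  η_pos : 0 < η
  gap_ge : ∀ k, η ≤ θ (k + 1) - θ k
  gap_le : ∀ k, θ (k + 1) - θ k ≤ η'
  strictMono : StrictMono θ
  tendsto_atTop : Tendsto θ atTop atTop
  tendsto_atBot : Tendsto θ atBot atBot
  jump_pos : ∀ k, 0 < 1 + γ k
  B_pos : 0 < B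
  jumpProd_le : ∀ i j, i ≤ j → jumpProd γ i j ≤ A
  le_jumpProd : ∀ i j, i ≤ j → B ≤ jumpProd γ i j

/-- `x` satisfies the variation of constants formula between consecutive impulses. -/
def Mild (a : ℝ → ℝ) (θ γ : ℤ → ℝ) (f : ℝ → ℝ) (δ : ℤ → ℝ) (x : ℝ → ℝ) : Prop :=
  ∀ k, ∀ t ∈ Ioc (θ k) (θ (k + 1)),
    x t = decay a (θ k) t * ((1 + γ k) * x (θ k) + δ k) + ∫ s in θ k..t, decay a s t * f s

/-- `x` does not blow up along the impulse times at `-∞`. -/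
def RecurrentlyBounded (θ : ℤ → ℝ) (x : ℝ → ℝ) : Prop :=
  ∃ C, ∀ K : ℤ, ∃ k ≤ K, |x (θ k)| ≤ C

lemma exists_index {θ : ℤ → ℝ} (hm : StrictMono θ) (h1 : Tendsto θ atTop atTop)
    (h2 : Tendsto θ atBot atBot) (t : ℝ) : ∃ k, t ∈ Ioc (θ k) (θ (k + 1)) := by
  obtain ⟨b, hb⟩ := (h1.eventually_ge_atTop t).exists
  obtain ⟨k, hk, hmax⟩ := Int.exists_greatest_of_bdd (P := fun k => θ k < t)
    ⟨b, fun z hz => (hm.lt_iff_lt.1 (hz.trans_le hb)).le⟩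
    (h2.eventually_lt_atBot t).exists
  refine ⟨k, hk, ?_⟩
  by_contra! h
  have := hmax _ h
  omega

lemma index_unique {θ : ℤ → ℝ} (hm : StrictMono θ) {t : ℝ} {j k : ℤ}
    (hj : t ∈ Ioc (θ j) (θ (j + 1))) (hk : t ∈ Ioc (θ k) (θ (k + 1))) : j = k := by
  have h1 := hm.lt_iff_lt.1 (hj.1.trans_le hk.2)
  have h2 := hm.lt_iff_lt.1 (hk.1.trans_le hj.2)
  omega

lemma Mild.neg {a : ℝ → ℝ} {θ γ : ℤ → ℝ} {f x : ℝ → ℝ} {δ : ℤ → ℝ} (h : Mild a θ γ f δ x) :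
    Mild a θ γ (fun t => -f t) (fun k => -δ k) (fun t => -x t) := by
  intro k t ht
  simp only [mul_neg, intervalIntegral.integral_neg]
  rw [h k t ht]; ring

lemma RecurrentlyBounded.neg {θ : ℤ → ℝ} {x : ℝ → ℝ} (h : RecurrentlyBounded θ x) :
    RecurrentlyBounded θ (fun t => -x t) := by
  simpa [RecurrentlyBounded] using h

lemma recurrentlyBounded_of_bounded (θ : ℤ → ℝ) {x : ℝ → ℝ} {C : ℝ} (h : ∀ t, |x t| ≤ C) :
    RecurrentlyBounded θ x := ⟨C, fun K => ⟨K, le_rfl, h _⟩⟩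

lemma Mild.sub {a : ℝ → ℝ} (ha : Continuous a) {θ γ : ℤ → ℝ} {f g x y : ℝ → ℝ} {δ ε : ℤ → ℝ}
    (hf : Measurable f) {K K' : ℝ} (hK : ∀ t, |f t| ≤ K) (hg : Measurable g)
    (hK' : ∀ t, |g t| ≤ K')
    (h : Mild a θ γ f δ x) (h' : Mild a θ γ g ε y) :
    Mild a θ γ (fun t => f t - g t) (fun k => δ k - ε k) (fun t => x t - y t) := by
  intro k t ht
  simp only [mul_sub]
  rw [intervalIntegral.integral_sub (intervalIntegrable_decay_mul ha hf hK _ _ _)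
    (intervalIntegrable_decay_mul ha hg hK' _ _ _), h k t ht, h' k t ht]; ring

/-- No impulse lies between `s` and `t`, so the formula may be restarted at the interior time `s`.
This serves the Lipschitz estimate and carries bounds forward to the next impulse. -/
lemma Mild.flow {a : ℝ → ℝ} (ha : Continuous a) {θ γ : ℤ → ℝ} {f x : ℝ → ℝ} {δ : ℤ → ℝ}
    (hf : Measurable f) {K : ℝ} (hK : ∀ t, |f t| ≤ K) (h : Mild a θ γ f δ x)
    {k : ℤ} {s t : ℝ} (hs : θ k < s) (hst : s ≤ t) (ht : t ≤ θ (k + 1)) :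
    x t = decay a s t * x s + ∫ r in s..t, decay a r t * f r := by
  have e1 : ∀ r, decay a s t * (decay a r s * f r) = decay a r t * f r := fun r => by
    rw [← decay_mul ha r s t]; ring
  have e2 : decay a s t * ∫ r in θ k..s, decay a r s * f r = ∫ r in θ k..s, decay a r t * f r := by
    rw [← intervalIntegral.integral_const_mul]; simp_rw [e1]
  rw [h k t ⟨hs.trans_le hst, ht⟩, h k s ⟨hs, hst.trans ht⟩,
    ← intervalIntegral.integral_add_adjacent_intervals
      (intervalIntegrable_decay_mul ha hf hK (θ k) s t)
      (intervalIntegrable_decay_mul ha hf hK s t t), ← e2, ← decay_mul ha (θ k) s t]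
  ring

/-! ### Telescoping and the comparison principle. -/

/-- The contribution at time `t` of the impulse at `θ k` and of the inhomogeneity on the part of
`(θ k, θ (k + 1)]` before `t`, where `t` belongs to the interval with index `n`. -/
noncomputable def contribution (a : ℝ → ℝ) (θ γ : ℤ → ℝ) (f : ℝ → ℝ) (δ : ℤ → ℝ) (n : ℤ) (t : ℝ)
    (k : ℤ) : ℝ :=
  jumpProd γ (k + 1) (n + 1) *
    (decay a (θ k) t * δ k + ∫ s in θ k..min (θ (k + 1)) t, decay a s t * f s)

namespace LinearImpulsive

variable {a : ℝ → ℝ} {θ γ : ℤ → ℝ} {lo hi η η' A B : ℝ}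

lemma jumpProd_pos (h : LinearImpulsive a θ γ lo hi η η' A B) (i j : ℤ) : 0 < jumpProd γ i j :=
  Finset.prod_pos fun k _ => h.jump_pos k

lemma one_le_A (h : LinearImpulsive a θ γ lo hi η η' A B) : 1 ≤ A := by
  simpa [jumpProd_self] using h.jumpProd_le 0 0 le_rfl

lemma A_pos (h : LinearImpulsive a θ γ lo hi η η' A B) : 0 < A := one_pos.trans_le h.one_le_A

lemma lo_le_hi (h : LinearImpulsive a θ γ lo hi η η' A B) : lo ≤ hi := (h.lo_le 0).trans (h.le_hi 0)

lemma hi_pos (h : LinearImpulsive a θ γ lo hi η η' A B) : 0 < hi := h.lo_pos.trans_le h.lo_le_hi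

lemma η_le (h : LinearImpulsive a θ γ lo hi η η' A B) : η ≤ η' := (h.gap_ge 0).trans (h.gap_le 0)

lemma one_sub_exp_pos (h : LinearImpulsive a θ γ lo hi η η' A B) :
    0 < 1 - Real.exp (-lo * η) := by
  have := mul_pos h.lo_pos h.η_pos
  have : Real.exp (-lo * η) < 1 := by
    simpa using Real.exp_lt_exp.2 (show -lo * η < 0 by linarith)
  linarith

lemma gap_mul_le (h : LinearImpulsive a θ γ lo hi η η' A B) (k : ℤ) (j : ℕ) :
    j * η ≤ θ (k + j) - θ k := by
  induction j with
  | zero => simp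
  | succ j ih =>
    have := h.gap_ge (k + j)
    push_cast
    rw [← add_assoc]
    linarith

/-- The weighted partial values telescope, with increments the contributions. -/
lemma mild_telescope (h : LinearImpulsive a θ γ lo hi η η' A B) {f x : ℝ → ℝ} {δ : ℤ → ℝ}
    (hx : Mild a θ γ f δ x) {n : ℤ} {t : ℝ} (ht : t ∈ Ioc (θ n) (θ (n + 1))) {k : ℤ} (hk : k ≤ n) :
    jumpProd γ (k + 1) (n + 1) * decay a (min (θ (k + 1)) t) t * x (min (θ (k + 1)) t) =
      jumpProd γ k (n + 1) * decay a (θ k) t * x (θ k) + contribution a θ γ f δ n t k := by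
  have hm : min (θ (k + 1)) t ∈ Ioc (θ k) (θ (k + 1)) := by
    refine ⟨lt_min (h.strictMono (by omega)) ?_, min_le_left _ _⟩
    exact (h.strictMono.monotone hk).trans_lt ht.1
  rw [hx k _ hm, jumpProd_eq_mul_left γ (show k < n + 1 by omega), contribution]
  set r := min (θ (k + 1)) t
  have e1 : ∀ s, decay a r t * (decay a s r * f s) = decay a s t * f s := fun s => by
    rw [← decay_mul h.cont s r t]; ring
  have e2 : decay a r t * ∫ s in θ k..r, decay a s r * f s = ∫ s in θ k..r, decay a s t * f s := by
    rw [← intervalIntegral.integral_const_mul]; simp_rw [e1]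
  rw [← e2, ← decay_mul h.cont (θ k) r t]
  ring

/-- Comparison principle: a majorant of the contributions bounds the solution. -/
lemma mild_le_of_contribution_le (h : LinearImpulsive a θ γ lo hi η η' A B) {f x : ℝ → ℝ}
    {δ : ℤ → ℝ} (hx : Mild a θ γ f δ x) (hb : RecurrentlyBounded θ x)
    {n : ℤ} {t : ℝ} (ht : t ∈ Ioc (θ n) (θ (n + 1))) (V : ℤ → ℝ) (hV : Tendsto V atBot (𝓝 0))
    (hc : ∀ k ≤ n, contribution a θ γ f δ n t k ≤ V (k + 1) - V k) : x t ≤ V (n + 1) := by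
  -- Truncating at `t` treats the last, incomplete interval like the others: `y (n + 1)` has weight
  -- one and equals `x t`.
  set y : ℤ → ℝ := fun k => jumpProd γ k (n + 1) * decay a (min (θ k) t) t * x (min (θ k) t)
  have hmin : ∀ k ≤ n, min (θ k) t = θ k := fun k hk =>
    min_eq_left ((h.strictMono.monotone hk).trans ht.1.le)
  have step : ∀ k ≤ n, y (k + 1) - V (k + 1) ≤ y k - V k := by
    intro k hk
    have := h.mild_telescope hx ht hk
    have e : y (k + 1) = y k + contribution a θ γ f δ n t k := by
      simp only [y, hmin k hk]; exact this
    linarith [hc k hk]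
  have mono : ∀ j : ℕ, y (n + 1) - V (n + 1) ≤ y (n + 1 - j) - V (n + 1 - j) := by
    intro j
    induction j with
    | zero => simp
    | succ j ih =>
      refine ih.trans ?_
      have := step (n + 1 - (j + 1 : ℕ)) (by push_cast; omega)
      have e : n + 1 - ((j + 1 : ℕ) : ℤ) + 1 = n + 1 - j := by push_cast; ring
      rwa [e] at this
  have ytop : y (n + 1) = x t := by
    simp [y, min_eq_right ht.2, jumpProd_self, decay_self]
  obtain ⟨C, hC⟩ := hb
  have hCn : 0 ≤ C := by
    obtain ⟨k, _, hk⟩ := hC 0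
    exact (abs_nonneg _).trans hk
  have hlim : Tendsto (fun k : ℤ => A * Real.exp (-lo * (t - θ k)) * C) atBot (𝓝 0) := by
    have h1 : Tendsto (fun k : ℤ => -lo * (t - θ k)) atBot atBot := by
      refine Tendsto.const_mul_atTop_of_neg (by linarith [h.lo_pos]) ?_
      exact tendsto_atTop_add_const_left _ t (tendsto_neg_atBot_atTop.comp h.tendsto_atBot)
    simpa using ((Real.tendsto_exp_atBot.comp h1).const_mul A).mul_const C
  -- Since `y - V` does not increase with the index, it suffices to find one early index where both
  -- `y` and `V` are below `ε / 2`. Recurrent boundedness supplies an index for `y`, exponential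
  -- decay of the weights does the rest.
  refine le_of_forall_pos_le_add fun ε hε => ?_
  have ev : ∀ᶠ k in atBot, |V k| < ε / 2 ∧ A * Real.exp (-lo * (t - θ k)) * C < ε / 2 := by
    refine (?_ : ∀ᶠ k in atBot, |V k| < ε / 2).and (hlim.eventually_lt_const (half_pos hε))
    simpa using (hV.abs).eventually_lt_const (show |(0 : ℝ)| < ε / 2 by simpa using half_pos hε)
  obtain ⟨K, hK⟩ := eventually_atBot.1 ev
  obtain ⟨k, hkK, hk⟩ := hC (min K n)
  have hkn : k ≤ n := hkK.trans (min_le_right _ _)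
  obtain ⟨hV1, hV2⟩ := hK k (hkK.trans (min_le_left _ _))
  have hyk : |y k| ≤ A * Real.exp (-lo * (t - θ k)) * C := by
    simp only [y, hmin k hkn, abs_mul, abs_of_pos (h.jumpProd_pos _ _),
      abs_of_pos (decay_pos _ _ _)]
    have h1 := h.jumpProd_le k (n + 1) (by omega)
    have h2 := decay_le h.cont h.lo_le (show θ k ≤ t by
      exact (h.strictMono.monotone hkn).trans ht.1.le)
    have := h.jumpProd_pos k (n + 1)
    have := decay_pos a (θ k) t
    have := h.A_pos
    gcongr
  have := mono (n + 1 - k).toNat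
  rw [Int.toNat_of_nonneg (by omega), show n + 1 - (n + 1 - k) = k by ring, ytop] at this
  have := abs_lt.1 hV1
  have := abs_le.1 hyk
  linarith

end LinearImpulsive
-- Explicit upper and lower bounds for mild solutions.
lemma integrableOn_exp_scale {l : ℝ} (hl : 0 < l) (r t : ℝ) :
    MeasureTheory.IntegrableOn (fun u => Real.exp (-l * (t - u))) (Iic r) := by
  have e : (fun u => Real.exp (-l * (t - u))) = fun u => Real.exp (-l * t) * Real.exp (l * u) := by
    ext u; rw [← Real.exp_add]; ring_nf
  rw [e]
  exact (integrableOn_exp_mul_Iic hl r).const_mul _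

lemma integral_Iic_exp_scale {l : ℝ} (hl : 0 < l) (r t : ℝ) :
    ∫ u in Iic r, Real.exp (-l * (t - u)) = Real.exp (-l * (t - r)) / l := by
  have e : (fun u => Real.exp (-l * (t - u))) = fun u => Real.exp (-l * t) * Real.exp (l * u) := by
    ext u; rw [← Real.exp_add]; ring_nf
  rw [e, MeasureTheory.integral_const_mul, integral_exp_mul_Iic hl, mul_div_assoc', ← Real.exp_add]
  ring_nf

lemma integrableOn_exp_scale_mul {l : ℝ} (hl : 0 < l) (r t : ℝ) {R : ℝ → ℝ} (hR : Measurable R)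
    {K : ℝ} (hK : ∀ t, |R t| ≤ K) :
    MeasureTheory.IntegrableOn (fun u => Real.exp (-l * (t - u)) * R u) (Iic r) :=
  (integrableOn_exp_scale hl r t).mul_bdd hR.aestronglyMeasurable
    (Eventually.of_forall fun u => by simpa using hK u)

namespace LinearImpulsive

variable {a : ℝ → ℝ} {θ γ : ℤ → ℝ} {lo hi η η' A B : ℝ}

lemma tendsto_exp_atBot (h : LinearImpulsive a θ γ lo hi η η' A B) {l : ℝ} (hl : 0 < l) (t : ℝ) :
    Tendsto (fun k : ℤ => Real.exp (-l * (t - θ k))) atBot (𝓝 0) := by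
  refine Real.tendsto_exp_atBot.comp (Tendsto.const_mul_atTop_of_neg (by linarith) ?_)
  exact tendsto_atTop_add_const_left _ t (tendsto_neg_atBot_atTop.comp h.tendsto_atBot)

lemma tendsto_exp_pred_atBot (h : LinearImpulsive a θ γ lo hi η η' A B) {l : ℝ} (hl : 0 < l)
    (t : ℝ) : Tendsto (fun k : ℤ => Real.exp (-l * (t - θ (k - 1)))) atBot (𝓝 0) :=
  (h.tendsto_exp_atBot hl t).comp (tendsto_atBot_add_const_right _ (-1) tendsto_id)

lemma min_eq_eventually (h : LinearImpulsive a θ γ lo hi η η' A B) (t : ℝ) :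
    ∀ᶠ k in atBot, min (θ k) t = θ k :=
  (h.tendsto_atBot.eventually_le_atBot t).mono fun _ hk => min_eq_left hk

lemma tendsto_exp_min_atBot (h : LinearImpulsive a θ γ lo hi η η' A B) {l : ℝ} (hl : 0 < l)
    (t : ℝ) : Tendsto (fun k : ℤ => Real.exp (-l * (t - min (θ k) t))) atBot (𝓝 0) :=
  (h.tendsto_exp_atBot hl t).congr' ((h.min_eq_eventually t).mono fun k hk => by simp only [hk])

lemma min_mem (h : LinearImpulsive a θ γ lo hi η η' A B) {n k : ℤ} {t : ℝ}
    (ht : t ∈ Ioc (θ n) (θ (n + 1))) (hk : k ≤ n) :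
    θ k < min (θ (k + 1)) t ∧ min (θ (k + 1)) t ≤ t ∧ min (θ (k + 1)) t - θ k ≤ η'
      ∧ min (θ k) t = θ k ∧ θ k ≤ t := by
  have h1 : θ k < t := (h.strictMono.monotone hk).trans_lt ht.1
  refine ⟨lt_min (h.strictMono (by omega)) h1, min_le_right _ _, ?_, min_eq_left h1.le, h1.le⟩
  linarith [min_le_left (θ (k + 1)) t, h.gap_le k]

lemma le_mild_of_le_contribution (h : LinearImpulsive a θ γ lo hi η η' A B) {f x : ℝ → ℝ}
    {δ : ℤ → ℝ} (hx : Mild a θ γ f δ x) (hb : RecurrentlyBounded θ x)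
    {n : ℤ} {t : ℝ} (ht : t ∈ Ioc (θ n) (θ (n + 1))) (V : ℤ → ℝ) (hV : Tendsto V atBot (𝓝 0))
    (hc : ∀ k ≤ n, V (k + 1) - V k ≤ contribution a θ γ f δ n t k) : V (n + 1) ≤ x t := by
  have := h.mild_le_of_contribution_le hx.neg hb.neg ht (fun k => -V k) (by simpa using hV.neg)
    (fun k hk => by
      have e : contribution a θ γ (fun t => -f t) (fun k => -δ k) n t k
          = -contribution a θ γ f δ n t k := by
        simp only [contribution, mul_neg, intervalIntegral.integral_neg]; ring
      rw [e]; linarith [hc k hk])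
  linarith

/-- Gaps of length at least `η` shrink the weight by `exp (-lo * η)` per step back. The weight of an
impulse is therefore dominated by an increment of a telescoping sequence; this is the geometric
series behind `1 / (1 - exp (-lo * η))`. -/
lemma exp_pred_le (h : LinearImpulsive a θ γ lo hi η η' A B) (k : ℤ) (t : ℝ) :
    Real.exp (-lo * (t - θ k)) ≤
      (Real.exp (-lo * (t - θ k)) - Real.exp (-lo * (t - θ (k - 1)))) /
        (1 - Real.exp (-lo * η)) := by
  rw [le_div_iff₀ h.one_sub_exp_pos, mul_sub, mul_one, ← Real.exp_add]
  have : Real.exp (-lo * (t - θ (k - 1))) ≤ Real.exp (-lo * (t - θ k) + -lo * η) := by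
    refine Real.exp_le_exp.2 ?_
    have := h.gap_ge (k - 1)
    rw [sub_add_cancel] at this
    nlinarith [h.lo_pos]
  linarith

/-- Upper bound by weighted integrals of the inhomogeneity. -/
lemma mild_le_weighted (h : LinearImpulsive a θ γ lo hi η η' A B) {f x R : ℝ → ℝ} {δ : ℤ → ℝ}
    (hx : Mild a θ γ f δ x) (hb : RecurrentlyBounded θ x)
    (hf : Measurable f) {K : ℝ} (hK : ∀ t, |f t| ≤ K)
    (hR : Measurable R) {K' : ℝ} (hK' : ∀ t, |R t| ≤ K') (hR0 : ∀ t, 0 ≤ R t)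
    (hfR : ∀ t, f t ≤ R t) {ρ I : ℝ} (hρ : 0 ≤ ρ) (hδ : ∀ k, δ k ≤ ρ)
    (hI : ∀ t, ∫ s in Iic t, Real.exp (-lo * (t - s)) * R s ≤ I) (t : ℝ) :
    x t ≤ A * I + A * ρ / (1 - Real.exp (-lo * η)) := by
  obtain ⟨n, ht⟩ := exists_index h.strictMono h.tendsto_atTop h.tendsto_atBot t
  have hE := h.one_sub_exp_pos
  have hA := h.A_pos
  have hint := fun r => integrableOn_exp_scale_mul h.lo_pos r t hR hK'
  -- The majorant has one part for the inhomogeneity, the weighted integral up to `θ k`, and one for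
  -- the impulses. The shift to `θ (k - 1)` in the latter makes its increment at `k` the one in
  -- `exp_pred_le`.
  have key := h.mild_le_of_contribution_le hx hb ht
    (fun k => A * (∫ s in Iic (min (θ k) t), Real.exp (-lo * (t - s)) * R s)
      + A * ρ * (Real.exp (-lo * (t - θ (k - 1))) / (1 - Real.exp (-lo * η)))) ?_ ?_
  · refine key.trans ?_
    simp only [min_eq_right ht.2, add_sub_cancel_right]
    rw [div_eq_mul_one_div (A * ρ)]
    have : Real.exp (-lo * (t - θ n)) ≤ 1 := by
      refine Real.exp_le_one_iff.2 ?_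
      nlinarith [h.lo_pos, ht.1]
    gcongr
    exact hI t
  · have h1 : Tendsto (fun k : ℤ => ∫ s in Iic (min (θ k) t), Real.exp (-lo * (t - s)) * R s)
        atBot (𝓝 0) := by
      refine squeeze_zero (g := fun k => Real.exp (-lo * (t - min (θ k) t)) / lo * K') ?_ ?_ ?_
      · exact fun k => MeasureTheory.integral_nonneg fun s => mul_nonneg (Real.exp_pos _).le (hR0 s)
      · intro k
        rw [← integral_Iic_exp_scale h.lo_pos, ← MeasureTheory.integral_mul_const]
        refine MeasureTheory.integral_mono (hint _)
          ((integrableOn_exp_scale h.lo_pos _ t).mul_const _) fun s => ?_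
        exact mul_le_mul_of_nonneg_left ((le_abs_self _).trans (hK' s)) (Real.exp_pos _).le
      · simpa using ((h.tendsto_exp_min_atBot h.lo_pos t).div_const lo).mul_const K'
    simpa using (h1.const_mul A).add
      (((h.tendsto_exp_pred_atBot h.lo_pos t).div_const (1 - Real.exp (-lo * η))).const_mul (A * ρ))
  · intro k hk
    obtain ⟨h1, h2, -, h3, h4⟩ := h.min_mem ht hk
    simp only [h3, add_sub_cancel_right]
    set r := min (θ (k + 1)) t
    have e1 : (∫ s in Iic r, Real.exp (-lo * (t - s)) * R s)
        - ∫ s in Iic (θ k), Real.exp (-lo * (t - s)) * R s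
        = ∫ s in θ k..r, Real.exp (-lo * (t - s)) * R s :=
      intervalIntegral.integral_Iic_sub_Iic (hint _) (hint _)
    have e2 : ∫ s in θ k..r, decay a s t * f s ≤ ∫ s in θ k..r, Real.exp (-lo * (t - s)) * R s := by
      refine intervalIntegral.integral_mono_on h1.le
        (intervalIntegrable_decay_mul h.cont hf hK _ _ _)
        ((intervalIntegrable_of_bounded hR hK' _ _).continuousOn_mul
          (by fun_prop)) fun s hs => ?_
      have := decay_le h.cont h.lo_le (hs.2.trans h2)
      have h5 := decay_pos a s t
      calc decay a s t * f s ≤ decay a s t * R s := by gcongr; exact hfR s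
        _ ≤ _ := by gcongr; exact hR0 s
    have e3 : decay a (θ k) t * δ k ≤ Real.exp (-lo * (t - θ k)) * ρ := by
      have := decay_le h.cont h.lo_le h4
      have h5 := decay_pos a (θ k) t
      calc decay a (θ k) t * δ k ≤ decay a (θ k) t * ρ := by gcongr; exact hδ k
        _ ≤ _ := by gcongr
    have e4 : 0 ≤ ∫ s in θ k..r, Real.exp (-lo * (t - s)) * R s :=
      intervalIntegral.integral_nonneg h1.le fun s _ => mul_nonneg (Real.exp_pos _).le (hR0 s)
    have e5 := h.exp_pred_le k t
    have e6 := h.jumpProd_le (k + 1) (n + 1) (by omega)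
    have e7 := h.jumpProd_pos (k + 1) (n + 1)
    calc contribution a θ γ f δ n t k
        ≤ jumpProd γ (k + 1) (n + 1) * (Real.exp (-lo * (t - θ k)) * ρ
          + ∫ s in θ k..r, Real.exp (-lo * (t - s)) * R s) := by
          unfold contribution; gcongr
      _ ≤ A * (Real.exp (-lo * (t - θ k)) * ρ
          + ∫ s in θ k..r, Real.exp (-lo * (t - s)) * R s) := by gcongr
      _ ≤ A * ((Real.exp (-lo * (t - θ k)) - Real.exp (-lo * (t - θ (k - 1)))) /
        (1 - Real.exp (-lo * η)) * ρ
          + ∫ s in θ k..r, Real.exp (-lo * (t - s)) * R s) := by gcongr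
      _ = _ := by rw [← e1]; ring

lemma abs_mild_le_weighted (h : LinearImpulsive a θ γ lo hi η η' A B) {f x R : ℝ → ℝ} {δ : ℤ → ℝ}
    (hx : Mild a θ γ f δ x) (hb : RecurrentlyBounded θ x)
    (hf : Measurable f) {K : ℝ} (hK : ∀ t, |f t| ≤ K)
    (hR : Measurable R) {K' : ℝ} (hK' : ∀ t, |R t| ≤ K')
    (hfR : ∀ t, |f t| ≤ R t) {ρ I : ℝ} (hδ : ∀ k, |δ k| ≤ ρ)
    (hI : ∀ t, ∫ s in Iic t, Real.exp (-lo * (t - s)) * R s ≤ I) (t : ℝ) :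
    |x t| ≤ A * I + A * ρ / (1 - Real.exp (-lo * η)) := by
  have hR0 : ∀ t, 0 ≤ R t := fun t => (abs_nonneg _).trans (hfR t)
  have hρ : 0 ≤ ρ := (abs_nonneg _).trans (hδ 0)
  refine abs_le'.2 ⟨?_, ?_⟩
  · exact h.mild_le_weighted hx hb hf hK hR hK' hR0 (fun t => (le_abs_self _).trans (hfR t)) hρ
      (fun k => (le_abs_self _).trans (hδ k)) hI t
  · exact h.mild_le_weighted hx.neg hb.neg hf.neg (by simpa using hK) hR hK' hR0
      (fun t => (neg_le_abs _).trans (hfR t)) hρ (fun k => (neg_le_abs _).trans (hδ k)) hI t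

lemma mild_le_of_le_const (h : LinearImpulsive a θ γ lo hi η η' A B) {f x : ℝ → ℝ} {δ : ℤ → ℝ}
    (hx : Mild a θ γ f δ x) (hb : RecurrentlyBounded θ x)
    (hf : Measurable f) {K : ℝ} (hK : ∀ t, |f t| ≤ K) {F ρ : ℝ} (hF : 0 ≤ F)
    (hfF : ∀ t, f t ≤ F) (hρ : 0 ≤ ρ) (hδ : ∀ k, δ k ≤ ρ) (t : ℝ) :
    x t ≤ A / lo * F + A * ρ / (1 - Real.exp (-lo * η)) := by
  have := h.mild_le_weighted hx hb hf hK (R := fun _ => F) measurable_const (fun _ => le_rfl)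
    (fun _ => hF) hfF hρ hδ (I := F / lo) (fun t => by
      rw [MeasureTheory.integral_mul_const, integral_Iic_exp_scale h.lo_pos]
      simp [div_eq_inv_mul]) t
  convert this using 2
  ring

lemma abs_mild_le_of_abs_le_const (h : LinearImpulsive a θ γ lo hi η η' A B) {f x : ℝ → ℝ}
    {δ : ℤ → ℝ} (hx : Mild a θ γ f δ x) (hb : RecurrentlyBounded θ x)
    (hf : Measurable f) {F ρ : ℝ} (hfF : ∀ t, |f t| ≤ F) (hδ : ∀ k, |δ k| ≤ ρ) (t : ℝ) :
    |x t| ≤ A / lo * F + A * ρ / (1 - Real.exp (-lo * η)) := by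
  have hF : 0 ≤ F := (abs_nonneg _).trans (hfF 0)
  have hρ : 0 ≤ ρ := (abs_nonneg _).trans (hδ 0)
  refine abs_le'.2 ⟨?_, ?_⟩
  · exact h.mild_le_of_le_const hx hb hf hfF hF (fun t => (le_abs_self _).trans (hfF t)) hρ
      (fun k => (le_abs_self _).trans (hδ k)) t
  · exact h.mild_le_of_le_const hx.neg hb.neg hf.neg (by simpa using hfF) hF
      (fun t => (neg_le_abs _).trans (hfF t)) hρ (fun k => (neg_le_abs _).trans (hδ k)) t

/-- Upper bound when the inhomogeneity is negative: every impulse is grouped with the loss over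
the interval that follows it. -/
lemma mild_le_of_le_const_of_nonpos (h : LinearImpulsive a θ γ lo hi η η' A B) {f x : ℝ → ℝ}
    {δ : ℤ → ℝ} (hx : Mild a θ γ f δ x) (hb : RecurrentlyBounded θ x)
    (hf : Measurable f) {K : ℝ} (hK : ∀ t, |f t| ≤ K) {F D : ℝ} (hF : F ≤ 0)
    (hfF : ∀ t, f t ≤ F) (hδ : ∀ k, δ k ≤ D)
    (hD : 0 ≤ D + F * ((Real.exp (lo * η') - 1) / lo)) (t : ℝ) :
    x t ≤ A / lo * F + A * D / (1 - Real.exp (-lo * η)) := by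
  obtain ⟨n, ht⟩ := exists_index h.strictMono h.tendsto_atTop h.tendsto_atBot t
  have hE := h.one_sub_exp_pos
  have hA := h.A_pos
  have hlo := h.lo_pos
  have hD0 : 0 ≤ D := by
    have : 0 ≤ (Real.exp (lo * η') - 1) / lo := by
      have := Real.add_one_le_exp (lo * η')
      have := mul_pos hlo (h.η_pos.trans_le h.η_le)
      exact div_nonneg (by linarith) hlo.le
    nlinarith
  have key := h.mild_le_of_contribution_le hx hb ht
    (fun k => A / lo * F * Real.exp (-lo * (t - min (θ k) t))
      + A * D * (Real.exp (-lo * (t - θ (k - 1))) / (1 - Real.exp (-lo * η)))) ?_ ?_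
  · refine key.trans ?_
    simp only [min_eq_right ht.2, add_sub_cancel_right]
    rw [div_eq_mul_one_div (A * D), sub_self, mul_zero, Real.exp_zero, mul_one]
    have : Real.exp (-lo * (t - θ n)) ≤ 1 := by
      refine Real.exp_le_one_iff.2 ?_
      nlinarith [h.lo_pos, ht.1]
    gcongr
  · simpa using ((h.tendsto_exp_min_atBot h.lo_pos t).const_mul (A / lo * F)).add
      (((h.tendsto_exp_pred_atBot h.lo_pos t).div_const (1 - Real.exp (-lo * η))).const_mul (A * D))
  · intro k hk
    obtain ⟨h1, h2, h2', h3, h4⟩ := h.min_mem ht hk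
    simp only [h3, add_sub_cancel_right]
    have e6 := h.jumpProd_le (k + 1) (n + 1) (by omega)
    have e7 := h.jumpProd_pos (k + 1) (n + 1)
    unfold contribution
    set r := min (θ (k + 1)) t
    set w := Real.exp (-lo * (t - θ k))
    have hw : 0 < w := Real.exp_pos _
    set G := (Real.exp (lo * (r - θ k)) - 1) / lo
    have hG : ∫ s in θ k..r, Real.exp (-lo * (θ k - s)) = G := by
      rw [integral_exp_scale hlo.ne', show -lo * (θ k - r) = lo * (r - θ k) by ring, sub_self,
        mul_zero, Real.exp_zero]
    have hG' : Real.exp (-lo * (t - r)) - w = lo * (w * G) := by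
      have : Real.exp (-lo * (t - r)) = w * Real.exp (lo * (r - θ k)) := by
        rw [← Real.exp_add]; ring_nf
      rw [this]; simp only [G]; field_simp
    -- Pulling `decay a (θ k) t` out of the interval leaves the backward propagator, which is at
    -- least `exp (lo * (s - θ k))`. Multiplied by `F ≤ 0`, this lower bound becomes an upper bound.
    have e2 : ∫ s in θ k..r, decay a s (θ k) * f s ≤ G * F := by
      rw [← hG, ← intervalIntegral.integral_mul_const]
      refine intervalIntegral.integral_mono_on h1.le
        (intervalIntegrable_decay_mul h.cont hf hK _ _ _)
        ((by fun_prop : Continuous _).intervalIntegrable _ _) fun s hs => ?_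
      have := decay_le h.cont h.lo_le hs.1
      rw [decay_symm]
      have h5 := decay_pos a (θ k) s
      have : Real.exp (-lo * (θ k - s)) ≤ (decay a (θ k) s)⁻¹ := by
        rw [show -lo * (θ k - s) = -(-lo * (s - θ k)) by ring, Real.exp_neg]
        gcongr
      calc (decay a (θ k) s)⁻¹ * f s ≤ (decay a (θ k) s)⁻¹ * F := by gcongr; exact hfF s
        _ ≤ _ := mul_le_mul_of_nonpos_right this hF
    have e3 : ∫ s in θ k..r, decay a s t * f s
        = decay a (θ k) t * ∫ s in θ k..r, decay a s (θ k) * f s := by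
      rw [← intervalIntegral.integral_const_mul]
      congr 1; ext s
      rw [← decay_mul h.cont s (θ k) t]; ring
    -- Impulse plus loss is nonnegative even over the longest gap, so enlarging the weights to `A`
    -- and `w` enlarges the product. The loss alone would not allow this.
    have hP : 0 ≤ D + G * F := by
      have : G ≤ (Real.exp (lo * η') - 1) / lo := by simp only [G]; gcongr
      nlinarith
    have hd := decay_le h.cont h.lo_le h4
    have hdp := decay_pos a (θ k) t
    have e5 := h.exp_pred_le k t
    rw [e3]
    calc jumpProd γ (k + 1) (n + 1) * (decay a (θ k) t * δ k
          + decay a (θ k) t * ∫ s in θ k..r, decay a s (θ k) * f s)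
        = jumpProd γ (k + 1) (n + 1) * (decay a (θ k) t * (δ k
          + ∫ s in θ k..r, decay a s (θ k) * f s)) := by ring
      _ ≤ jumpProd γ (k + 1) (n + 1) * (decay a (θ k) t * (D + G * F)) := by
          gcongr; exact hδ k
      _ ≤ A * (w * (D + G * F)) := by gcongr
      _ = A / lo * F * (Real.exp (-lo * (t - r)) - w) + A * D * w := by
          rw [hG']; field_simp; ring
      _ ≤ A / lo * F * (Real.exp (-lo * (t - r)) - w) + A * D *
          ((w - Real.exp (-lo * (t - θ (k - 1)))) / (1 - Real.exp (-lo * η))) := by gcongr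
      _ = _ := by ring

/-- The counterpart of `exp_pred_le` for lower bounds: over a gap of at most `η'` the weight grows
by a factor of at most `exp (l * η')`, so an impulse weight dominates a fixed multiple of the next
increment. -/
lemma exp_succ_sub_le (h : LinearImpulsive a θ γ lo hi η η' A B) {l : ℝ} (hl : 0 < l)
    {s r t : ℝ} (hr : r - s ≤ η') :
    (Real.exp (-l * (t - r)) - Real.exp (-l * (t - s))) *
      (Real.exp (-l * η') / (1 - Real.exp (-l * η'))) ≤ Real.exp (-l * (t - s)) := by
  have hlη : 0 < l * η' := mul_pos hl (h.η_pos.trans_le h.η_le)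
  have hE : 0 < 1 - Real.exp (-l * η') := by
    have : Real.exp (-l * η') < 1 := by
      simpa using Real.exp_lt_exp.2 (show -l * η' < 0 by linarith)
    linarith
  rw [mul_div_assoc', div_le_iff₀ hE, sub_mul, ← Real.exp_add]
  have : Real.exp (-l * (t - r) + -l * η') ≤ Real.exp (-l * (t - s)) := by
    refine Real.exp_le_exp.2 ?_
    nlinarith
  linarith

/-- Lower bound when impulses and inhomogeneity are bounded below in the grouped sense. -/
lemma le_mild_of_grouped (h : LinearImpulsive a θ γ lo hi η η' A B) {f x : ℝ → ℝ}
    {δ : ℤ → ℝ} (hx : Mild a θ γ f δ x) (hb : RecurrentlyBounded θ x) {S D : ℝ} (hD : 0 ≤ D)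
    (hc : ∀ n, ∀ t ∈ Ioc (θ n) (θ (n + 1)), ∀ k ≤ n,
      B * (Real.exp (-hi * (t - θ k)) * D
        + S * ∫ s in θ k..min (θ (k + 1)) t, Real.exp (-hi * (t - s)))
        ≤ contribution a θ γ f δ n t k) (t : ℝ) :
    B / hi * S + B * D * Real.exp (-hi * η') / (1 - Real.exp (-hi * η')) ≤ x t := by
  obtain ⟨n, ht⟩ := exists_index h.strictMono h.tendsto_atTop h.tendsto_atBot t
  have hhi := h.hi_pos
  have hB := h.B_pos
  set c := Real.exp (-hi * η') / (1 - Real.exp (-hi * η'))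
  -- A single exponential suffices as minorant: the integral in `hc` is exactly its increment
  -- divided by `hi`, and the impulse weight is at least `c` times that increment.
  have key := h.le_mild_of_le_contribution hx hb ht
    (fun k => (B / hi * S + B * D * c) * Real.exp (-hi * (t - min (θ k) t))) ?_ ?_
  · refine le_trans (le_of_eq ?_) key
    simp [min_eq_right ht.2, c, mul_div_assoc]
  · simpa using (h.tendsto_exp_min_atBot hhi t).const_mul (B / hi * S + B * D * c)
  · intro k hk
    refine le_trans ?_ (hc n t ht k hk)
    obtain ⟨h1, h2, h2', h3, h4⟩ := h.min_mem ht hk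
    simp only [h3]
    rw [integral_exp_scale hhi.ne']
    have := h.exp_succ_sub_le hhi (t := t) h2'
    set r := min (θ (k + 1)) t
    set w := Real.exp (-hi * (t - θ k))
    set w' := Real.exp (-hi * (t - r))
    calc (B / hi * S + B * D * c) * w' - (B / hi * S + B * D * c) * w
        = B * S * ((w' - w) / hi) + B * D * ((w' - w) * c) := by ring
      _ ≤ B * S * ((w' - w) / hi) + B * D * w := by gcongr
      _ = _ := by ring

lemma le_mild_of_const_le (h : LinearImpulsive a θ γ lo hi η η' A B) {f x : ℝ → ℝ}
    {δ : ℤ → ℝ} (hx : Mild a θ γ f δ x) (hb : RecurrentlyBounded θ x)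
    (hf : Measurable f) {K : ℝ} (hK : ∀ t, |f t| ≤ K) {S D : ℝ} (hS : 0 ≤ S)
    (hfS : ∀ t, S ≤ f t) (hD : 0 ≤ D) (hδ : ∀ k, D ≤ δ k) (t : ℝ) :
    B / hi * S + B * D * Real.exp (-hi * η') / (1 - Real.exp (-hi * η')) ≤ x t := by
  refine h.le_mild_of_grouped hx hb hD (fun n t ht k hk => ?_) t
  obtain ⟨h1, h2, h2', h3, h4⟩ := h.min_mem ht hk
  have e6 := h.le_jumpProd (k + 1) (n + 1) (by omega)
  have e7 := h.jumpProd_pos (k + 1) (n + 1)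
  have hB := h.B_pos
  unfold contribution
  set r := min (θ (k + 1)) t
  have e2 : ∫ s in θ k..r, S * Real.exp (-hi * (t - s)) ≤ ∫ s in θ k..r, decay a s t * f s := by
    refine intervalIntegral.integral_mono_on h1.le
      ((by fun_prop : Continuous _).intervalIntegrable _ _)
      (intervalIntegrable_decay_mul h.cont hf hK _ _ _) fun s hs => ?_
    have := le_decay h.cont h.le_hi (hs.2.trans h2)
    have h5 := decay_pos a s t
    rw [mul_comm]
    gcongr; exact hfS s
  have e4 : 0 ≤ ∫ s in θ k..r, S * Real.exp (-hi * (t - s)) :=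
    intervalIntegral.integral_nonneg h1.le fun s _ => mul_nonneg hS (Real.exp_pos _).le
  have e3 := le_decay h.cont h.le_hi h4
  have e8 := decay_pos a (θ k) t
  rw [← intervalIntegral.integral_const_mul]
  gcongr
  exact hδ k

/-- Lower bound when the inhomogeneity may be negative: every impulse is grouped with the loss
over the interval that follows it. -/
lemma le_mild_of_const_le_of_nonpos (h : LinearImpulsive a θ γ lo hi η η' A B) {f x : ℝ → ℝ}
    {δ : ℤ → ℝ} (hx : Mild a θ γ f δ x) (hb : RecurrentlyBounded θ x)
    (hf : Measurable f) {K : ℝ} (hK : ∀ t, |f t| ≤ K) {S D : ℝ} (hS : S ≤ 0)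
    (hfS : ∀ t, S ≤ f t) (hδ : ∀ k, D ≤ δ k)
    (hD : 0 ≤ D + S * ((Real.exp (hi * η') - 1) / hi)) (t : ℝ) :
    B / hi * S + B * D * Real.exp (-hi * η') / (1 - Real.exp (-hi * η')) ≤ x t := by
  have hhi := h.hi_pos
  have hD0 : 0 ≤ D := by
    have : 0 ≤ (Real.exp (hi * η') - 1) / hi := by
      have := Real.add_one_le_exp (hi * η')
      have := mul_pos hhi (h.η_pos.trans_le h.η_le)
      exact div_nonneg (by linarith) hhi.le
    nlinarith
  refine h.le_mild_of_grouped hx hb hD0 (fun n t ht k hk => ?_) t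
  obtain ⟨h1, h2, h2', h3, h4⟩ := h.min_mem ht hk
  have e6 := h.le_jumpProd (k + 1) (n + 1) (by omega)
  have e7 := h.jumpProd_pos (k + 1) (n + 1)
  have hB := h.B_pos
  unfold contribution
  set r := min (θ (k + 1)) t
  set w := Real.exp (-hi * (t - θ k))
  have hw : 0 < w := Real.exp_pos _
  set G := (Real.exp (hi * (r - θ k)) - 1) / hi
  have hG : ∫ s in θ k..r, Real.exp (-hi * (θ k - s)) = G := by
    rw [integral_exp_scale hhi.ne', show -hi * (θ k - r) = hi * (r - θ k) by ring, sub_self,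
      mul_zero, Real.exp_zero]
  have hG' : ∫ s in θ k..r, Real.exp (-hi * (t - s)) = w * G := by
    rw [← hG, ← intervalIntegral.integral_const_mul]
    congr 1; ext s
    rw [← Real.exp_add]; ring_nf
  have e2 : G * S ≤ ∫ s in θ k..r, decay a s (θ k) * f s := by
    rw [← hG, ← intervalIntegral.integral_mul_const]
    refine intervalIntegral.integral_mono_on h1.le
      ((by fun_prop : Continuous _).intervalIntegrable _ _)
      (intervalIntegrable_decay_mul h.cont hf hK _ _ _) fun s hs => ?_
    have := le_decay h.cont h.le_hi hs.1
    rw [decay_symm]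
    have h5 := decay_pos a (θ k) s
    have : (decay a (θ k) s)⁻¹ ≤ Real.exp (-hi * (θ k - s)) := by
      rw [show -hi * (θ k - s) = -(-hi * (s - θ k)) by ring, Real.exp_neg]
      gcongr
    calc Real.exp (-hi * (θ k - s)) * S ≤ (decay a (θ k) s)⁻¹ * S :=
          mul_le_mul_of_nonpos_right this hS
      _ ≤ _ := by gcongr; exact hfS s
  have e3 : ∫ s in θ k..r, decay a s t * f s
      = decay a (θ k) t * ∫ s in θ k..r, decay a s (θ k) * f s := by
    rw [← intervalIntegral.integral_const_mul]
    congr 1; ext s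
    rw [← decay_mul h.cont s (θ k) t]; ring
  have hP : 0 ≤ D + G * S := by
    have : G ≤ (Real.exp (hi * η') - 1) / hi := by simp only [G]; gcongr
    nlinarith
  have hd := le_decay h.cont h.le_hi h4
  have hdp := decay_pos a (θ k) t
  rw [e3, hG']
  calc B * (w * D + S * (w * G)) = B * (w * (D + G * S)) := by ring
    _ ≤ jumpProd γ (k + 1) (n + 1) * (decay a (θ k) t * (D + G * S)) := by gcongr
    _ ≤ jumpProd γ (k + 1) (n + 1) * (decay a (θ k) t * (δ k
          + ∫ s in θ k..r, decay a s (θ k) * f s)) := by gcongr; exact hδ k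
    _ = _ := by ring

/-- Lower bound when the impulses may be negative. -/
lemma le_mild_of_const_le_of_impulses_nonpos (h : LinearImpulsive a θ γ lo hi η η' A B)
    {f x : ℝ → ℝ} {δ : ℤ → ℝ} (hx : Mild a θ γ f δ x) (hb : RecurrentlyBounded θ x)
    (hf : Measurable f) {K : ℝ} (hK : ∀ t, |f t| ≤ K) {S D : ℝ} (hS : 0 ≤ S)
    (hfS : ∀ t, S ≤ f t) (hD : D ≤ 0) (hδ : ∀ k, D ≤ δ k) (t : ℝ) :
    B / hi * S + A * D / (1 - Real.exp (-lo * η)) ≤ x t := by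
  obtain ⟨n, ht⟩ := exists_index h.strictMono h.tendsto_atTop h.tendsto_atBot t
  have hhi := h.hi_pos
  have hB := h.B_pos
  have hA := h.A_pos
  have hE := h.one_sub_exp_pos
  -- The worst cases differ: the gain is weighted by `B` and the fast rate `hi`, the negative
  -- impulses by `A` and the slow rate `lo`.
  have key := h.le_mild_of_le_contribution hx hb ht
    (fun k => B / hi * S * Real.exp (-hi * (t - min (θ k) t))
      + A * D * (Real.exp (-lo * (t - θ (k - 1))) / (1 - Real.exp (-lo * η)))) ?_ ?_
  · refine le_trans ?_ key
    simp only [min_eq_right ht.2, add_sub_cancel_right]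
    rw [div_eq_mul_one_div (A * D), sub_self, mul_zero, Real.exp_zero, mul_one]
    have h1 : Real.exp (-lo * (t - θ n)) ≤ 1 := by
      refine Real.exp_le_one_iff.2 ?_
      nlinarith [h.lo_pos, ht.1]
    have h2 : Real.exp (-lo * (t - θ n)) / (1 - Real.exp (-lo * η))
        ≤ 1 / (1 - Real.exp (-lo * η)) := by gcongr
    have h3 : A * D ≤ 0 := mul_nonpos_of_nonneg_of_nonpos hA.le hD
    linarith [mul_le_mul_of_nonpos_left h2 h3]
  · simpa using ((h.tendsto_exp_min_atBot hhi t).const_mul (B / hi * S)).add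
      (((h.tendsto_exp_pred_atBot h.lo_pos t).div_const (1 - Real.exp (-lo * η))).const_mul (A * D))
  · intro k hk
    obtain ⟨h1, h2, h2', h3, h4⟩ := h.min_mem ht hk
    simp only [h3, add_sub_cancel_right]
    have e6 := h.le_jumpProd (k + 1) (n + 1) (by omega)
    have e6' := h.jumpProd_le (k + 1) (n + 1) (by omega)
    have e7 := h.jumpProd_pos (k + 1) (n + 1)
    unfold contribution
    set r := min (θ (k + 1)) t
    have e0 := integral_exp_scale hhi.ne' (θ k) r t
    have e2 : S * ∫ s in θ k..r, Real.exp (-hi * (t - s)) ≤ ∫ s in θ k..r, decay a s t * f s := by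
      rw [← intervalIntegral.integral_const_mul]
      refine intervalIntegral.integral_mono_on h1.le
        ((by fun_prop : Continuous _).intervalIntegrable _ _)
        (intervalIntegrable_decay_mul h.cont hf hK _ _ _) fun s hs => ?_
      have := le_decay h.cont h.le_hi (hs.2.trans h2)
      have h5 := decay_pos a s t
      rw [mul_comm]
      gcongr; exact hfS s
    have e4 : 0 ≤ S * ∫ s in θ k..r, Real.exp (-hi * (t - s)) :=
      mul_nonneg hS (intervalIntegral.integral_nonneg h1.le fun s _ => (Real.exp_pos _).le)
    have e3 := decay_le h.cont h.lo_le h4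
    have e8 := decay_pos a (θ k) t
    have e5 := h.exp_pred_le k t
    have e9 : A * D * ((Real.exp (-lo * (t - θ k)) - Real.exp (-lo * (t - θ (k - 1)))) /
        (1 - Real.exp (-lo * η))) ≤ jumpProd γ (k + 1) (n + 1) * (decay a (θ k) t * δ k) := by
      have i1 : jumpProd γ (k + 1) (n + 1) * decay a (θ k) t
          ≤ A * ((Real.exp (-lo * (t - θ k)) - Real.exp (-lo * (t - θ (k - 1)))) /
        (1 - Real.exp (-lo * η))) :=
        mul_le_mul e6' (e3.trans e5) e8.le hA.le
      have i2 := mul_le_mul_of_nonpos_right i1 hD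
      have i3 := mul_le_mul_of_nonneg_left (hδ k) (mul_pos e7 e8).le
      linarith
    have e10 : B * (S * ∫ s in θ k..r, Real.exp (-hi * (t - s)))
        ≤ jumpProd γ (k + 1) (n + 1) * ∫ s in θ k..r, decay a s t * f s := by gcongr
    rw [e0] at e10
    calc _ = B * (S * ((Real.exp (-hi * (t - r)) - Real.exp (-hi * (t - θ k))) / hi))
          + A * D * ((Real.exp (-lo * (t - θ k)) - Real.exp (-lo * (t - θ (k - 1)))) /
        (1 - Real.exp (-lo * η))) := by ring
      _ ≤ _ := by rw [mul_add]; linarith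

end LinearImpulsive
/-! ### Existence of bounded mild solutions -/

namespace LinearImpulsive

variable {a : ℝ → ℝ} {θ γ : ℤ → ℝ} {lo hi η η' A B : ℝ}

lemma decay_le_one (h : LinearImpulsive a θ γ lo hi η η' A B) {s t : ℝ} (hst : s ≤ t) :
    decay a s t ≤ 1 := by
  refine (decay_le h.cont h.lo_le hst).trans (Real.exp_le_one_iff.2 ?_)
  nlinarith [h.lo_pos]

lemma abs_integral_decay_mul_le (h : LinearImpulsive a θ γ lo hi η η' A B) {f : ℝ → ℝ} {K : ℝ}
    (hK : ∀ t, |f t| ≤ K) {s t : ℝ} (hst : s ≤ t) :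
    |∫ r in s..t, decay a r t * f r| ≤ K * (t - s) := by
  have := intervalIntegral.norm_integral_le_of_norm_le_const (a := s) (b := t)
    (f := fun r => decay a r t * f r) (C := K) (fun r hr => by
      rw [uIoc_of_le hst] at hr
      rw [Real.norm_eq_abs, abs_mul, abs_of_pos (decay_pos _ _ _)]
      calc decay a r t * |f r| ≤ 1 * |f r| := by gcongr; exact h.decay_le_one hr.2
        _ ≤ K := by rw [one_mul]; exact hK r)
  rwa [Real.norm_eq_abs, abs_of_nonneg (sub_nonneg.2 hst)] at this

/-- A two-sided linear recursion with exponentially stable homogeneous part has a bounded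
solution. -/
lemma exists_bounded_recursion (h : LinearImpulsive a θ γ lo hi η η' A B) {e : ℤ → ℝ} {E : ℝ}
    (he : ∀ k, |e k| ≤ E) :
    ∃ v : ℤ → ℝ, (∃ C, ∀ k, |v k| ≤ C) ∧
      ∀ k, v (k + 1) = decay a (θ k) (θ (k + 1)) * (1 + γ k) * v k + e k := by
  have hρ1 : Real.exp (-lo * η) < 1 := by linarith [h.one_sub_exp_pos]
  set ρ := Real.exp (-lo * η)
  have hρ0 : 0 ≤ ρ := (Real.exp_pos _).le
  -- `u k j` is the source at index `k - 1 - j` transported to index `k`. It is bounded by a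
  -- geometric sequence, and the term `j = 0` of the sum at `k + 1` is the new source `e k`.
  let u : ℤ → ℕ → ℝ := fun k j =>
    jumpProd γ (k - j) k * decay a (θ (k - j)) (θ k) * e (k - 1 - j)
  have hu : ∀ k j, ‖u k j‖ ≤ A * E * ρ ^ j := by
    intro k j
    simp only [u, norm_mul, Real.norm_eq_abs, abs_of_pos (h.jumpProd_pos _ _),
      abs_of_pos (decay_pos _ _ _)]
    have h1 := h.jumpProd_le (k - j) k (by omega)
    have h2 : decay a (θ (k - j)) (θ k) ≤ ρ ^ j := by
      refine (decay_le h.cont h.lo_le (h.strictMono.monotone (by omega))).trans ?_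
      simp only [ρ, ← Real.exp_nat_mul]
      refine Real.exp_le_exp.2 ?_
      have := h.gap_mul_le (k - j) j
      rw [sub_add_cancel] at this
      nlinarith [h.lo_pos]
    have := h.jumpProd_pos (k - j) k
    have := decay_pos a (θ (k - j)) (θ k)
    have := h.A_pos
    calc _ ≤ A * ρ ^ j * E := by gcongr; exact he _
      _ = _ := by ring
  have hsum : Summable fun j : ℕ => A * E * ρ ^ j :=
    (summable_geometric_of_lt_one hρ0 hρ1).mul_left _
  refine ⟨fun k => ∑' j, u k j, ⟨∑' j : ℕ, A * E * ρ ^ j, fun k => ?_⟩, fun k => ?_⟩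
  · exact tsum_of_norm_bounded hsum.hasSum (hu k)
  · have hs : ∀ k, Summable (u k) := fun k => Summable.of_norm_bounded hsum (hu k)
    beta_reduce
    rw [(hs (k + 1)).tsum_eq_zero_add, ← tsum_mul_left, add_comm]
    congr 1
    · congr 1; ext j
      simp only [u]
      have e1 : k + 1 - ((j + 1 : ℕ) : ℤ) = k - j := by push_cast; ring
      have e2 : k + 1 - 1 - ((j + 1 : ℕ) : ℤ) = k - 1 - j := by push_cast; ring
      rw [e1, e2, jumpProd_eq_mul_right γ (by omega : k - (j : ℤ) ≤ k),
        ← decay_mul h.cont (θ (k - j)) (θ k) (θ (k + 1))]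
      ring
    · simp [u, jumpProd_self, decay_self]

/-- The values at impulse times determine the solution and satisfy a linear recursion, so a bounded
solution of the recursion is extended over the intervals. -/
lemma exists_mild (h : LinearImpulsive a θ γ lo hi η η' A B) {f : ℝ → ℝ} {δ : ℤ → ℝ}
    {K D : ℝ} (hK : ∀ t, |f t| ≤ K) (hD : ∀ k, |δ k| ≤ D) :
    ∃ x, Mild a θ γ f δ x ∧ RecurrentlyBounded θ x := by
  have hidx := exists_index h.strictMono h.tendsto_atTop h.tendsto_atBot
  choose n hn using hidx
  set e : ℤ → ℝ := fun k => decay a (θ k) (θ (k + 1)) * δ k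
    + ∫ s in θ k..θ (k + 1), decay a s (θ (k + 1)) * f s
  have hK0 : 0 ≤ K := (abs_nonneg _).trans (hK 0)
  have he : ∀ k, |e k| ≤ D + K * η' := by
    intro k
    have hk : θ k ≤ θ (k + 1) := h.strictMono.monotone (by omega)
    refine (abs_add_le _ _).trans (add_le_add ?_ ?_)
    · rw [abs_mul, abs_of_pos (decay_pos _ _ _)]
      calc _ ≤ 1 * |δ k| := by gcongr; exact h.decay_le_one hk
        _ ≤ D := by rw [one_mul]; exact hD k
    · exact (h.abs_integral_decay_mul_le hK hk).trans
        (mul_le_mul_of_nonneg_left (h.gap_le k) hK0)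
  obtain ⟨v, ⟨C, hC⟩, hv⟩ := h.exists_bounded_recursion he
  set x : ℝ → ℝ := fun t => decay a (θ (n t)) t * ((1 + γ (n t)) * v (n t) + δ (n t))
    + ∫ s in θ (n t)..t, decay a s t * f s
  -- The intervals are closed on the right, so `θ k` has index `k - 1` and consistency is the
  -- recursion at `k - 1`.
  have hxθ : ∀ k, x (θ k) = v k := by
    intro k
    have hk : n (θ k) = k - 1 := index_unique h.strictMono (hn (θ k))
      ⟨h.strictMono (by omega), by rw [sub_add_cancel]⟩
    have := hv (k - 1)
    simp only [e, sub_add_cancel] at this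
    rw [this]; simp only [x, hk]; ring
  refine ⟨x, fun k t ht => ?_, C, fun K => ⟨K, le_rfl, by rw [hxθ]; exact hC K⟩⟩
  have hk : n t = k := index_unique h.strictMono (hn t) ht
  rw [hxθ]; simp only [x, hk]

end LinearImpulsive

/-! ### Regularity of mild solutions -/

/-- The continuous extension to `ℝ` of a mild solution on the interval of index `k`, where `c` is
its right limit at `s = θ k`. -/
noncomputable def mildBranch (a f : ℝ → ℝ) (s c t : ℝ) : ℝ :=
  decay a s t * (c + ∫ r in s..t, decay a r s * f r)

lemma Mild.eq_branch {a : ℝ → ℝ} (ha : Continuous a) {θ γ : ℤ → ℝ} {f x : ℝ → ℝ} {δ : ℤ → ℝ}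
    (h : Mild a θ γ f δ x) {k : ℤ} {t : ℝ} (ht : t ∈ Ioc (θ k) (θ (k + 1))) :
    x t = mildBranch a f (θ k) ((1 + γ k) * x (θ k) + δ k) t := by
  rw [h k t ht, mildBranch, mul_add (decay a (θ k) t) ((1 + γ k) * x (θ k) + δ k),
    ← intervalIntegral.integral_const_mul]
  congr 2; ext s
  rw [← decay_mul ha s (θ k) t]; ring

lemma continuous_mildBranch {a : ℝ → ℝ} (ha : Continuous a) {f : ℝ → ℝ} (hf : Measurable f)
    {K : ℝ} (hK : ∀ t, |f t| ≤ K) (s c : ℝ) : Continuous (mildBranch a f s c) :=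
  (continuous_decay_right ha s).mul (continuous_const.add
    (intervalIntegral.continuous_primitive
      (fun u v => intervalIntegrable_decay_mul ha hf hK u v s) s))

/-- The set `S` is left general so that `Iic t` gives the left derivative and `univ` the two-sided
one. -/
lemma hasDerivWithinAt_mildBranch {a : ℝ → ℝ} (ha : Continuous a) {f : ℝ → ℝ} (hf : Measurable f)
    {K : ℝ} (hK : ∀ t, |f t| ≤ K) (s c t : ℝ) (S : Set ℝ)
    [intervalIntegral.FTCFilter t (𝓝[S] t) (𝓝[S] t)] (hc : ContinuousWithinAt f S t) :
    HasDerivWithinAt (mildBranch a f s c) (-a t * mildBranch a f s c t + f t) S t := by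
  have hm : Measurable fun r => decay a r s * f r :=
    (continuous_decay_left ha s).measurable.mul hf
  have h1 := intervalIntegral.integral_hasDerivWithinAt_right (s := S) (t := S)
    (intervalIntegrable_decay_mul ha hf hK s t s)
    ⟨univ, univ_mem, hm.aestronglyMeasurable⟩
    ((continuous_decay_left ha s).continuousAt.continuousWithinAt.mul hc)
  have h2 : HasDerivWithinAt (mildBranch a f s c) _ S t :=
    ((hasDerivAt_decay_right ha s t).hasDerivWithinAt (s := S)).mul (h1.const_add c)
  refine h2.congr_deriv ?_
  have : decay a s t * decay a t s = 1 := by rw [decay_mul ha, decay_self]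
  simp only [mildBranch]
  linear_combination (f t) * this

section

variable {a : ℝ → ℝ} {θ γ : ℤ → ℝ} {lo hi η η' A B : ℝ} {f x : ℝ → ℝ} {δ : ℤ → ℝ} {K : ℝ}

lemma LinearImpulsive.plc_mild (h : LinearImpulsive a θ γ lo hi η η' A B)
    (hf : Measurable f) (hK : ∀ t, |f t| ≤ K) (hx : Mild a θ γ f δ x) :
    PLC θ x ∧ ∀ k, Tendsto x (𝓝[>] (θ k)) (𝓝 (x (θ k) + (γ k * x (θ k) + δ k))) := by
  have hcont := fun s c => continuous_mildBranch h.cont hf hK s c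
  have hjump : ∀ k, Tendsto x (𝓝[>] (θ k)) (𝓝 (x (θ k) + (γ k * x (θ k) + δ k))) := by
    intro k
    set c := (1 + γ k) * x (θ k) + δ k
    have h1 : Tendsto (mildBranch a f (θ k) c) (𝓝[>] (θ k)) (𝓝 c) := by
      have := (hcont (θ k) c).continuousAt (x := θ k) |>.tendsto
      simp only [mildBranch, decay_self, intervalIntegral.integral_same, add_zero, one_mul] at this
      exact this.mono_left nhdsWithin_le_nhds
    have h2 : x (θ k) + (γ k * x (θ k) + δ k) = c := by simp only [c]; ring
    rw [h2]
    refine h1.congr' ?_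
    filter_upwards [Ioc_mem_nhdsGT (h.strictMono (show k < k + 1 by omega))] with t ht
    exact (hx.eq_branch h.cont ht).symm
  refine ⟨⟨fun t ht => ?_, fun k => ?_, fun k => ⟨_, hjump k⟩⟩, hjump⟩
  · obtain ⟨k, hk⟩ := exists_index h.strictMono h.tendsto_atTop h.tendsto_atBot t
    have hk' : t ∈ Ioo (θ k) (θ (k + 1)) :=
      ⟨hk.1, lt_of_le_of_ne hk.2 fun e => ht ⟨k + 1, e.symm⟩⟩
    refine (hcont (θ k) ((1 + γ k) * x (θ k) + δ k)).continuousAt.congr ?_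
    filter_upwards [Ioo_mem_nhds hk'.1 hk'.2] with s hs
    exact (hx.eq_branch h.cont ⟨hs.1, hs.2.le⟩).symm
  · have hk : θ k ∈ Ioc (θ (k - 1)) (θ (k - 1 + 1)) :=
      ⟨h.strictMono (by omega), by rw [sub_add_cancel]⟩
    rw [hx.eq_branch h.cont hk]
    refine ((hcont _ _).continuousAt.tendsto.mono_left nhdsWithin_le_nhds).congr' ?_
    filter_upwards [Ioo_mem_nhdsLT hk.1] with s hs
    exact (hx.eq_branch h.cont ⟨hs.1, by rw [sub_add_cancel]; exact hs.2.le⟩).symm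

lemma LinearImpulsive.hasDerivWithinAt_mild (h : LinearImpulsive a θ γ lo hi η η' A B)
    (hf : Measurable f) (hK : ∀ t, |f t| ≤ K) (hx : Mild a θ γ f δ x) {t : ℝ}
    (ht : t ∉ range θ) (S : Set ℝ) [intervalIntegral.FTCFilter t (𝓝[S] t) (𝓝[S] t)]
    (hc : ContinuousWithinAt f S t) :
    HasDerivWithinAt x (-a t * x t + f t) S t := by
  obtain ⟨k, hk⟩ := exists_index h.strictMono h.tendsto_atTop h.tendsto_atBot t
  have hk' : t ∈ Ioo (θ k) (θ (k + 1)) :=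
    ⟨hk.1, lt_of_le_of_ne hk.2 fun e => ht ⟨k + 1, e.symm⟩⟩
  rw [hx.eq_branch h.cont hk]
  refine (hasDerivWithinAt_mildBranch h.cont hf hK _ _ t S hc).congr_of_eventuallyEq ?_
    (hx.eq_branch h.cont hk)
  filter_upwards [mem_nhdsWithin_of_mem_nhds (Ioo_mem_nhds hk'.1 hk'.2)] with s hs
  exact hx.eq_branch h.cont ⟨hs.1, hs.2.le⟩

/-- The derivative of `decay a u t * x u` in `u` is `decay a u t * f u`. Integrating it tolerates a
countable exceptional set, which is all that delayed arguments hitting impulse times produce. -/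
lemma mild_of_hasDerivAt (ha : Continuous a)
    (hf : Measurable f) (hK : ∀ t, |f t| ≤ K)
    (hcont : ∀ k, ContinuousOn x (Ioc (θ k) (θ (k + 1))))
    (hjump : ∀ k, Tendsto x (𝓝[>] (θ k)) (𝓝 (x (θ k) + (γ k * x (θ k) + δ k))))
    {C : Set ℝ} (hC : C.Countable)
    (hd : ∀ k, ∀ t ∈ Ioo (θ k) (θ (k + 1)), t ∉ C → HasDerivAt x (-a t * x t + f t) t) :
    Mild a θ γ f δ x := by
  intro k t ht
  have hint := fun s t' => intervalIntegrable_decay_mul ha hf hK s t' t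
  have key : ∀ s ∈ Ioc (θ k) t, ∫ u in s..t, decay a u t * f u = x t - decay a s t * x s := by
    intro s hs
    have hsub : Icc s t ⊆ Ioc (θ k) (θ (k + 1)) := fun u hu =>
      ⟨hs.1.trans_le hu.1, hu.2.trans ht.2⟩
    have := MeasureTheory.integral_eq_of_hasDerivAt_off_countable_of_le
      (fun u => decay a u t * x u) (fun u => decay a u t * f u) hs.2 hC
      ((continuous_decay_left ha t).continuousOn.mul ((hcont k).mono hsub)) (fun u hu => ?_)
      (hint s t)
    · rw [this, decay_self, one_mul]
    · have h1 : HasDerivAt (fun u => decay a u t) (a u * decay a u t) u := by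
        simp_rw [fun s => decay_symm (a := a) s t]
        refine HasDerivAt.congr_deriv ((hasDerivAt_decay_right ha t u).inv (decay_pos a t u).ne') ?_
        have := (decay_pos a t u).ne'
        field_simp
      have hu' : u ∈ Ioo (θ k) (θ (k + 1)) := ⟨hs.1.trans hu.1.1, hu.1.2.trans_le ht.2⟩
      refine (h1.mul (hd k u hu' hu.2)).congr_deriv ?_
      ring
  -- The identity `key` holds only for `s` strictly after `θ k`; letting `s` decrease to `θ k`
  -- brings in the right limit, that is, the value after the jump.
  have hl1 : Tendsto (fun s => ∫ u in s..t, decay a u t * f u) (𝓝[>] (θ k))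
      (𝓝 (∫ u in θ k..t, decay a u t * f u)) := by
    have : Continuous fun s => ∫ u in s..t, decay a u t * f u := by
      simp_rw [fun s => intervalIntegral.integral_symm (f := fun u => decay a u t * f u)
        (μ := MeasureTheory.volume) t s]
      exact (intervalIntegral.continuous_primitive hint t).neg
    exact this.continuousAt.tendsto.mono_left nhdsWithin_le_nhds
  have hl2 : Tendsto (fun s => x t - decay a s t * x s) (𝓝[>] (θ k))
      (𝓝 (x t - decay a (θ k) t * (x (θ k) + (γ k * x (θ k) + δ k)))) :=
    (((continuous_decay_left ha t).continuousAt.tendsto.mono_left nhdsWithin_le_nhds).mul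
      (hjump k)).const_sub (x t)
  have := tendsto_nhds_unique (hl1.congr' ?_) hl2
  · rw [this]; ring
  · filter_upwards [Ioc_mem_nhdsGT ht.1] with s hs using key s hs

lemma PLC.measurable {φ : ℝ → ℝ} (h : PLC θ φ) : Measurable φ := by
  have hcount : (range θ).Countable := countable_range θ
  refine measurable_of_restrict_of_restrict_compl hcount.measurableSet ?_ ?_
  · have := hcount.to_subtype
    exact measurable_of_countable _
  · refine Continuous.measurable ?_
    rw [← continuousOn_iff_continuous_domRestrict]
    exact fun t ht => (h.continuousAt t ht).continuousWithinAt

lemma PLC.tendsto_left {φ : ℝ → ℝ} (h : PLC θ φ) (t : ℝ) : ContinuousWithinAt φ (Iic t) t := by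
  by_cases ht : t ∈ range θ
  · obtain ⟨k, rfl⟩ := ht
    rw [← continuousWithinAt_sdiff_self, Iic_sdiff_right]
    exact h.left_continuous k
  · exact (h.continuousAt t ht).continuousWithinAt

lemma PLC.continuousOn {φ : ℝ → ℝ} (h : PLC θ φ) (hθ : StrictMono θ) (k : ℤ) :
    ContinuousOn φ (Ioc (θ k) (θ (k + 1))) := by
  intro t ht
  rcases ht.2.lt_or_eq with h1 | h1
  · refine (h.continuousAt t ?_).continuousWithinAt
    rintro ⟨j, rfl⟩
    have := hθ.lt_iff_lt.1 ht.1
    have := hθ.lt_iff_lt.1 h1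
    omega
  · exact (h.tendsto_left t).mono fun s hs => by rw [h1]; exact hs.2

/-- A bounded mild solution is Lipschitz between consecutive impulses. -/
lemma LinearImpulsive.lipschitz_mild (h : LinearImpulsive a θ γ lo hi η η' A B)
    (hf : Measurable f) (hK : ∀ t, |f t| ≤ K) (hx : Mild a θ γ f δ x) {M : ℝ} (hM : ∀ t, |x t| ≤ M)
    {k : ℤ} {s t : ℝ} (hs : s ∈ Ioc (θ k) (θ (k + 1))) (ht : t ∈ Ioc (θ k) (θ (k + 1))) :
    |x t - x s| ≤ (hi * M + K) * |t - s| := by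
  wlog hst : s ≤ t generalizing s t
  · rw [abs_sub_comm, abs_sub_comm t]
    exact this ht hs (le_of_not_ge hst)
  have h1 := hx.flow h.cont hf hK hs.1 hst ht.2
  have h2 := h.abs_integral_decay_mul_le hK hst
  have h3 := h.decay_le_one hst
  have h4 : 1 - decay a s t ≤ hi * (t - s) := by
    have := le_decay h.cont h.le_hi hst
    have := Real.add_one_le_exp (-hi * (t - s))
    linarith
  rw [abs_of_nonneg (sub_nonneg.2 hst)]
  have e : x t - x s = -((1 - decay a s t) * x s) + ∫ r in s..t, decay a r t * f r := by
    rw [h1]; ring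
  rw [e]
  refine (abs_add_le _ _).trans ?_
  rw [abs_neg, abs_mul, abs_of_nonneg (by linarith : 0 ≤ 1 - decay a s t)]
  have : (1 - decay a s t) * |x s| ≤ hi * (t - s) * M :=
    mul_le_mul h4 (hM s) (abs_nonneg _) (mul_nonneg h.hi_pos.le (sub_nonneg.2 hst))
  linarith

end

/-! ### Almost periods common to finitely many functions and sequences -/

/-- `α` can be partitioned into finitely many classes of related elements. -/
def FinitelyCovered {α : Type} (R : α → α → Prop) : Prop :=
  ∃ (ι : Type) (_ : Finite ι) (c : α → ι), ∀ x y, c x = c y → R x y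

/-- Relatively dense sets can have empty intersection, whereas finite partitions have common
refinements. This is why common almost periods are obtained through finite partitions. -/
lemma FinitelyCovered.and {α : Type} {R S : α → α → Prop} (hR : FinitelyCovered R)
    (hS : FinitelyCovered S) : FinitelyCovered fun x y => R x y ∧ S x y := by
  obtain ⟨ι, _, c, hc⟩ := hR
  obtain ⟨κ, _, d, hd⟩ := hS
  refine ⟨ι × κ, inferInstance, fun x => (c x, d x), fun x y h => ?_⟩
  rw [Prod.mk.injEq] at h
  exact ⟨hc x y h.1, hd x y h.2⟩

lemma FinitelyCovered.forall {α J : Type} [Finite J] {R : J → α → α → Prop}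
    (hR : ∀ j, FinitelyCovered (R j)) : FinitelyCovered fun x y => ∀ j, R j x y := by
  choose ι hι c hc using hR
  exact ⟨∀ j, ι j, inferInstance, fun x j => c j x, fun x y h j => hc j x y (congrFun h j)⟩

lemma FinitelyCovered.comap {α β : Type} {R : α → α → Prop} (hR : FinitelyCovered R) (g : β → α) :
    FinitelyCovered fun x y => R (g x) (g y) := by
  obtain ⟨ι, _, c, hc⟩ := hR
  exact ⟨ι, inferInstance, c ∘ g, fun x y h => hc _ _ h⟩

lemma FinitelyCovered.bounded {α : Type} {g : α → ℝ}
    (h : FinitelyCovered fun x y => |g x - g y| < 1) : ∃ C, ∀ x, |g x| ≤ C := by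
  obtain ⟨ι, _, c, hc⟩ := h
  have : (range fun i : range c => |g i.2.choose| + 1).Finite := finite_range _
  obtain ⟨C, hC⟩ := this.bddAbove
  refine ⟨C, fun x => ?_⟩
  have h1 := hC ⟨⟨c x, x, rfl⟩, rfl⟩
  have hex : ∃ y, c y = c x := ⟨x, rfl⟩
  have h2 : |g hex.choose| + 1 ≤ C := h1
  have h3 := hc x hex.choose hex.choose_spec.symm
  have h4 := abs_sub_abs_le_abs_sub (g x) (g hex.choose)
  linarith

/-- Finitely many class representatives lie in some `[-C, C]`. Subtracting from `r + C` the
representative of its class gives a difference of related integers in `[r, r + 2 * C]`. -/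
lemma FinitelyCovered.relDenseInt {R : ℤ → ℤ → Prop} (h : FinitelyCovered R) :
    RelDenseInt {n | ∃ p q, n = p - q ∧ R p q} := by
  obtain ⟨ι, _, c, hc⟩ := h
  have : (range fun i : range c => |i.2.choose|).Finite := finite_range _
  obtain ⟨C, hC⟩ := this.bddAbove
  have hC0 : 0 ≤ C := (abs_nonneg _).trans (hC ⟨⟨c 0, 0, rfl⟩, rfl⟩)
  refine ⟨(2 * C).toNat, fun r => ?_⟩
  have hex : ∃ y, c y = c (r + C) := ⟨_, rfl⟩
  have h2 : |hex.choose| ≤ C := hC ⟨⟨c (r + C), _, rfl⟩, rfl⟩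
  refine ⟨_, ⟨r + C, hex.choose, rfl, hc _ _ hex.choose_spec.symm⟩, ?_, ?_⟩
  · have := (abs_le.1 h2).2; omega
  · rw [Int.toNat_of_nonneg (by omega)]
    have := (abs_le.1 h2).1; omega

/-- Each `p` exceeds some `ε / 2`-almost period by an offset in `{0, …, N}`, and translates with
equal offset are both close to the translate by that offset. The parameter `j` allows all increments
of the impulse times to be treated at once. -/
lemma finitelyCovered_of_seq {J : Type} {z : ℤ → J → ℝ}
    (h : ∀ ε : ℝ, 0 < ε → RelDenseInt {p | ∀ k j, |z (k + p) j - z k j| < ε}) {ε : ℝ}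
    (hε : 0 < ε) : FinitelyCovered fun p q : ℤ => ∀ k j, |z (k + p) j - z (k + q) j| < ε := by
  obtain ⟨N, hN⟩ := h (ε / 2) (half_pos hε)
  choose P hP h1 h2 using fun p : ℤ => hN (p - N)
  refine ⟨Fin (N + 1), inferInstance, fun p => ⟨(p - P p).toNat, ?_⟩, fun p q hpq k j => ?_⟩
  · have := h1 p; have := h2 p; omega
  · have e : p - P p = q - P q := by
      have := Fin.mk.inj hpq
      have := h2 p; have := h2 q; omega
    have e1 := hP p (k + (p - P p)) j
    have e2 := hP q (k + (q - P q)) j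
    rw [show k + (p - P p) + P p = k + p by ring] at e1
    rw [show k + (q - P q) + P q = k + q by ring, ← e] at e2
    rw [abs_lt] at *
    constructor <;> linarith [e1.1, e1.2, e2.1, e2.2]

lemma SeqAP.finitelyCovered {z : ℤ → ℝ} (h : SeqAP z) {ε : ℝ} (hε : 0 < ε) :
    FinitelyCovered fun p q : ℤ => ∀ k, |z (k + p) - z (k + q)| < ε := by
  simpa using finitelyCovered_of_seq (J := Unit) (z := fun k _ => z k)
    (by simpa [SeqAP] using h) hε

lemma UniformlyAP.finitelyCovered {θ : ℤ → ℝ} (h : UniformlyAP θ) {ε : ℝ} (hε : 0 < ε) :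
    FinitelyCovered fun p q : ℤ => ∀ k r,
      |(θ (k + p + r) - θ (k + p)) - (θ (k + q + r) - θ (k + q))| < ε := by
  refine finitelyCovered_of_seq (J := ℤ) (z := fun k r => θ (k + r) - θ k) (fun ε hε => ?_) hε
  obtain ⟨N, hN⟩ := h ε hε
  refine ⟨N, fun r => ?_⟩
  obtain ⟨p, hp, h1⟩ := hN r
  exact ⟨p, fun k j => hp j k, h1⟩

lemma SeqAP.bounded {z : ℤ → ℝ} (h : SeqAP z) : ∃ C, ∀ k, |z k| ≤ C := by
  obtain ⟨ι, hι, c, hc⟩ := h.finitelyCovered one_pos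
  exact FinitelyCovered.bounded ⟨ι, hι, c, fun x y hxy => by simpa using hc x y hxy 0⟩

lemma UniformlyAP.gap_bounded {θ : ℤ → ℝ} (h : UniformlyAP θ) :
    ∃ C, ∀ k, |θ (k + 1) - θ k| ≤ C := by
  obtain ⟨ι, hι, c, hc⟩ := h.finitelyCovered one_pos
  exact FinitelyCovered.bounded ⟨ι, hι, c, fun x y hxy => by simpa using hc x y hxy 0 1⟩

/-- An almost period moves both times into the compact window `[-1, ℓ + 1]`, where continuity is
uniform. -/
lemma BohrAPUniformly.uniformlyContinuous {f : ℝ → ℝ → ℝ} {D K : Set ℝ} (h : BohrAPUniformly f D)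
    (hKD : K ⊆ D) (hK : IsCompact K) {ε : ℝ} (hε : 0 < ε) :
    ∃ d > 0, ∀ t t' : ℝ, |t - t'| < d → ∀ x ∈ K, |f t x - f t' x| < ε := by
  obtain ⟨ℓ, hℓ, hS⟩ := h.2 K hKD hK (ε / 3) (by positivity)
  have hcomp : IsCompact (Icc (-1) (ℓ + 1) ×ˢ K) := isCompact_Icc.prod hK
  have huc := hcomp.uniformContinuousOn_of_continuous
    (h.1.mono (prod_mono (subset_univ _) hKD))
  obtain ⟨d, hd, huc⟩ := Metric.uniformContinuousOn_iff.1 huc (ε / 3) (by positivity)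
  refine ⟨min d 1, by positivity, fun t t' htt x hx => ?_⟩
  obtain ⟨ω, hω, h1, h2⟩ := hS (-t)
  have ht := abs_lt.1 (htt.trans_le (min_le_right _ _))
  have e1 := hω t x hx
  have e2 := hω t' x hx
  have e3 := huc (t + ω, x) ⟨⟨by simp; linarith, by simp; linarith⟩, hx⟩
    (t' + ω, x) ⟨⟨by simp; linarith, by simp; linarith⟩, hx⟩ (by
      rw [Prod.dist_eq, dist_self, Real.dist_eq]
      simpa [hd] using htt.trans_le (min_le_left _ _))
  rw [Real.dist_eq] at e3
  rw [abs_lt] at *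
  constructor <;> linarith [e1.1, e1.2, e2.1, e2.2, e3.1, e3.2]

/-- As for sequences, except that the offset ranges over `[0, ℓ]` and is cut into cells of length
`d`; uniform continuity compares offsets within a cell. -/
lemma BohrAPUniformly.finitelyCovered {f : ℝ → ℝ → ℝ} {D K : Set ℝ} (h : BohrAPUniformly f D)
    (hKD : K ⊆ D) (hK : IsCompact K) {ε : ℝ} (hε : 0 < ε) :
    FinitelyCovered fun ω ω' : ℝ => ∀ t, ∀ x ∈ K, |f (t + ω) x - f (t + ω') x| < ε := by
  obtain ⟨ℓ, hℓ, hS⟩ := h.2 K hKD hK (ε / 3) (by positivity)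
  obtain ⟨d, hd, huc⟩ := h.uniformlyContinuous hKD hK (show 0 < ε / 3 by positivity)
  choose P hP h1 h2 using fun ω : ℝ => hS (ω - ℓ)
  refine ⟨Fin (⌊ℓ / d⌋₊ + 1), inferInstance, fun ω => ⟨⌊(ω - P ω) / d⌋₊, ?_⟩,
    fun ω ω' hc t x hx => ?_⟩
  · rw [Nat.lt_succ_iff]
    refine Nat.floor_le_floor ?_
    have := h1 ω
    gcongr; linarith
  · have e := Fin.mk.inj hc
    have hnn : ∀ ω, 0 ≤ (ω - P ω) / d := fun ω => div_nonneg (by linarith [h2 ω]) hd.le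
    have i1 := Nat.floor_le (hnn ω)
    have i2 := Nat.lt_floor_add_one ((ω - P ω) / d)
    have i3 := Nat.floor_le (hnn ω')
    have i4 := Nat.lt_floor_add_one ((ω' - P ω') / d)
    rw [e] at i1 i2
    have i5 : |(t + (ω - P ω)) - (t + (ω' - P ω'))| < d := by
      have : |(ω - P ω) / d - (ω' - P ω') / d| < 1 := by rw [abs_lt]; constructor <;> linarith
      rw [← sub_div, abs_div, abs_of_pos hd, div_lt_one hd] at this
      rwa [show t + (ω - P ω) - (t + (ω' - P ω')) = ω - P ω - (ω' - P ω') by ring]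
    have e1 := hP ω (t + (ω - P ω)) x hx
    have e2 := hP ω' (t + (ω' - P ω')) x hx
    have e3 := huc _ _ i5 x hx
    rw [show t + (ω - P ω) + P ω = t + ω by ring] at e1
    rw [show t + (ω' - P ω') + P ω' = t + ω' by ring] at e2
    rw [abs_lt] at e1 e2 e3 ⊢
    constructor <;> linarith [e1.1, e1.2, e2.1, e2.2, e3.1, e3.2]

lemma BohrAP.uniformly {f : ℝ → ℝ} (h : BohrAP f) (D : Set ℝ) :
    BohrAPUniformly (fun t _ => f t) D := by
  refine ⟨(h.1.comp continuous_fst).continuousOn, fun K _ _ ε hε => ?_⟩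
  obtain ⟨ℓ, hℓ, hS⟩ := h.2 ε hε
  refine ⟨ℓ, hℓ, fun r => ?_⟩
  obtain ⟨ω, hω, h1⟩ := hS r
  exact ⟨ω, fun t _ _ => hω t, h1⟩

lemma BohrAP.bounded {f : ℝ → ℝ} (h : BohrAP f) : ∃ C, ∀ t, |f t| ≤ C := by
  obtain ⟨ι, hι, c, hc⟩ := (h.uniformly univ).finitelyCovered (subset_univ {0})
    isCompact_singleton one_pos
  exact FinitelyCovered.bounded ⟨ι, hι, c, fun x y hxy => by simpa using hc x y hxy 0⟩

lemma exists_pos_forall_le {J : Type} [Finite J] {d : J → ℝ} (hd : ∀ j, 0 < d j) :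
    ∃ e > 0, ∀ j, e ≤ d j := by
  rcases isEmpty_or_nonempty J with _ | _
  · exact ⟨1, one_pos, fun j => isEmptyElim j⟩
  · obtain ⟨j, hj⟩ := Finite.exists_min d
    exact ⟨d j, hd j, hj⟩

/-- `n` is an almost period of the impulse times, of two sequences and, up to the corresponding time
shift `θ n - θ 0`, of a family of functions. Times are compared up to `d`, values up to `ε`. -/
structure CommonAlmostPeriod {J : Type} (θ γ δ : ℤ → ℝ) (f : J → ℝ → ℝ → ℝ) (K : J → Set ℝ)
    (d ε : ℝ) (n : ℤ) : Prop where
  times : ∀ k r, |(θ (k + n + r) - θ (k + n)) - (θ (k + r) - θ k)| < d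
  fst : ∀ k, |γ (k + n) - γ k| < ε
  snd : ∀ k, |δ (k + n) - δ k| < ε
  functions : ∀ j, ∀ s t, |s - t - (θ n - θ 0)| ≤ d → ∀ x ∈ K j, |f j s x - f j t x| < ε

/-- Real time shifts are tied to index shifts by pulling the partition for the functions back along
`θ`. One partition of the integers then serves all the data, and differences within a class are the
common almost periods. -/
lemma exists_common_almost_periods {J : Type} [Finite J] {θ γ δ : ℤ → ℝ} (hθ : UniformlyAP θ)
    (hγ : SeqAP γ) (hδ : SeqAP δ) {f : J → ℝ → ℝ → ℝ} {D K : J → Set ℝ}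
    (hf : ∀ j, BohrAPUniformly (f j) (D j)) (hKD : ∀ j, K j ⊆ D j) (hK : ∀ j, IsCompact (K j))
    {ε : ℝ} (hε : 0 < ε) :
    ∃ d > 0, d ≤ ε ∧ RelDenseInt {n | CommonAlmostPeriod θ γ δ f K d ε n} := by
  choose d0 hd0 huc using fun j =>
    (hf j).uniformlyContinuous (hKD j) (hK j) (show 0 < ε / 2 by positivity)
  obtain ⟨d1, hd1, hd1'⟩ := exists_pos_forall_le hd0
  set d := min ε (d1 / 2)
  have hd : 0 < d := by positivity
  refine ⟨d, hd, min_le_left _ _, ?_⟩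
  have hcov := (hθ.finitelyCovered hd).and ((hγ.finitelyCovered hε).and
    ((hδ.finitelyCovered hε).and (FinitelyCovered.forall fun j =>
      ((hf j).finitelyCovered (hKD j) (hK j) (show 0 < ε / 2 by positivity)).comap θ)))
  obtain ⟨N, hN⟩ := hcov.relDenseInt
  refine ⟨N, fun r => ?_⟩
  obtain ⟨n, ⟨p, q, hn, h1, h2, h3, h4⟩, hr⟩ := hN r
  have hp : p = n + q := by omega
  subst hp
  refine ⟨n, ⟨fun k r => ?_, fun k => ?_, fun k => ?_, fun j s t hst x hx => ?_⟩, hr⟩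
  · have := h1 (k - q) r
    rwa [show k - q + (n + q) = k + n by ring, sub_add_cancel] at this
  · have := h2 (k - q)
    rwa [show k - q + (n + q) = k + n by ring, sub_add_cancel] at this
  · have := h3 (k - q)
    rwa [show k - q + (n + q) = k + n by ring, sub_add_cancel] at this
  -- This says that `θ (n + q) - θ q` is within `d` of `θ n - θ 0`. Together with the tolerance `d`
  -- in `hst` the time discrepancy is below `2 * d ≤ d1`.
  · have i1 := h1 (-q) q
    rw [show -q + (n + q) + q = n + q by ring, show -q + (n + q) = n by ring,
      show -q + q + q = q by ring, show -q + q = 0 by ring] at i1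
    have i2 := h4 j (t - θ q) x hx
    rw [sub_add_cancel] at i2
    have i3 : |s - (t - θ q + θ (n + q))| < d0 j := by
      have : d ≤ d1 / 2 := min_le_right _ _
      have := hd1' j
      rw [abs_lt] at *
      rw [abs_le] at hst
      constructor <;> linarith [hst.1, hst.2, i1.1, i1.2]
    have i4 := huc j _ _ i3 x hx
    rw [abs_lt] at *
    constructor <;> linarith [i2.1, i2.2, i4.1, i4.2]

/-! ### The times close to an impulse -/

/-- The times within `e` of an impulse time. -/
def nearImpulse (θ : ℤ → ℝ) (e : ℝ) : Set ℝ := {w | ∃ k, |w - θ k| ≤ e}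

lemma measurableSet_nearImpulse (θ : ℤ → ℝ) (e : ℝ) : MeasurableSet (nearImpulse θ e) := by
  unfold nearImpulse
  rw [ofPred_exists]
  refine MeasurableSet.iUnion fun k => measurableSet_le ?_ measurable_const
  fun_prop

namespace LinearImpulsive

variable {a : ℝ → ℝ} {θ γ : ℤ → ℝ} {lo hi η η' A B : ℝ}

lemma mul_natAbs_le (h : LinearImpulsive a θ γ lo hi η η' A B) (j k : ℤ) :
    (j - k).natAbs * η ≤ |θ j - θ k| := by
  wlog hjk : k ≤ j generalizing j k
  · rw [abs_sub_comm, ← Int.natAbs_neg, neg_sub]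
    exact this k j (le_of_not_ge hjk)
  have := h.gap_mul_le k (j - k).natAbs
  rw [show k + ((j - k).natAbs : ℤ) = j by omega] at this
  exact this.trans (le_abs_self _)

/-- For a bi-Lipschitz time change `u`, the times of a window at which `u` is within `e` of an
impulse have measure `O(e)`. -/
lemma exists_volume_nearImpulse_le (h : LinearImpulsive a θ γ lo hi η η' A B) {κ C : ℝ}
    (hκ : 0 < κ) (hC0 : 0 ≤ C) (ℓ : ℝ) :
    ∃ c, 0 ≤ c ∧ ∀ u : ℝ → ℝ, (∀ s s', κ * |s - s'| ≤ |u s - u s'|) →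
      (∀ s s', |u s - u s'| ≤ C * |s - s'|) → ∀ e, 0 ≤ e → e ≤ 1 → ∀ r,
      MeasureTheory.volume (u ⁻¹' nearImpulse θ e ∩ Icc r (r + ℓ)) ≤ ENNReal.ofReal (c * e) := by
  -- Two impulses met in the window are at most `C * ℓ + 2 * e ≤ 2 + C * ℓ` apart, so their indices
  -- differ by at most `N`.
  set N : ℕ := ⌈(2 + C * ℓ) / η⌉₊
  refine ⟨(2 * N + 1) * (2 / κ), by positivity, fun u hu hC e he he1 r => ?_⟩
  rcases (u ⁻¹' nearImpulse θ e ∩ Icc r (r + ℓ)).eq_empty_or_nonempty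
    with hem | ⟨s0, ⟨k0, hk0⟩, hs0⟩
  · rw [hem]; simp
  set I : ℤ → Set ℝ := fun k => {s | |u s - θ k| ≤ e}
  have hsub : u ⁻¹' nearImpulse θ e ∩ Icc r (r + ℓ) ⊆ ⋃ k ∈ Finset.Icc (k0 - N) (k0 + N), I k := by
    rintro s ⟨⟨k, hk⟩, hs⟩
    have h1 : |s - s0| ≤ ℓ := by
      rw [abs_le]; constructor <;> linarith [hs.1, hs.2, hs0.1, hs0.2]
    have h2 : |θ k - θ k0| ≤ 2 + C * ℓ := by
      have i1 := (hC s s0).trans (mul_le_mul_of_nonneg_left h1 hC0)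
      rw [abs_le] at *
      constructor <;> linarith [hk.1, hk.2, i1.1, i1.2, hk0.1, hk0.2]
    have h3 : (((k - k0).natAbs : ℕ) : ℝ) ≤ N := by
      refine le_trans ?_ (Nat.le_ceil _)
      rw [le_div_iff₀ h.η_pos]
      exact (h.mul_natAbs_le k k0).trans h2
    have h4 : (k - k0).natAbs ≤ N := by exact_mod_cast h3
    simp only [mem_iUnion, Finset.mem_Icc]
    exact ⟨k, by omega, hk⟩
  -- The lower Lipschitz bound on `u` limits the diameter of the preimage of an interval of length
  -- `2 * e`.
  have hI : ∀ k, MeasureTheory.volume (I k) ≤ ENNReal.ofReal (2 * e / κ) := by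
    intro k
    refine (Real.volume_le_diam _).trans (Metric.ediam_le fun s hs s' hs' => ?_)
    rw [edist_dist, Real.dist_eq]
    refine ENNReal.ofReal_le_ofReal ?_
    rw [le_div_iff₀ hκ, mul_comm]
    refine (hu s s').trans ?_
    have i1 : |u s - θ k| ≤ e := hs
    have i2 : |u s' - θ k| ≤ e := hs'
    rw [abs_le] at *
    constructor <;> linarith [i1.1, i1.2, i2.1, i2.2]
  calc _ ≤ MeasureTheory.volume (⋃ k ∈ Finset.Icc (k0 - (N : ℤ)) (k0 + N), I k) :=
        MeasureTheory.measure_mono hsub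
    _ ≤ ∑ k ∈ Finset.Icc (k0 - (N : ℤ)) (k0 + N), MeasureTheory.volume (I k) :=
        MeasureTheory.measure_biUnion_finset_le _ _
    _ ≤ ∑ k ∈ Finset.Icc (k0 - (N : ℤ)) (k0 + N), ENNReal.ofReal (2 * e / κ) :=
        Finset.sum_le_sum fun k _ => hI k
    _ = ENNReal.ofReal ((2 * N + 1) * (2 / κ) * e) := by
        rw [Finset.sum_const, Int.card_Icc,
          show k0 + N + 1 - (k0 - (N : ℤ)) = ((2 * N + 1 : ℕ) : ℤ) by
          push_cast; ring, Int.toNat_natCast, nsmul_eq_mul, ← ENNReal.ofReal_natCast,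
          ← ENNReal.ofReal_mul (by positivity)]
        congr 1; push_cast; ring

end LinearImpulsive

/-! ### Small weighted mass of the times close to an impulse. -/

/-- A set with uniformly small measure in unit windows has small exponentially weighted measure. -/
lemma integral_exp_indicator_le {l : ℝ} (hl : 0 < l) {S : Set ℝ} (hS : MeasurableSet S) {μ : ℝ}
    (hμ0 : 0 ≤ μ)
    (hμ : ∀ r, MeasureTheory.volume (S ∩ Icc r (r + 1)) ≤ ENNReal.ofReal μ) (t : ℝ) :
    ∫ s in Iic t, Real.exp (-l * (t - s)) * S.indicator (fun _ => (1 : ℝ)) s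
      ≤ μ / (1 - Real.exp (-l)) := by
  set R : ℝ → ℝ := S.indicator (fun _ => (1 : ℝ))
  have hR : Measurable R := measurable_const.indicator hS
  have hR0 : ∀ s, 0 ≤ R s := fun s => indicator_nonneg (fun _ _ => zero_le_one) s
  have hR1 : ∀ s, R s ≤ 1 := fun s => indicator_le_self' (fun _ _ => zero_le_one) s
  have hRb : ∀ s, |R s| ≤ 1 := fun s => by rw [abs_of_nonneg (hR0 s)]; exact hR1 s
  have hint := fun r t => integrableOn_exp_scale_mul hl r t hR hRb
  have hE : Real.exp (-l) < 1 := by simpa using Real.exp_lt_exp.2 (show -l < 0 by linarith)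
  set G : ℝ → ℝ := fun t => ∫ s in Iic t, Real.exp (-l * (t - s)) * R s
  have hbdd : BddAbove (range G) := by
    refine ⟨1 / l, ?_⟩
    rintro _ ⟨t, rfl⟩
    have : ∫ s in Iic t, Real.exp (-l * (t - s)) = 1 / l := by
      rw [integral_Iic_exp_scale hl]; simp
    rw [← this]
    refine MeasureTheory.integral_mono (hint t t) (integrableOn_exp_scale hl t t) fun s => ?_
    exact mul_le_of_le_one_right (Real.exp_pos _).le (hR1 s)
  -- Moving back one unit of time multiplies the weight by `exp (-l)`, so `G t` is `exp (-l) * G (t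
  -- - 1)` plus the last window. Taking suprema gives the geometric bound without summing a series.
  have hstep : ∀ t, G t ≤ Real.exp (-l) * (⨆ t, G t) + μ := by
    intro t
    have e1 : G t = Real.exp (-l) * G (t - 1)
        + ∫ s in (t - 1)..t, Real.exp (-l * (t - s)) * R s := by
      have := intervalIntegral.integral_Iic_sub_Iic (hint (t - 1) t) (hint t t)
      rw [← this]
      simp only [G]
      rw [← MeasureTheory.integral_const_mul]
      have e : ∀ s, Real.exp (-l) * (Real.exp (-l * (t - 1 - s)) * R s)
          = Real.exp (-l * (t - s)) * R s := fun s => by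
        rw [← mul_assoc, ← Real.exp_add]; ring_nf
      simp_rw [e]; ring
    have e2 : ∫ s in (t - 1)..t, Real.exp (-l * (t - s)) * R s ≤ μ := by
      calc _ ≤ ∫ s in (t - 1)..t, R s := by
            refine intervalIntegral.integral_mono_on (by linarith)
              ((intervalIntegrable_of_bounded hR hRb _ _).continuousOn_mul (by fun_prop))
              (intervalIntegrable_of_bounded hR hRb _ _) fun s hs => ?_
            refine mul_le_of_le_one_left (hR0 s) (Real.exp_le_one_iff.2 ?_)
            nlinarith [hs.2]
        _ ≤ μ := by
            rw [intervalIntegral.integral_of_le (by linarith),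
              MeasureTheory.integral_indicator hS, MeasureTheory.setIntegral_const, smul_eq_mul,
              mul_one, MeasureTheory.measureReal_restrict_apply hS]
            refine ENNReal.toReal_le_of_le_ofReal hμ0 (le_trans (MeasureTheory.measure_mono ?_)
              (hμ (t - 1)))
            rw [sub_add_cancel]
            exact inter_subset_inter_right _ Ioc_subset_Icc_self
    rw [e1]
    have := le_ciSup hbdd (t - 1)
    have := mul_le_mul_of_nonneg_left this (Real.exp_pos (-l)).le
    linarith
  have hsup := ciSup_le hstep
  refine (le_ciSup hbdd t).trans ?_
  rw [le_div_iff₀ (by linarith)]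
  linarith

/-- The mass that a weight puts on delays leading close to an impulse is uniformly small. -/
lemma LinearImpulsive.exists_integral_nearImpulse_le {a : ℝ → ℝ} {θ γ : ℤ → ℝ}
    {lo hi η η' A B : ℝ} (h : LinearImpulsive a θ γ lo hi η η' A B) {v : ℝ → ℝ} {T : ℝ} (hT : 0 ≤ T)
    (hv : IntervalIntegrable v MeasureTheory.volume 0 T) {ε : ℝ} (hε : 0 < ε) :
    ∃ e0 > 0, ∀ e, 0 ≤ e → e ≤ e0 → ∀ t,
      ∫ s in (0 : ℝ)..T, v s * (nearImpulse θ e).indicator (fun _ => (1 : ℝ)) (t - s) ≤ ε := by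
  rw [intervalIntegrable_iff_integrableOn_Ioc_of_le hT] at hv
  -- Absolute continuity of the integral of `|v|`: only the measure of the set matters, and that
  -- measure is bounded uniformly in `t` because `s ↦ t - s` is an isometry.
  obtain ⟨d, hd, hd'⟩ := MeasureTheory.exists_pos_setLIntegral_lt_of_measure_lt
    (μ := MeasureTheory.volume.restrict (Ioc 0 T)) (f := fun s => ‖v s‖ₑ) hv.2.ne
    (ENNReal.ofReal_pos.2 hε).ne'
  obtain ⟨c, hc, hcv⟩ := h.exists_volume_nearImpulse_le one_pos zero_le_one T
  have hcv' := fun t : ℝ => hcv (fun s => t - s)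
    (fun s s' => by rw [one_mul, abs_sub_comm]; apply le_of_eq; congr 1; ring)
    (fun s s' => by rw [one_mul, abs_sub_comm s]; apply le_of_eq; congr 1; ring)
  obtain ⟨e0, he0, he0', he0''⟩ : ∃ e0 > 0, e0 ≤ 1 ∧ ENNReal.ofReal (c * e0) < d := by
    have h1 : Tendsto (fun e : ℝ => ENNReal.ofReal (c * e)) (𝓝[>] 0) (𝓝 0) := by
      have : Continuous fun e : ℝ => ENNReal.ofReal (c * e) :=
        ENNReal.continuous_ofReal.comp (by fun_prop)
      simpa using (this.tendsto 0).mono_left nhdsWithin_le_nhds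
    obtain ⟨e0, h2, h3, h4⟩ := ((h1.eventually_lt_const hd).and
      ((eventually_mem_nhdsWithin).and (eventually_nhdsWithin_of_eventually_nhds
        (eventually_le_nhds (zero_lt_one (α := ℝ)))))).exists
    exact ⟨e0, h3, h4, h2⟩
  refine ⟨e0, he0, fun e he hee t => ?_⟩
  set S : Set ℝ := (fun s => t - s) ⁻¹' nearImpulse θ e
  have hS : MeasurableSet S := (measurableSet_nearImpulse θ e).preimage (by fun_prop)
  have e1 : ∀ s, v s * (nearImpulse θ e).indicator (fun _ => (1 : ℝ)) (t - s)
      = S.indicator v s := by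
    intro s
    by_cases hs : t - s ∈ nearImpulse θ e
    · rw [indicator_of_mem hs, indicator_of_mem (show s ∈ S from hs), mul_one]
    · rw [indicator_of_notMem hs, indicator_of_notMem (show s ∉ S from hs), mul_zero]
  simp_rw [e1]
  rw [intervalIntegral.integral_of_le hT, MeasureTheory.integral_indicator hS]
  have h2 : ∫⁻ s in S, ‖v s‖ₑ ∂MeasureTheory.volume.restrict (Ioc 0 T) < ENNReal.ofReal ε := by
    refine hd' S (lt_of_le_of_lt ?_ he0'')
    rw [MeasureTheory.Measure.restrict_apply hS]
    refine le_trans (MeasureTheory.measure_mono ?_) ((hcv' t e he (hee.trans he0') 0).trans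
      (ENNReal.ofReal_le_ofReal (mul_le_mul_of_nonneg_left hee hc)))
    rw [zero_add]
    exact inter_subset_inter_right _ Ioc_subset_Icc_self
  have h3 := (MeasureTheory.enorm_integral_le_lintegral_enorm
    (μ := (MeasureTheory.volume.restrict (Ioc 0 T)).restrict S) v).trans_lt h2
  rw [Real.enorm_eq_ofReal_abs, ENNReal.ofReal_lt_ofReal_iff hε] at h3
  exact (le_abs_self _).trans h3.le

/-! ### The nonlinearity -/

/-- The function `z ↦ 1 / (1 + z ^ p)`. -/
noncomputable def hill (p z : ℝ) : ℝ := 1 / (1 + z ^ p)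

lemma hill_nonneg {p z : ℝ} (hz : 0 ≤ z) : 0 ≤ hill p z := by
  have := Real.rpow_nonneg hz p
  unfold hill; positivity

lemma hill_le_one {p z : ℝ} (hz : 0 ≤ z) : hill p z ≤ 1 := by
  have := Real.rpow_nonneg hz p
  unfold hill
  rw [div_le_one (by positivity)]; linarith

lemma hill_anti {p z w : ℝ} (hp : 0 < p) (hz : 0 ≤ z) (hzw : z ≤ w) : hill p w ≤ hill p z := by
  have := Real.rpow_nonneg hz p
  have := Real.rpow_le_rpow hz hzw hp.le
  unfold hill
  gcongr

lemma measurable_hill (p : ℝ) : Measurable (hill p) := by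
  unfold hill; fun_prop

lemma continuousAt_hill {p z : ℝ} (hp : 0 < p) (hz : 0 ≤ z) : ContinuousAt (hill p) z := by
  have := Real.rpow_nonneg hz p
  unfold hill
  exact continuousAt_const.div (continuousAt_const.add
    (Real.continuous_rpow_const hp.le).continuousAt) (by positivity)

/-- Mean value theorem: the derivative has absolute value `p * x ^ (p - 1) / (1 + x ^ p) ^ 2`, and
the denominator is at least one. Positivity of `lo` keeps the supremum finite when `p < 1`. -/
lemma abs_hill_sub_le {p lo hi z w : ℝ} (hp : 0 < p) (hlo : 0 < lo) (hz : z ∈ Icc lo hi)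
    (hw : w ∈ Icc lo hi) :
    |hill p z - hill p w| ≤ sSup ((fun x : ℝ => p * x ^ (p - 1)) '' Icc lo hi) * |z - w| := by
  have hbdd : BddAbove ((fun x : ℝ => p * x ^ (p - 1)) '' Icc lo hi) := by
    refine (isCompact_Icc.image_of_continuousOn ?_).bddAbove
    exact continuousOn_const.mul (continuousOn_id.rpow_const fun x hx =>
      Or.inl (hlo.trans_le hx.1).ne')
  have hd : ∀ x ∈ Icc lo hi,
      HasDerivWithinAt (hill p) (-(p * x ^ (p - 1)) / (1 + x ^ p) ^ 2) (Icc lo hi) x := by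
    intro x hx
    have hx0 := hlo.trans_le hx.1
    have h1 : HasDerivAt (fun x : ℝ => 1 + x ^ p) (p * x ^ (p - 1)) x :=
      (Real.hasDerivAt_rpow_const (Or.inl hx0.ne')).const_add 1
    have h2 := h1.inv (by have := Real.rpow_pos_of_pos hx0 p; positivity)
    have e : hill p = (fun x : ℝ => 1 + x ^ p)⁻¹ := by
      ext x; simp [hill]
    rw [e]
    exact h2.hasDerivWithinAt
  have := (convex_Icc lo hi).norm_image_sub_le_of_norm_hasDerivWithin_le hd
    (C := sSup ((fun x : ℝ => p * x ^ (p - 1)) '' Icc lo hi)) (fun x hx => ?_) hw hz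
  · simpa [Real.norm_eq_abs] using this
  · have hx0 := hlo.trans_le hx.1
    have i1 := Real.rpow_pos_of_pos hx0 p
    have i2 := Real.rpow_pos_of_pos hx0 (p - 1)
    refine le_trans ?_ (le_csSup hbdd ⟨x, hx, rfl⟩)
    rw [Real.norm_eq_abs, abs_div, abs_neg, abs_of_pos (by positivity), abs_of_pos (by positivity)]
    exact div_le_self (by positivity) (by nlinarith)

lemma sSup_rpow_nonneg {p lo hi : ℝ} (hp : 0 < p) (hlo : 0 < lo) :
    0 ≤ sSup ((fun x : ℝ => p * x ^ (p - 1)) '' Icc lo hi) := by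
  refine Real.sSup_nonneg ?_
  rintro _ ⟨x, hx, rfl⟩
  have := Real.rpow_nonneg (hlo.le.trans hx.1) (p - 1)
  positivity

/-! ### The model: bounds, comparison and continuity of the production term. -/

namespace Model

variable {m : ℕ} (P : Model m)

/-- All the assumptions of the existence theorem. -/
structure Admissible : Prop where
  standing : P.Standing
  a1 : P.A1
  a2 : P.A2
  a3 : P.A3
  a4 : P.A4
  a5 : P.A5
  a6 : P.A6
  a7 : P.A7
  M₁_nonneg : 0 ≤ P.M₁
  M₂_pos : 0 < P.M₂
  contraction : P.A / P.aL * ∑ i, (P.bM i * P.KStar i + P.cM i * P.GStar i + P.L i) < 1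

/-- The distributed delay term. -/
noncomputable def distributed (i : Fin m) (x : ℝ → ℝ) (t : ℝ) : ℝ :=
  ∫ s in (0 : ℝ)..P.T, P.v i s * hill (P.β i) (x (t - s))

/-- The production and harvesting part of the right-hand side. -/
noncomputable def production (x : ℝ → ℝ) (t : ℝ) : ℝ :=
  ∑ i, (P.b i t * hill (P.α i) (x (t - P.τ i t)) + P.c i t * P.distributed i x t
    - P.H i t (x (t - P.σ i t)))

lemma rhs_eq (x : ℝ → ℝ) (t : ℝ) : P.rhs x t = -P.a t * x t + P.production x t := by
  simp only [rhs, production, distributed, hill, mul_one_div]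

variable {P}

namespace Admissible

lemma abs_ciInf_ciSup {ι : Type*} {f : ι → ℝ} (h : ∃ C, ∀ t, |f t| ≤ C) (t : ι) :
    ⨅ t, f t ≤ f t ∧ f t ≤ ⨆ t, f t := by
  obtain ⟨C, hC⟩ := h
  refine ⟨ciInf_le ⟨-C, ?_⟩ t, le_ciSup ⟨C, ?_⟩ t⟩
  · rintro _ ⟨s, rfl⟩; exact (abs_le.1 (hC s)).1
  · rintro _ ⟨s, rfl⟩; exact (abs_le.1 (hC s)).2

lemma a_bounds (h : P.Admissible) (t : ℝ) : P.aL ≤ P.a t ∧ P.a t ≤ P.aM :=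
  abs_ciInf_ciSup h.a1.ap.bounded t

lemma b_bounds (h : P.Admissible) (i : Fin m) (t : ℝ) : P.bL i ≤ P.b i t ∧ P.b i t ≤ P.bM i :=
  abs_ciInf_ciSup (h.a2.b_ap i).bounded t

lemma c_bounds (h : P.Admissible) (i : Fin m) (t : ℝ) : P.cL i ≤ P.c i t ∧ P.c i t ≤ P.cM i :=
  abs_ciInf_ciSup (h.a2.c_ap i).bounded t

lemma δ_bounds (h : P.Admissible) (k : ℤ) : P.δL ≤ P.δ k ∧ P.δ k ≤ P.δM :=
  abs_ciInf_ciSup (SeqAP.bounded h.a5) k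

lemma gap_bounds (h : P.Admissible) (k : ℤ) :
    P.η ≤ P.θ (k + 1) - P.θ k ∧ P.θ (k + 1) - P.θ k ≤ P.ηBar :=
  abs_ciInf_ciSup h.a7.ap.gap_bounded k

lemma H_bounds (h : P.Admissible) (i : Fin m) (t : ℝ) {x : ℝ} (hx : 0 ≤ x) :
    P.HL i ≤ P.H i t x ∧ P.H i t x ≤ P.HM i := by
  obtain ⟨C, hC⟩ := h.a3.bounded i
  exact abs_ciInf_ciSup (f := fun z : ℝ × ℝ≥0 => P.H i z.1 (z.2 : ℝ))
    ⟨C, fun z => by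
      have := h.a3.nonneg i z.1 z.2 z.2.2
      rw [abs_of_nonneg this]; exact hC _ _ z.2.2⟩ (t, ⟨x, hx⟩)

lemma bM_nonneg (h : P.Admissible) (i : Fin m) : 0 ≤ P.bM i :=
  (h.a2.b_nonneg i 0).trans (h.b_bounds i 0).2

lemma cM_nonneg (h : P.Admissible) (i : Fin m) : 0 ≤ P.cM i :=
  (h.a2.c_nonneg i 0).trans (h.c_bounds i 0).2

lemma linear (h : P.Admissible) :
    LinearImpulsive P.a P.θ P.γ P.aL P.aM P.η P.ηBar P.A P.B := by
  have hpos : ∀ k, 0 < 1 + P.γ k := by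
    intro k
    have := (abs_ciInf_ciSup h.a6.ap.bounded k).1
    have := h.a6.γL_gt
    unfold γL at this
    linarith
  have hmem : ∀ i j, i < j → jumpProd P.γ i j ∈ P.gammaProducts := fun i j hij =>
    ⟨i, j - 1, by omega, by
      unfold jumpProd
      congr 1; ext k; simp only [Finset.mem_Ico, Finset.mem_Icc]; omega⟩
  have hbelow : BddBelow P.gammaProducts := by
    refine ⟨0, ?_⟩
    rintro _ ⟨q, p, _, rfl⟩
    exact Finset.prod_nonneg fun k _ => (hpos k).le
  exact
    { cont := h.a1.ap.1
      lo_pos := h.a1.aL_pos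
      lo_le := fun t => (h.a_bounds t).1
      le_hi := fun t => (h.a_bounds t).2
      η_pos := h.a7.η_pos
      gap_ge := fun k => (h.gap_bounds k).1
      gap_le := fun k => (h.gap_bounds k).2
      strictMono := h.standing.θ_strictMono
      tendsto_atTop := h.standing.θ_atTop
      tendsto_atBot := h.standing.θ_atBot
      jump_pos := hpos
      B_pos := lt_min h.a6.ΓL_pos one_pos
      -- The empty product equals one and belongs to no pair `q ≤ p`; this is why `A` and `B`
      -- compare `ΓM` and `ΓL` with one.
      jumpProd_le := fun i j hij => by
        rcases hij.eq_or_lt with rfl | hij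
        · rw [jumpProd_self]; exact le_max_right _ _
        · exact (le_csSup h.a6.ΓM_finite (hmem i j hij)).trans (le_max_left _ _)
      le_jumpProd := fun i j hij => by
        rcases hij.eq_or_lt with rfl | hij
        · rw [jumpProd_self]; exact min_le_right _ _
        · exact (min_le_left _ _).trans (csInf_le hbelow (hmem i j hij)) }

/-! #### The time changes `t ↦ t - τ t` -/

/-- The mean value theorem on both sides. Monotonicity preserves left limits and countability of
exceptional times; the two Lipschitz bounds control measures of preimages. -/
lemma exists_bilipschitz {τ : ℝ → ℝ} (hd : Differentiable ℝ τ) (hb : ∃ C, ∀ t, |deriv τ t| ≤ C)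
    (hi : 0 < ⨅ t, (1 - deriv τ t)) :
    ∃ κ C : ℝ, 0 < κ ∧ 0 ≤ C ∧ StrictMono (fun t => t - τ t) ∧
      (∀ s s', κ * |s - s'| ≤ |(s - τ s) - (s' - τ s')|) ∧
      ∀ s s', |(s - τ s) - (s' - τ s')| ≤ C * |s - s'| := by
  obtain ⟨C, hC⟩ := hb
  set u : ℝ → ℝ := fun t => t - τ t
  have hdu : ∀ t, HasDerivAt u (1 - deriv τ t) t := fun t =>
    (hasDerivAt_id t).sub (hd t).hasDerivAt
  have hle : ∀ t, (⨅ t, (1 - deriv τ t)) ≤ deriv u t := fun t => by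
    rw [(hdu t).deriv]
    refine ciInf_le ⟨1 - C, ?_⟩ t
    rintro _ ⟨s, rfl⟩
    have := (abs_le.1 (hC s)).2
    simp only; linarith
  have hmono : StrictMono u := strictMono_of_deriv_pos fun t => hi.trans_le (hle t)
  refine ⟨_, 1 + C, hi, ?_, hmono, fun s s' => ?_, fun s s' => ?_⟩
  · have := (abs_nonneg _).trans (hC 0); linarith
  · wlog hss : s' ≤ s generalizing s s'
    · rw [abs_sub_comm, abs_sub_comm (s - τ s)]
      exact this s' s (le_of_not_ge hss)
    rw [abs_of_nonneg (sub_nonneg.2 hss)]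
    exact (mul_sub_le_image_sub_of_le_deriv (fun t => (hdu t).differentiableAt) hle hss).trans
      (le_abs_self _)
  · have := convex_univ.norm_image_sub_le_of_norm_deriv_le (f := u) (C := 1 + C)
      (fun t _ => (hdu t).differentiableAt) (fun t _ => by
        rw [(hdu t).deriv, Real.norm_eq_abs]
        refine (abs_sub _ _).trans ?_
        rw [abs_one]; linarith [hC t]) (mem_univ s') (mem_univ s)
    simpa [Real.norm_eq_abs] using this

/-! #### Measurability and bounds -/

lemma measurable_distributed (h : P.Admissible) (i : Fin m) {x : ℝ → ℝ} (hx : Measurable x) :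
    Measurable (P.distributed i x) := by
  have hv := (intervalIntegrable_iff_integrableOn_Ioc_of_le h.standing.T_pos.le).1
    (h.standing.v_integrable i)
  -- The kernel is only almost everywhere measurable, so joint measurability in `(t, s)` needs a
  -- measurable representative.
  have e : P.distributed i x = fun t => ∫ s in Ioc 0 P.T,
      hv.1.mk (P.v i) s * hill (P.β i) (x (t - s)) := by
    ext t
    rw [distributed, intervalIntegral.integral_of_le h.standing.T_pos.le]
    refine MeasureTheory.integral_congr_ae ?_
    filter_upwards [hv.1.ae_eq_mk] with s hs
    rw [hs]
  rw [e]
  refine (MeasureTheory.StronglyMeasurable.integral_prod_right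
    (f := fun t s => hv.1.mk (P.v i) s * hill (P.β i) (x (t - s))) ?_).measurable
  refine Measurable.stronglyMeasurable ?_
  refine (hv.1.stronglyMeasurable_mk.measurable.comp measurable_snd).mul
    ((measurable_hill _).comp (hx.comp (measurable_fst.sub measurable_snd)))

lemma measurable_H_comp (h : P.Admissible) (i : Fin m) {y : ℝ → ℝ} (hy : Measurable y)
    (hy0 : ∀ t, 0 ≤ y t) : Measurable fun t => P.H i t (y t) := by
  -- `H` is continuous only for nonnegative second argument; the truncation extends it continuously
  -- without changing it along `y`.
  have hc : Continuous fun z : ℝ × ℝ => P.H i z.1 (max z.2 0) := by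
    have := (h.a3.ap i).1.comp_continuous (f := fun z : ℝ × ℝ => (z.1, max z.2 0)) (by fun_prop)
      (fun z => ⟨mem_univ _, mem_Ici.2 (le_max_right z.2 0)⟩)
    exact this
  have := hc.measurable.comp (measurable_id.prodMk hy)
  convert this using 1
  ext t
  simp [max_eq_left (hy0 t)]

lemma measurable_production (h : P.Admissible) {x : ℝ → ℝ} (hx : Measurable x)
    (hx0 : ∀ t, 0 ≤ x t) : Measurable (P.production x) := by
  have hτ := fun i => (h.a4.τ_ap i).1.measurable
  have hσ := fun i => (h.a4.σ_ap i).1.measurable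
  have hb := fun i => (h.a2.b_ap i).1.measurable
  have hc := fun i => (h.a2.c_ap i).1.measurable
  unfold production
  refine Finset.measurable_sum _ fun i _ => Measurable.sub (Measurable.add ?_ ?_) ?_
  · exact (hb i).mul ((measurable_hill _).comp (hx.comp (measurable_id.sub (hτ i))))
  · exact (hc i).mul (h.measurable_distributed i hx)
  · exact h.measurable_H_comp i (hx.comp (measurable_id.sub (hσ i))) fun t => hx0 _

lemma integrable_v_mul (h : P.Admissible) (i : Fin m) {g : ℝ → ℝ} (hg : Measurable g)
    {C : ℝ} (hgC : ∀ s, |g s| ≤ C) :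
    IntervalIntegrable (fun s => P.v i s * g s) MeasureTheory.volume 0 P.T := by
  have hv := (intervalIntegrable_iff_integrableOn_Ioc_of_le h.standing.T_pos.le).1
    (h.standing.v_integrable i)
  rw [intervalIntegrable_iff_integrableOn_Ioc_of_le h.standing.T_pos.le]
  exact MeasureTheory.Integrable.mul_bdd hv hg.aestronglyMeasurable
    (Eventually.of_forall fun s => by simpa using hgC s)

lemma integral_v_mul_mono (h : P.Admissible) (i : Fin m) {g g' : ℝ → ℝ} (hg : Measurable g)
    (hg' : Measurable g') {C C' : ℝ} (hgC : ∀ s, |g s| ≤ C) (hgC' : ∀ s, |g' s| ≤ C')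
    (hle : ∀ s, g s ≤ g' s) :
    ∫ s in (0 : ℝ)..P.T, P.v i s * g s ≤ ∫ s in (0 : ℝ)..P.T, P.v i s * g' s :=
  intervalIntegral.integral_mono_on h.standing.T_pos.le (h.integrable_v_mul i hg hgC)
    (h.integrable_v_mul i hg' hgC') fun s hs =>
    mul_le_mul_of_nonneg_left (hle s) (h.standing.v_nonneg i s hs)

lemma integral_v_mul_const (h : P.Admissible) (i : Fin m) (C : ℝ) :
    ∫ s in (0 : ℝ)..P.T, P.v i s * C = C := by
  rw [intervalIntegral.integral_mul_const, h.standing.v_integral, one_mul]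

lemma measurable_hill_comp (p : ℝ) {x : ℝ → ℝ} (hx : Measurable x) (t : ℝ) :
    Measurable fun s => hill p (x (t - s)) :=
  (measurable_hill p).comp (hx.comp (measurable_const.sub measurable_id))

lemma abs_hill_le_one {p z : ℝ} (hz : 0 ≤ z) : |hill p z| ≤ 1 := by
  rw [abs_of_nonneg (hill_nonneg hz)]; exact hill_le_one hz

lemma distributed_mem (h : P.Admissible) (i : Fin m) {x : ℝ → ℝ} (hx : Measurable x)
    (hx0 : ∀ t, 0 ≤ x t) (t : ℝ) : 0 ≤ P.distributed i x t ∧ P.distributed i x t ≤ 1 := by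
  have hm := measurable_hill_comp (P.β i) hx t
  have hb : ∀ s, |hill (P.β i) (x (t - s))| ≤ 1 := fun s => abs_hill_le_one (hx0 _)
  constructor
  · have := h.integral_v_mul_mono i (measurable_const (a := (0 : ℝ))) hm
      (fun _ => le_rfl) hb (fun s => hill_nonneg (hx0 _))
    rwa [h.integral_v_mul_const] at this
  · have := h.integral_v_mul_mono i hm (measurable_const (a := (1 : ℝ)))
      hb (fun _ => le_rfl) (fun s => hill_le_one (hx0 _))
    rwa [h.integral_v_mul_const] at this

lemma le_distributed (h : P.Admissible) (i : Fin m) {x : ℝ → ℝ} (hx : Measurable x)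
    (hx0 : ∀ t, 0 ≤ x t) {M : ℝ} (hxM : ∀ t, x t ≤ M) (t : ℝ) :
    hill (P.β i) M ≤ P.distributed i x t := by
  have hm := measurable_hill_comp (P.β i) hx t
  have := h.integral_v_mul_mono i (measurable_const (a := hill (P.β i) M)) hm
    (fun _ => le_rfl) (fun s => abs_hill_le_one (hx0 _))
    (fun s => hill_anti (h.standing.β_pos i) (hx0 _) (hxM _))
  rwa [h.integral_v_mul_const] at this

variable (P) in
/-- The upper bound of the production term. -/
noncomputable def productionSup : ℝ := ∑ i, (P.bM i + P.cM i - P.HL i)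

variable (P) in
/-- The lower bound of the production term along functions bounded by `M₁`. -/
noncomputable def productionInf : ℝ :=
  ∑ i, (P.bL i * hill (P.α i) P.M₁ + P.cL i * hill (P.β i) P.M₁ - P.HM i)

variable (P) in
/-- A bound for the absolute value of the production term. -/
noncomputable def productionAbs : ℝ := ∑ i, (P.bM i + P.cM i + P.HM i)

lemma production_le (h : P.Admissible) {x : ℝ → ℝ} (hx : Measurable x) (hx0 : ∀ t, 0 ≤ x t)
    (t : ℝ) : P.production x t ≤ productionSup P := by
  refine Finset.sum_le_sum fun i _ => ?_
  have h1 := h.b_bounds i t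
  have h2 := h.c_bounds i t
  have h3 := h.H_bounds i t (hx0 (t - P.σ i t))
  have h4 := h.distributed_mem i hx hx0 t
  have h5 := hill_le_one (p := P.α i) (hx0 (t - P.τ i t))
  have h6 := mul_le_mul_of_nonneg_left h5 (h.a2.b_nonneg i t)
  have h7 := mul_le_mul_of_nonneg_left h4.2 (h.a2.c_nonneg i t)
  linarith

lemma le_production (h : P.Admissible) {x : ℝ → ℝ} (hx : Measurable x) (hx0 : ∀ t, 0 ≤ x t)
    (hxM : ∀ t, x t ≤ P.M₁) (t : ℝ) : productionInf P ≤ P.production x t := by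
  refine Finset.sum_le_sum fun i _ => ?_
  have h1 := h.b_bounds i t
  have h2 := h.c_bounds i t
  have h3 := h.H_bounds i t (hx0 (t - P.σ i t))
  have h4 := h.le_distributed i hx hx0 hxM t
  have h5 := hill_anti (h.standing.α_pos i) (hx0 (t - P.τ i t)) (hxM _)
  have h6 := mul_le_mul h1.1 h5 (hill_nonneg h.M₁_nonneg) (h.a2.b_nonneg i t)
  have h7 := mul_le_mul h2.1 h4 (hill_nonneg h.M₁_nonneg) (h.a2.c_nonneg i t)
  linarith

lemma abs_production_le (h : P.Admissible) {x : ℝ → ℝ} (hx : Measurable x) (hx0 : ∀ t, 0 ≤ x t)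
    (t : ℝ) : |P.production x t| ≤ productionAbs P := by
  refine (Finset.abs_sum_le_sum_abs _ _).trans (Finset.sum_le_sum fun i _ => ?_)
  have h1 := h.b_bounds i t
  have h2 := h.c_bounds i t
  have h3 := h.H_bounds i t (hx0 (t - P.σ i t))
  have h3' := h.a3.nonneg i t _ (hx0 (t - P.σ i t))
  have h4 := h.distributed_mem i hx hx0 t
  have h5 := hill_le_one (p := P.α i) (hx0 (t - P.τ i t))
  have h5' := hill_nonneg (p := P.α i) (hx0 (t - P.τ i t))
  have h6 := mul_le_mul_of_nonneg_left h5 (h.a2.b_nonneg i t)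
  have h7 := mul_le_mul_of_nonneg_left h4.2 (h.a2.c_nonneg i t)
  have h6' := mul_nonneg (h.a2.b_nonneg i t) h5'
  have h7' := mul_nonneg (h.a2.c_nonneg i t) h4.1
  rw [abs_le]
  constructor <;> linarith

lemma productionInf_le_productionSup (h : P.Admissible) : productionInf P ≤ productionSup P := by
  have h0 : ∀ t : ℝ, (0 : ℝ) ≤ (fun _ : ℝ => P.M₁) t := fun _ => h.M₁_nonneg
  exact (h.le_production measurable_const h0 (fun _ => le_rfl) 0).trans
    (h.production_le measurable_const h0 0)

lemma M₁_eq (P : Model m) : P.M₁ = P.A / P.aL * productionSup P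
    + P.A * max P.δM 0 / (1 - Real.exp (-P.aL * P.η)) := rfl

lemma M₂_eq (P : Model m) : P.M₂ = P.B / P.aM * productionInf P
    + if 0 ≤ P.δL then
        P.B * P.δL * Real.exp (-P.aM * P.ηBar) / (1 - Real.exp (-P.aM * P.ηBar))
      else P.A * P.δL / (1 - Real.exp (-P.aL * P.η)) := by
  simp only [M₂, productionInf, hill, mul_one_div]

/-! #### Comparison of production terms -/

/-- Difference of the production terms along two functions at two times. -/
lemma abs_production_sub_le (h : P.Admissible) {x y : ℝ → ℝ} (hx : Measurable x)
    (hy : Measurable y) (hxI : ∀ t, x t ∈ Icc P.M₂ P.M₁) (hyI : ∀ t, y t ∈ Icc P.M₂ P.M₁)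
    {t' t e : ℝ} {d₁ d₂ d₃ : Fin m → ℝ}
    (hb : ∀ i, |P.b i t' - P.b i t| ≤ e) (hc : ∀ i, |P.c i t' - P.c i t| ≤ e)
    (hH : ∀ i, ∀ z ∈ Icc 0 P.M₁, |P.H i t' z - P.H i t z| ≤ e)
    (h₁ : ∀ i, |x (t' - P.τ i t') - y (t - P.τ i t)| ≤ d₁ i)
    (h₂ : ∀ i, ∫ s in (0 : ℝ)..P.T, P.v i s * |x (t' - s) - y (t - s)| ≤ d₂ i)
    (h₃ : ∀ i, |x (t' - P.σ i t') - y (t - P.σ i t)| ≤ d₃ i) :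
    |P.production x t' - P.production y t| ≤
      ∑ i, (3 * e + P.bM i * P.KStar i * d₁ i + P.cM i * P.GStar i * d₂ i + P.L i * d₃ i) := by
  have hx0 : ∀ t, 0 ≤ x t := fun t => h.M₂_pos.le.trans (hxI t).1
  have hy0 : ∀ t, 0 ≤ y t := fun t => h.M₂_pos.le.trans (hyI t).1
  unfold production
  rw [← Finset.sum_sub_distrib]
  refine (Finset.abs_sum_le_sum_abs _ _).trans (Finset.sum_le_sum fun i _ => ?_)
  have hK0 : 0 ≤ P.KStar i := sSup_rpow_nonneg (h.standing.α_pos i) h.M₂_pos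
  have hG0 : 0 ≤ P.GStar i := sSup_rpow_nonneg (h.standing.β_pos i) h.M₂_pos
  have k1 : |hill (P.α i) (x (t' - P.τ i t')) - hill (P.α i) (y (t - P.τ i t))|
      ≤ P.KStar i * d₁ i :=
    (abs_hill_sub_le (h.standing.α_pos i) h.M₂_pos (hxI _) (hyI _)).trans
      (mul_le_mul_of_nonneg_left (h₁ i) hK0)
  have k2 : |P.distributed i x t' - P.distributed i y t| ≤ P.GStar i * d₂ i := by
    unfold distributed
    have mx := measurable_hill_comp (P.β i) hx t'
    have my := measurable_hill_comp (P.β i) hy t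
    have ix := h.integrable_v_mul i mx (fun s => abs_hill_le_one (hx0 _))
    have iy := h.integrable_v_mul i my (fun s => abs_hill_le_one (hy0 _))
    rw [← intervalIntegral.integral_sub ix iy]
    have md : Measurable fun s => |x (t' - s) - y (t - s)| := by
      have a1 : Measurable fun s => x (t' - s) := hx.comp (measurable_const.sub measurable_id)
      have a2 : Measurable fun s => y (t - s) := hy.comp (measurable_const.sub measurable_id)
      exact (a1.sub a2).abs
    have bd : ∀ s, |(|x (t' - s) - y (t - s)|)| ≤ P.M₁ := by
      intro s
      rw [abs_abs, abs_le]
      have := hxI (t' - s); have := hyI (t - s)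
      constructor <;> linarith [(hxI (t' - s)).1, (hxI (t' - s)).2, (hyI (t - s)).1,
        (hyI (t - s)).2, h.M₂_pos]
    have := intervalIntegral.norm_integral_le_of_norm_le h.standing.T_pos.le
      (f := fun s => P.v i s * hill (P.β i) (x (t' - s)) - P.v i s * hill (P.β i) (y (t - s)))
      (g := fun s => P.GStar i * (P.v i s * |x (t' - s) - y (t - s)|))
      (Eventually.of_forall fun s hs => by
        have hv0 := h.standing.v_nonneg i s (Ioc_subset_Icc_self hs)
        rw [← mul_sub, Real.norm_eq_abs, abs_mul, abs_of_nonneg hv0]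
        have := mul_le_mul_of_nonneg_left
          (abs_hill_sub_le (h.standing.β_pos i) h.M₂_pos (hxI (t' - s)) (hyI (t - s))) hv0
        refine this.trans (le_of_eq ?_)
        unfold GStar; ring)
      ((h.integrable_v_mul i md bd).const_mul _)
    rw [Real.norm_eq_abs, intervalIntegral.integral_const_mul] at this
    exact this.trans (mul_le_mul_of_nonneg_left (h₂ i) hG0)
  have k3 : |P.H i t' (x (t' - P.σ i t')) - P.H i t (y (t - P.σ i t))| ≤ e + P.L i * d₃ i := by
    refine (abs_sub_le _ (P.H i t (x (t' - P.σ i t'))) _).trans (add_le_add ?_ ?_)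
    · exact hH i _ ⟨hx0 _, (hxI _).2⟩
    · exact (h.a3.lipschitz i t _ _ (hx0 _) (hy0 _)).trans
        (mul_le_mul_of_nonneg_left (h₃ i) (h.a3.L_pos i).le)
  have k4 : |P.b i t' * hill (P.α i) (x (t' - P.τ i t'))
      - P.b i t * hill (P.α i) (y (t - P.τ i t))| ≤ e + P.bM i * P.KStar i * d₁ i := by
    have : P.b i t' * hill (P.α i) (x (t' - P.τ i t'))
      - P.b i t * hill (P.α i) (y (t - P.τ i t))
      = (P.b i t' - P.b i t) * hill (P.α i) (x (t' - P.τ i t')) + P.b i t *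
        (hill (P.α i) (x (t' - P.τ i t')) - hill (P.α i) (y (t - P.τ i t))) := by ring
    rw [this]
    refine (abs_add_le _ _).trans (add_le_add ?_ ?_)
    · rw [abs_mul]
      exact (mul_le_of_le_one_right (abs_nonneg _) (abs_hill_le_one (hx0 _))).trans (hb i)
    · rw [abs_mul, abs_of_nonneg (h.a2.b_nonneg i t), mul_assoc]
      exact mul_le_mul (h.b_bounds i t).2 k1 (abs_nonneg _) (h.bM_nonneg i)
  have k5 : |P.c i t' * P.distributed i x t' - P.c i t * P.distributed i y t|
      ≤ e + P.cM i * P.GStar i * d₂ i := by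
    have : P.c i t' * P.distributed i x t' - P.c i t * P.distributed i y t
      = (P.c i t' - P.c i t) * P.distributed i x t' + P.c i t *
        (P.distributed i x t' - P.distributed i y t) := by ring
    rw [this]
    have hd := h.distributed_mem i hx hx0 t'
    refine (abs_add_le _ _).trans (add_le_add ?_ ?_)
    · rw [abs_mul, abs_of_nonneg hd.1]
      exact (mul_le_of_le_one_right (abs_nonneg _) hd.2).trans (hc i)
    · rw [abs_mul, abs_of_nonneg (h.a2.c_nonneg i t), mul_assoc]
      exact mul_le_mul (h.c_bounds i t).2 k2 (abs_nonneg _) (h.cM_nonneg i)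
  rw [abs_le] at k3 k4 k5 ⊢
  constructor <;> linarith [k3.1, k3.2, k4.1, k4.2, k5.1, k5.2]

/-! #### Continuity -/

/-- Integration smooths the jumps: for fixed `t`, the function `x` is continuous at `t - s` for all
but countably many `s`, and dominated convergence applies. -/
lemma continuousAt_distributed (h : P.Admissible) (i : Fin m) {x : ℝ → ℝ} (hx : PLC P.θ x)
    (hx0 : ∀ t, 0 ≤ x t) (t : ℝ) : ContinuousAt (P.distributed i x) t := by
  have hv := h.standing.v_integrable i
  refine intervalIntegral.continuousAt_of_dominated_interval (bound := fun s => ‖P.v i s‖)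
    (Eventually.of_forall fun t' => ?_) (Eventually.of_forall fun t' => Eventually.of_forall
      fun s _ => ?_) hv.norm ?_
  · have := h.integrable_v_mul i (measurable_hill_comp (P.β i) hx.measurable t')
      (fun s => abs_hill_le_one (hx0 _))
    exact this.aestronglyMeasurable_restrict_uIoc
  · rw [norm_mul]
    exact mul_le_of_le_one_right (norm_nonneg _) (abs_hill_le_one (hx0 _))
  · have hcount : {s | t - s ∈ range P.θ}.Countable := by
      have : {s | t - s ∈ range P.θ} = (fun w => t - w) '' range P.θ := by
        ext s; constructor
        · exact fun hs => ⟨t - s, hs, by simp⟩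
        · rintro ⟨w, hw, rfl⟩; simpa using hw
      rw [this]; exact (countable_range P.θ).image _
    filter_upwards [hcount.ae_notMem MeasureTheory.volume] with s hs _
    have h1 : ContinuousAt (fun t' => x (t' - s)) t :=
      ContinuousAt.comp (f := fun t' => t' - s) (hx.continuousAt (t - s) hs) (by fun_prop)
    exact continuousAt_const.mul (ContinuousAt.comp (g := hill (P.β i))
      (continuousAt_hill (h.standing.β_pos i) (hx0 _)) h1)

lemma continuousWithinAt_production (h : P.Admissible) {x : ℝ → ℝ} (hx : PLC P.θ x)
    (hx0 : ∀ t, 0 ≤ x t) (t : ℝ) (S : Set ℝ)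
    (hτ : ∀ i, ContinuousWithinAt (fun s => x (s - P.τ i s)) S t)
    (hσ : ∀ i, ContinuousWithinAt (fun s => x (s - P.σ i s)) S t) :
    ContinuousWithinAt (P.production x) S t := by
  unfold production
  refine tendsto_finsetSum _ fun i _ => ContinuousWithinAt.sub
    (ContinuousWithinAt.add ?_ ?_) ?_
  · exact (h.a2.b_ap i).1.continuousWithinAt.mul
      (ContinuousAt.comp_continuousWithinAt (g := hill (P.α i))
        (continuousAt_hill (h.standing.α_pos i) (hx0 _)) (hτ i))
  · exact (h.a2.c_ap i).1.continuousWithinAt.mul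
      (h.continuousAt_distributed i hx hx0 t).continuousWithinAt
  · have hH : ContinuousWithinAt (fun z : ℝ × ℝ => P.H i z.1 z.2) (univ ×ˢ Ici 0)
        (t, x (t - P.σ i t)) := (h.a3.ap i).1 _ ⟨mem_univ _, hx0 _⟩
    exact hH.comp (f := fun s => (s, x (s - P.σ i s))) (continuousWithinAt_id.prodMk (hσ i))
      (fun s _ => ⟨mem_univ _, hx0 _⟩)

/-- An increasing delayed argument approaches its limit from the left, where `x` is continuous even
at impulse times. -/
lemma continuousWithinAt_comp_delay {x : ℝ → ℝ} (hx : PLC P.θ x) {τ : ℝ → ℝ} (hτ : Continuous τ)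
    (hm : StrictMono fun t => t - τ t) (t : ℝ) :
    ContinuousWithinAt (fun s => x (s - τ s)) (Iic t) t :=
  (hx.tendsto_left (t - τ t)).comp (f := fun s => s - τ s)
    (by fun_prop : Continuous fun s => s - τ s).continuousWithinAt
    (fun _ hs => hm.monotone hs)

lemma continuousAt_comp_delay {x : ℝ → ℝ} (hx : PLC P.θ x) {τ : ℝ → ℝ} (hτ : Continuous τ)
    {t : ℝ} (ht : t - τ t ∉ range P.θ) : ContinuousAt (fun s => x (s - τ s)) t :=
  ContinuousAt.comp (f := fun s => s - τ s) (hx.continuousAt _ ht)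
    (by fun_prop : Continuous fun s => s - τ s).continuousAt

end Admissible
end Model

namespace Model

variable {m : ℕ} {P : Model m}

namespace Admissible

/-! ### A priori bounds -/

/-- The quotient is the integral of `exp (l * u)` over `[0, r]`. -/
lemma exp_sub_one_div_mono {l l' : ℝ} (hl : 0 < l) (hll : l ≤ l') {r : ℝ} (hr : 0 ≤ r) :
    (Real.exp (l * r) - 1) / l ≤ (Real.exp (l' * r) - 1) / l' := by
  have e : ∀ l : ℝ, 0 < l → (Real.exp (l * r) - 1) / l
      = ∫ u in (0 : ℝ)..r, Real.exp (-l * (0 - u)) := by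
    intro l hl
    rw [integral_exp_scale hl.ne']; simp
  rw [e l hl, e l' (hl.trans_le hll)]
  refine intervalIntegral.integral_mono_on hr ((by fun_prop : Continuous _).intervalIntegrable _ _)
    ((by fun_prop : Continuous _).intervalIntegrable _ _) fun u hu => ?_
  refine Real.exp_le_exp.2 ?_
  nlinarith [hu.1]

/-- If the production term can be negative, the impulses outweigh it on every interval. -/
lemma grouped_nonneg (h : P.Admissible) (hS : productionInf P ≤ 0) :
    0 ≤ P.δL ∧ 0 ≤ P.δL + productionInf P * ((Real.exp (P.aM * P.ηBar) - 1) / P.aM) := by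
  have hl := h.linear
  have hM := h.M₂_pos
  rw [M₂_eq] at hM
  have hB := hl.B_pos
  have hhi := hl.hi_pos
  have h1 : P.B / P.aM * productionInf P ≤ 0 :=
    mul_nonpos_of_nonneg_of_nonpos (by positivity) hS
  have hδ : 0 ≤ P.δL := by
    by_contra hneg
    rw [if_neg hneg] at hM
    have : P.A * P.δL / (1 - Real.exp (-P.aL * P.η)) ≤ 0 :=
      div_nonpos_of_nonpos_of_nonneg
        (mul_nonpos_of_nonneg_of_nonpos hl.A_pos.le (not_le.1 hneg).le) hl.one_sub_exp_pos.le
    linarith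
  refine ⟨hδ, ?_⟩
  rw [if_pos hδ] at hM
  have hpos : 0 < P.aM * P.ηBar := mul_pos hhi (hl.η_pos.trans_le hl.η_le)
  have hE1 : 1 < Real.exp (P.aM * P.ηBar) := by simpa using Real.exp_lt_exp.2 hpos
  rw [neg_mul, Real.exp_neg] at hM
  set E := Real.exp (P.aM * P.ηBar)
  -- `M₂` is a positive multiple of the grouped quantity, so its positivity is exactly the required
  -- inequality.
  have h2 : P.B / P.aM * productionInf P + P.B * P.δL * E⁻¹ / (1 - E⁻¹)
      = P.B / (E - 1) * (P.δL + productionInf P * ((E - 1) / P.aM)) := by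
    have : E - 1 ≠ 0 := by linarith
    have h0 : E ≠ 0 := by linarith
    have h3 : 1 - E⁻¹ = (E - 1) / E := by field_simp
    rw [h3]; field_simp; ring
  rw [h2] at hM
  exact (pos_of_mul_pos_right hM (div_nonneg hB.le (by linarith))).le

/-- If `productionSup` is negative, so is `productionInf`, and `grouped_nonneg` provides what the
grouped upper bound needs. -/
lemma mild_le_M₁ (h : P.Admissible) {f x : ℝ → ℝ} (hx : Mild P.a P.θ P.γ f P.δ x)
    (hb : RecurrentlyBounded P.θ x) (hf : Measurable f) {K : ℝ} (hK : ∀ t, |f t| ≤ K)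
    (hfF : ∀ t, f t ≤ productionSup P) (t : ℝ) : x t ≤ P.M₁ := by
  have hl := h.linear
  have hδ : ∀ k, P.δ k ≤ max P.δM 0 := fun k => (h.δ_bounds k).2.trans (le_max_left _ _)
  rw [M₁_eq]
  rcases le_total 0 (productionSup P) with hF | hF
  · exact hl.mild_le_of_le_const hx hb hf hK hF hfF (le_max_right _ _) hδ t
  · refine hl.mild_le_of_le_const_of_nonpos hx hb hf hK hF hfF hδ ?_ t
    have hSF := h.productionInf_le_productionSup
    obtain ⟨-, h1⟩ := h.grouped_nonneg (hSF.trans hF)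
    have hη := (hl.η_pos.trans_le hl.η_le).le
    -- The inequality known for `δL`, `productionInf` and the rate `aM` passes to `max δM 0`,
    -- `productionSup` and `aL`: the first two increase, and a smaller rate weakens the loss.
    have h2 := exp_sub_one_div_mono hl.lo_pos hl.lo_le_hi hη
    have h3 : 0 ≤ (Real.exp (P.aL * P.ηBar) - 1) / P.aL := by
      have := exp_sub_one_div_mono hl.lo_pos le_rfl hη
      have h4 := Real.add_one_le_exp (P.aL * P.ηBar)
      have := mul_nonneg hl.lo_pos.le hη
      exact div_nonneg (by linarith) hl.lo_pos.le
    have h5 := (h.δ_bounds 0).1.trans (hδ 0)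
    nlinarith [mul_le_mul_of_nonpos_left h2 (hSF.trans hF), mul_le_mul_of_nonneg_right hSF h3]

/-- The signs of `productionInf` and `δL` select one of three lower bounds; both being negative is
incompatible with `0 < M₂`. -/
lemma M₂_le_mild (h : P.Admissible) {f x : ℝ → ℝ} (hx : Mild P.a P.θ P.γ f P.δ x)
    (hb : RecurrentlyBounded P.θ x) (hf : Measurable f) {K : ℝ} (hK : ∀ t, |f t| ≤ K)
    (hfS : ∀ t, productionInf P ≤ f t) (t : ℝ) : P.M₂ ≤ x t := by
  have hl := h.linear
  have hδ : ∀ k, P.δL ≤ P.δ k := fun k => (h.δ_bounds k).1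
  rw [M₂_eq]
  rcases le_total (productionInf P) 0 with hS | hS
  · obtain ⟨h1, h2⟩ := h.grouped_nonneg hS
    rw [if_pos h1]
    exact hl.le_mild_of_const_le_of_nonpos hx hb hf hK hS hfS hδ h2 t
  · split_ifs with hD
    · exact hl.le_mild_of_const_le hx hb hf hK hS hfS hD hδ t
    · exact hl.le_mild_of_const_le_of_impulses_nonpos hx hb hf hK hS hfS (not_le.1 hD).le hδ t

/-! ### Existence and uniqueness of the solution between the bounds -/

variable (P) in
/-- The contraction constant before multiplication by the norm of the linear solution operator. -/
noncomputable def lipschitzSum : ℝ := ∑ i, (P.bM i * P.KStar i + P.cM i * P.GStar i + P.L i)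

lemma lipschitzSum_nonneg (h : P.Admissible) : 0 ≤ lipschitzSum P := by
  refine Finset.sum_nonneg fun i _ => ?_
  have hK0 : 0 ≤ P.KStar i := sSup_rpow_nonneg (h.standing.α_pos i) h.M₂_pos
  have hG0 : 0 ≤ P.GStar i := sSup_rpow_nonneg (h.standing.β_pos i) h.M₂_pos
  have := h.bM_nonneg i
  have := h.cM_nonneg i
  have := h.a3.L_pos i
  positivity

lemma abs_production_sub_le_mul (h : P.Admissible) {x y : ℝ → ℝ} (hx : Measurable x)
    (hy : Measurable y) (hxI : ∀ t, x t ∈ Icc P.M₂ P.M₁) (hyI : ∀ t, y t ∈ Icc P.M₂ P.M₁) {D : ℝ}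
    (hD : ∀ t, |x t - y t| ≤ D) (t : ℝ) :
    |P.production x t - P.production y t| ≤ lipschitzSum P * D := by
  have hD0 : 0 ≤ D := (abs_nonneg _).trans (hD 0)
  have := h.abs_production_sub_le hx hy hxI hyI (t' := t) (t := t) (e := 0)
    (d₁ := fun _ => D) (d₂ := fun _ => D) (d₃ := fun _ => D) (by simp) (by simp) (by simp)
    (fun i => hD _) (fun i => ?_) (fun i => hD _)
  · refine this.trans (le_of_eq ?_)
    rw [lipschitzSum, Finset.sum_mul]
    exact Finset.sum_congr rfl fun i _ => by ring
  · have a1 : Measurable fun s => x (t - s) := hx.comp (measurable_const.sub measurable_id)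
    have a2 : Measurable fun s => y (t - s) := hy.comp (measurable_const.sub measurable_id)
    have := h.integral_v_mul_mono i (g := fun s => |x (t - s) - y (t - s)|) (g' := fun _ => D)
      (a1.sub a2).abs measurable_const
      (fun s => by rw [abs_abs]; exact hD _) (fun _ => le_rfl) (fun s => hD _)
    rwa [h.integral_v_mul_const] at this

/-- The additive impulses cancel in the difference, so only the factor `A / aL` of the forcing
remains. -/
lemma abs_mild_sub_le (h : P.Admissible) {x y u w : ℝ → ℝ} (hx : Measurable x)
    (hy : Measurable y) (hxI : ∀ t, x t ∈ Icc P.M₂ P.M₁) (hyI : ∀ t, y t ∈ Icc P.M₂ P.M₁)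
    (hu : Mild P.a P.θ P.γ (P.production x) P.δ u) (hw : Mild P.a P.θ P.γ (P.production y) P.δ w)
    (huI : ∀ t, u t ∈ Icc P.M₂ P.M₁) (hwI : ∀ t, w t ∈ Icc P.M₂ P.M₁) {D : ℝ}
    (hD : ∀ t, |x t - y t| ≤ D) (t : ℝ) :
    |u t - w t| ≤ P.A / P.aL * lipschitzSum P * D := by
  have hl := h.linear
  have hx0 : ∀ t, 0 ≤ x t := fun t => h.M₂_pos.le.trans (hxI t).1
  have hy0 : ∀ t, 0 ≤ y t := fun t => h.M₂_pos.le.trans (hyI t).1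
  have mx := h.measurable_production hx hx0
  have my := h.measurable_production hy hy0
  have hsub := Mild.sub hl.cont mx (h.abs_production_le hx hx0) my (h.abs_production_le hy hy0)
    hu hw
  have hb : RecurrentlyBounded P.θ fun t => u t - w t :=
    recurrentlyBounded_of_bounded P.θ (C := P.M₁ - P.M₂) fun t => by
      rw [abs_le]
      constructor <;> linarith [(huI t).1, (huI t).2, (hwI t).1, (hwI t).2]
  have := hl.abs_mild_le_of_abs_le_const hsub hb (mx.sub my)
    (h.abs_production_sub_le_mul hx hy hxI hyI hD) (ρ := 0) (by simp) t
  simpa [mul_assoc] using this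

lemma exists_mild_mem_Icc (h : P.Admissible) {f : ℝ → ℝ} (hf : Measurable f) {K : ℝ}
    (hK : ∀ t, |f t| ≤ K) (hfS : ∀ t, productionInf P ≤ f t) (hfF : ∀ t, f t ≤ productionSup P) :
    ∃ y, Mild P.a P.θ P.γ f P.δ y ∧ Measurable y ∧ ∀ t, y t ∈ Icc P.M₂ P.M₁ := by
  obtain ⟨D, hD⟩ := SeqAP.bounded h.a5
  obtain ⟨y, hy, hb⟩ := h.linear.exists_mild hK hD
  exact ⟨y, hy, (h.linear.plc_mild hf hK hy).1.measurable, fun t =>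
    ⟨h.M₂_le_mild hy hb hf hK hfS t, h.mild_le_M₁ hy hb hf hK hfF t⟩⟩

/-- Successive approximation with pointwise geometric estimates, uniform in `t`; measurability
survives because a pointwise limit of measurable functions is measurable. -/
lemma exists_mild_fixed_point (h : P.Admissible) :
    ∃ x, Mild P.a P.θ P.γ (P.production x) P.δ x ∧ Measurable x ∧ ∀ t, x t ∈ Icc P.M₂ P.M₁ := by
  obtain ⟨x₀, -, hx₀, hx₀I⟩ := h.exists_mild_mem_Icc (f := fun _ => productionInf P)
    measurable_const (fun _ => le_rfl) (fun _ => le_rfl)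
    (fun _ => h.productionInf_le_productionSup)
  let X := {x : ℝ → ℝ // Measurable x ∧ ∀ t, x t ∈ Icc P.M₂ P.M₁}
  have hstep : ∀ x : X, ∃ y : X, Mild P.a P.θ P.γ (P.production x.1) P.δ y.1 := by
    rintro ⟨x, hx, hxI⟩
    have hx0 : ∀ t, 0 ≤ x t := fun t => h.M₂_pos.le.trans (hxI t).1
    obtain ⟨y, hy, hym, hyI⟩ := h.exists_mild_mem_Icc (h.measurable_production hx hx0)
      (h.abs_production_le hx hx0) (h.le_production hx hx0 fun t => (hxI t).2)
      (h.production_le hx hx0)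
    exact ⟨⟨y, hym, hyI⟩, hy⟩
  -- Any choice will do: the contraction estimate holds for all mild solutions with values in `[M₂,
  -- M₁]`.
  choose Φ hΦ using hstep
  set q := P.A / P.aL * lipschitzSum P
  have hq0 : 0 ≤ q := mul_nonneg (div_nonneg h.linear.A_pos.le h.linear.lo_pos.le)
    h.lipschitzSum_nonneg
  have hq1 : q < 1 := h.contraction
  have hcontr : ∀ (x y : X) (D : ℝ), (∀ t, |x.1 t - y.1 t| ≤ D) →
      ∀ t, |(Φ x).1 t - (Φ y).1 t| ≤ q * D := fun x y D hD t =>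
    h.abs_mild_sub_le x.2.1 y.2.1 x.2.2 y.2.2 (hΦ x) (hΦ y) (Φ x).2.2 (Φ y).2.2 hD t
  let u : ℕ → X := fun n => Φ^[n] ⟨x₀, hx₀, hx₀I⟩
  have hu : ∀ n, u (n + 1) = Φ (u n) := fun n => Function.iterate_succ_apply' _ _ _
  have hdist : ∀ n t, dist ((u n).1 t) ((u (n + 1)).1 t) ≤ (P.M₁ - P.M₂) * q ^ n := by
    intro n
    induction n with
    | zero =>
      intro t
      have h1 := (u 0).2.2 t
      have h2 := (u 1).2.2 t
      rw [Real.dist_eq, abs_le, pow_zero, mul_one]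
      constructor <;> linarith [h1.1, h1.2, h2.1, h2.2]
    | succ n ih =>
      intro t
      have := hcontr _ _ _ ih t
      rw [hu (n + 1), hu n, Real.dist_eq, ← hu n]
      rw [← hu n] at this
      rw [hu n] at this ⊢
      rw [pow_succ]
      linarith
  have hlim : ∀ t, ∃ l, Tendsto (fun n => (u n).1 t) atTop (𝓝 l) := fun t =>
    cauchySeq_tendsto_of_complete
      (cauchySeq_of_le_geometric q (P.M₁ - P.M₂) hq1 fun n => hdist n t)
  choose x hx using hlim
  have hxm : Measurable x :=
    measurable_of_tendsto_metrizable (fun n => (u n).2.1) (tendsto_pi_nhds.2 hx)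
  have hxI : ∀ t, x t ∈ Icc P.M₂ P.M₁ := fun t =>
    isClosed_Icc.mem_of_tendsto (hx t) (Eventually.of_forall fun n => (u n).2.2 t)
  have hxd : ∀ n t, |(u n).1 t - x t| ≤ (P.M₁ - P.M₂) * q ^ n / (1 - q) := fun n t =>
    dist_le_of_le_geometric_of_tendsto q (P.M₁ - P.M₂) hq1 (fun n => hdist n t) (hx t) n
  let x' : X := ⟨x, hxm, hxI⟩
  have hfix : (Φ x').1 = x := by
    ext t
    have h1 : ∀ n, |(u (n + 1)).1 t - (Φ x').1 t| ≤ q * ((P.M₁ - P.M₂) * q ^ n / (1 - q)) :=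
      fun n => by rw [hu]; exact hcontr (u n) x' _ (hxd n) t
    have h2 : Tendsto (fun n : ℕ => q * ((P.M₁ - P.M₂) * q ^ n / (1 - q))) atTop (𝓝 0) := by
      have := (((tendsto_pow_atTop_nhds_zero_of_lt_one hq0 hq1).const_mul
        (P.M₁ - P.M₂)).div_const (1 - q)).const_mul q
      simpa using this
    have h3 : Tendsto (fun n => (u (n + 1)).1 t) atTop (𝓝 ((Φ x').1 t)) := by
      rw [tendsto_iff_dist_tendsto_zero]
      exact squeeze_zero (fun _ => dist_nonneg) h1 h2
    exact tendsto_nhds_unique h3 ((tendsto_add_atTop_iff_nat 1).2 (hx t))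
  refine ⟨x, ?_, hxm, hxI⟩
  have := hΦ x'
  rwa [hfix] at this

lemma mild_fixed_point_unique (h : P.Admissible) {x y : ℝ → ℝ}
    (hx : Mild P.a P.θ P.γ (P.production x) P.δ x) (hxm : Measurable x)
    (hxI : ∀ t, x t ∈ Icc P.M₂ P.M₁)
    (hy : Mild P.a P.θ P.γ (P.production y) P.δ y) (hym : Measurable y)
    (hyI : ∀ t, y t ∈ Icc P.M₂ P.M₁) : x = y := by
  set q := P.A / P.aL * lipschitzSum P
  have hq0 : 0 ≤ q := mul_nonneg (div_nonneg h.linear.A_pos.le h.linear.lo_pos.le)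
    h.lipschitzSum_nonneg
  have hq1 : q < 1 := h.contraction
  have hn : ∀ n : ℕ, ∀ t, |x t - y t| ≤ q ^ n * (P.M₁ - P.M₂) := by
    intro n
    induction n with
    | zero =>
      intro t
      rw [abs_le, pow_zero, one_mul]
      constructor <;> linarith [(hxI t).1, (hxI t).2, (hyI t).1, (hyI t).2]
    | succ n ih =>
      intro t
      have := h.abs_mild_sub_le hxm hym hxI hyI hx hy hxI hyI ih t
      rw [pow_succ']
      linarith
  ext t
  have h2 : Tendsto (fun n : ℕ => q ^ n * (P.M₁ - P.M₂)) atTop (𝓝 0) := by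
    simpa using (tendsto_pow_atTop_nhds_zero_of_lt_one hq0 hq1).mul_const (P.M₁ - P.M₂)
  have := ge_of_tendsto' h2 fun n => hn n t
  exact sub_eq_zero.1 (abs_nonpos_iff.1 this)

/-! ### Mild fixed points and solutions -/

lemma isSolution_of_mild (h : P.Admissible) {x : ℝ → ℝ}
    (hx : Mild P.a P.θ P.γ (P.production x) P.δ x) (hxm : Measurable x) (hx0 : ∀ t, 0 ≤ x t) :
    P.IsSolution x := by
  have hl := h.linear
  have mx := h.measurable_production hxm hx0
  have bx := h.abs_production_le hxm hx0
  obtain ⟨hplc, hjump⟩ := hl.plc_mild mx bx hx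
  refine ⟨hplc, fun t ht => ?_, fun t ht ht' => ?_, hjump⟩
  · rw [rhs_eq]
    refine hl.hasDerivWithinAt_mild mx bx hx ht (Iic t)
      (h.continuousWithinAt_production hplc hx0 t _ (fun i => ?_) fun i => ?_)
    · obtain ⟨_, _, _, _, hm, _⟩ := exists_bilipschitz (h.a4.τ_differentiable i)
        (h.a4.τ_deriv_bounded i) (h.a4.τ_deriv i)
      exact continuousWithinAt_comp_delay hplc (h.a4.τ_ap i).1 hm t
    · obtain ⟨_, _, _, _, hm, _⟩ := exists_bilipschitz (h.a4.σ_differentiable i)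
        (h.a4.σ_deriv_bounded i) (h.a4.σ_deriv i)
      exact continuousWithinAt_comp_delay hplc (h.a4.σ_ap i).1 hm t
  · rw [rhs_eq, ← hasDerivWithinAt_univ]
    have : intervalIntegral.FTCFilter t (𝓝[univ] t) (𝓝[univ] t) := by
      rw [nhdsWithin_univ]; infer_instance
    exact hl.hasDerivWithinAt_mild mx bx hx ht univ
      (h.continuousWithinAt_production hplc hx0 t _
        (fun i => (continuousAt_comp_delay hplc (h.a4.τ_ap i).1 (ht' i).1).continuousWithinAt)
        (fun i => (continuousAt_comp_delay hplc (h.a4.σ_ap i).1 (ht' i).2).continuousWithinAt))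

variable (P) in
/-- The times at which some delayed argument is an impulse time. -/
def exceptionalTimes : Set ℝ :=
  ⋃ i, ((fun t => t - P.τ i t) ⁻¹' range P.θ ∪ (fun t => t - P.σ i t) ⁻¹' range P.θ)

lemma countable_exceptionalTimes (h : P.Admissible) : (exceptionalTimes P).Countable := by
  refine countable_iUnion fun i => ?_
  obtain ⟨_, _, _, _, hm, _⟩ := exists_bilipschitz (h.a4.τ_differentiable i)
    (h.a4.τ_deriv_bounded i) (h.a4.τ_deriv i)
  obtain ⟨_, _, _, _, hm', _⟩ := exists_bilipschitz (h.a4.σ_differentiable i)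
    (h.a4.σ_deriv_bounded i) (h.a4.σ_deriv i)
  exact ((countable_range P.θ).preimage_of_injOn hm.injective.injOn).union
    ((countable_range P.θ).preimage_of_injOn hm'.injective.injOn)

lemma notMem_range_of_mem_Ioo {θ : ℤ → ℝ} (hθ : StrictMono θ) {k : ℤ} {t : ℝ}
    (ht : t ∈ Ioo (θ k) (θ (k + 1))) : t ∉ range θ := by
  rintro ⟨j, rfl⟩
  have := hθ.lt_iff_lt.1 ht.1
  have := hθ.lt_iff_lt.1 ht.2
  omega

lemma IsSolution.hasDerivAt {x : ℝ → ℝ} (hx : P.IsSolution x) {t : ℝ} (ht : t ∉ range P.θ)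
    (ht' : t ∉ exceptionalTimes P) : HasDerivAt x (-P.a t * x t + P.production x t) t := by
  rw [← rhs_eq]
  simp only [exceptionalTimes, mem_iUnion, mem_union, mem_preimage, not_exists, not_or] at ht'
  exact hx.deriv t ht ht'

lemma mild_of_isSolution (h : P.Admissible) {x : ℝ → ℝ} (hx : P.IsSolution x)
    (hx0 : ∀ t, 0 ≤ x t) : Mild P.a P.θ P.γ (P.production x) P.δ x := by
  have hl := h.linear
  have hxm := hx.plc.measurable
  exact mild_of_hasDerivAt hl.cont (h.measurable_production hxm hx0)
    (h.abs_production_le hxm hx0) (hx.plc.continuousOn hl.strictMono) hx.jump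
    h.countable_exceptionalTimes
    (fun k t ht ht' => IsSolution.hasDerivAt hx (notMem_range_of_mem_Ioo hl.strictMono ht) ht')

/-- Almost periodicity says nothing near impulse times. The value at one interval midpoint is
therefore transported by almost periods to arbitrarily early times, and from there the flow reaches
the next impulse at bounded cost. -/
lemma recurrentlyBounded_of_piecewiseAP (h : P.Admissible) {x : ℝ → ℝ} (hx : P.IsSolution x)
    (hx0 : ∀ t, 0 ≤ x t) (hap : PiecewiseAP P.θ x) : RecurrentlyBounded P.θ x := by
  have hl := h.linear
  have hxm := hx.plc.measurable
  have mx := h.measurable_production hxm hx0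
  have bx := h.abs_production_le hxm hx0
  have hmild := h.mild_of_isSolution hx hx0
  have hgap : P.θ 0 < P.θ 1 := hl.strictMono one_pos
  set t₀ := (P.θ 0 + P.θ 1) / 2
  set ε := (P.θ 1 - P.θ 0) / 4
  have hε : 0 < ε := by simp only [ε]; linarith
  have ht₀ : ∀ k, ε < |t₀ - P.θ k| := by
    intro k
    rw [lt_abs]
    rcases le_or_gt k 0 with hk | hk
    · left
      have := hl.strictMono.monotone hk
      simp only [t₀, ε]; linarith
    · right
      have := hl.strictMono.monotone (show 1 ≤ k by omega)
      simp only [t₀, ε]; linarith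
  obtain ⟨ℓ, hℓ, hS⟩ := hap.almost_periods ε hε
  refine ⟨|x t₀| + ε + productionAbs P * P.ηBar, fun K => ?_⟩
  -- This window puts `t₀ + ω` in `[θ K - ℓ, θ K]`, so the impulse that follows has index at most
  -- `K`.
  obtain ⟨ω, hω, h1, h2⟩ := hS (P.θ K - ℓ - t₀)
  have hs := hω t₀ ht₀
  set s := t₀ + ω
  obtain ⟨k, hk⟩ := exists_index hl.strictMono hl.tendsto_atTop hl.tendsto_atBot s
  have hkK : k < K := hl.strictMono.lt_iff_lt.1 (hk.1.trans_le (by simp only [s]; linarith))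
  refine ⟨k + 1, by omega, ?_⟩
  rw [hmild.flow hl.cont mx bx hk.1 hk.2 le_rfl]
  refine (abs_add_le _ _).trans ?_
  have i1 : |decay P.a s (P.θ (k + 1)) * x s| ≤ |x s| := by
    rw [abs_mul, abs_of_pos (decay_pos _ _ _)]
    exact mul_le_of_le_one_left (abs_nonneg _) (hl.decay_le_one hk.2)
  have i2 := hl.abs_integral_decay_mul_le bx hk.2
  have i3 : P.θ (k + 1) - s ≤ P.ηBar := by linarith [hk.1, hl.gap_le k]
  have i4 := mul_le_mul_of_nonneg_left i3 ((abs_nonneg _).trans (bx 0))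
  have i5 := abs_sub_abs_le_abs_sub (x s) (x t₀)
  linarith

/-- The a priori bounds come in order: `M₁` needs only nonnegativity, while the lower bound of the
production term presupposes `x ≤ M₁`. -/
lemma unique_solution (h : P.Admissible) {x y : ℝ → ℝ} (hx : P.IsSolution x)
    (hxap : PiecewiseAP P.θ x) (hx0 : ∀ t, 0 < x t) (hy : P.IsSolution y)
    (hyap : PiecewiseAP P.θ y) (hy0 : ∀ t, 0 < y t) : x = y := by
  have key : ∀ {x : ℝ → ℝ}, P.IsSolution x → PiecewiseAP P.θ x → (∀ t, 0 < x t) →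
      Mild P.a P.θ P.γ (P.production x) P.δ x ∧ Measurable x ∧ ∀ t, x t ∈ Icc P.M₂ P.M₁ := by
    intro x hx hxap hx0
    have hx0' := fun t => (hx0 t).le
    have hxm := hx.plc.measurable
    have mx := h.measurable_production hxm hx0'
    have bx := h.abs_production_le hxm hx0'
    have hmild := h.mild_of_isSolution hx hx0'
    have hb := h.recurrentlyBounded_of_piecewiseAP hx hx0' hxap
    have hM := h.mild_le_M₁ hmild hb mx bx (h.production_le hxm hx0')
    exact ⟨hmild, hxm, fun t =>
      ⟨h.M₂_le_mild hmild hb mx bx (h.le_production hxm hx0' hM) t, hM t⟩⟩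
  obtain ⟨x1, x2, x3⟩ := key hx hxap hx0
  obtain ⟨y1, y2, y3⟩ := key hy hyap hy0
  exact h.mild_fixed_point_unique x1 x2 x3 y1 y2 y3

end Admissible
end Model
/-! ### Alignment of the impulse times with their translates -/

/-- The index `k` with `t ∈ (θ k, θ (k + 1)]`. -/
noncomputable def impulseIndex (θ : ℤ → ℝ) (t : ℝ) : ℤ :=
  Classical.epsilon fun k => t ∈ Ioc (θ k) (θ (k + 1))

/-- The slope on the interval of index `k` of the map that aligns `θ` with its translate by `q`. -/
noncomputable def alignSlope (θ : ℤ → ℝ) (q k : ℤ) : ℝ :=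
  (θ (k + q + 1) - θ (k + q)) / (θ (k + 1) - θ k)

/-- The piecewise affine map that sends `θ k` to `θ (k + q)` for all `k`. -/
noncomputable def align (θ : ℤ → ℝ) (q : ℤ) (t : ℝ) : ℝ :=
  θ (impulseIndex θ t + q) + (t - θ (impulseIndex θ t)) * alignSlope θ q (impulseIndex θ t)

namespace LinearImpulsive

variable {a : ℝ → ℝ} {θ γ : ℤ → ℝ} {lo hi η η' A B : ℝ}

lemma impulseIndex_spec (h : LinearImpulsive a θ γ lo hi η η' A B) (t : ℝ) :
    t ∈ Ioc (θ (impulseIndex θ t)) (θ (impulseIndex θ t + 1)) :=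
  Classical.epsilon_spec (exists_index h.strictMono h.tendsto_atTop h.tendsto_atBot t)

lemma impulseIndex_eq (h : LinearImpulsive a θ γ lo hi η η' A B) {t : ℝ} {k : ℤ}
    (ht : t ∈ Ioc (θ k) (θ (k + 1))) : impulseIndex θ t = k :=
  index_unique h.strictMono (h.impulseIndex_spec t) ht

lemma measurable_impulseIndex (h : LinearImpulsive a θ γ lo hi η η' A B) :
    Measurable (impulseIndex θ) := by
  refine Monotone.measurable fun s t hst => ?_
  have h1 := h.impulseIndex_spec s
  have h2 := h.impulseIndex_spec t
  have := h.strictMono.lt_iff_lt.1 (h1.1.trans_le (hst.trans h2.2))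
  omega

lemma measurable_alignSlope (h : LinearImpulsive a θ γ lo hi η η' A B) (q : ℤ) :
    Measurable fun t => alignSlope θ q (impulseIndex θ t) :=
  (measurable_of_countable (alignSlope θ q)).comp h.measurable_impulseIndex

lemma measurable_align (h : LinearImpulsive a θ γ lo hi η η' A B) (q : ℤ) :
    Measurable (align θ q) := by
  have h1 : Measurable fun t => θ (impulseIndex θ t + q) :=
    (measurable_of_countable fun k => θ (k + q)).comp h.measurable_impulseIndex
  have h2 : Measurable fun t => θ (impulseIndex θ t) :=
    (measurable_of_countable θ).comp h.measurable_impulseIndex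
  exact h1.add ((measurable_id.sub h2).mul (h.measurable_alignSlope q))

lemma gap_pos (h : LinearImpulsive a θ γ lo hi η η' A B) (k : ℤ) : 0 < θ (k + 1) - θ k :=
  h.η_pos.trans_le (h.gap_ge k)

lemma alignSlope_pos (h : LinearImpulsive a θ γ lo hi η η' A B) (q k : ℤ) :
    0 < alignSlope θ q k := div_pos (h.gap_pos _) (h.gap_pos _)

lemma align_eq (h : LinearImpulsive a θ γ lo hi η η' A B) (q : ℤ) {t : ℝ} {k : ℤ}
    (ht : t ∈ Ioc (θ k) (θ (k + 1))) : align θ q t = θ (k + q) + (t - θ k) * alignSlope θ q k := by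
  rw [align, h.impulseIndex_eq ht]

lemma align_impulse (h : LinearImpulsive a θ γ lo hi η η' A B) (q k : ℤ) :
    align θ q (θ k) = θ (k + q) := by
  have hk : θ k ∈ Ioc (θ (k - 1)) (θ (k - 1 + 1)) :=
    ⟨h.strictMono (by omega), by rw [sub_add_cancel]⟩
  have := h.gap_pos (k - 1)
  rw [h.align_eq q hk, alignSlope]
  rw [sub_add_cancel] at this ⊢
  rw [mul_div_cancel₀ _ this.ne', show k - 1 + q + 1 = k + q by ring]
  ring

lemma affine_mem (h : LinearImpulsive a θ γ lo hi η η' A B) (q : ℤ) {t : ℝ} {k : ℤ} :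
    (θ k < t → θ (k + q) < θ (k + q) + (t - θ k) * alignSlope θ q k) ∧
    (t ≤ θ (k + 1) → θ (k + q) + (t - θ k) * alignSlope θ q k ≤ θ (k + q + 1)) ∧
    (t < θ (k + 1) → θ (k + q) + (t - θ k) * alignSlope θ q k < θ (k + q + 1)) := by
  have hs := h.alignSlope_pos q k
  have hg : (θ (k + 1) - θ k) * alignSlope θ q k = θ (k + q + 1) - θ (k + q) :=
    mul_div_cancel₀ _ (h.gap_pos k).ne'
  refine ⟨fun ht => ?_, fun ht => ?_, fun ht => ?_⟩ <;> nlinarith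

lemma align_mem_Ioc (h : LinearImpulsive a θ γ lo hi η η' A B) (q : ℤ) {t : ℝ} {k : ℤ}
    (ht : t ∈ Ioc (θ k) (θ (k + 1))) : align θ q t ∈ Ioc (θ (k + q)) (θ (k + q + 1)) := by
  rw [h.align_eq q ht]
  exact ⟨(h.affine_mem q).1 ht.1, (h.affine_mem q).2.1 ht.2⟩

lemma align_mem_Ioo (h : LinearImpulsive a θ γ lo hi η η' A B) (q : ℤ) {t : ℝ} {k : ℤ}
    (ht : t ∈ Ioo (θ k) (θ (k + 1))) : align θ q t ∈ Ioo (θ (k + q)) (θ (k + q + 1)) := by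
  rw [h.align_eq q ⟨ht.1, ht.2.le⟩]
  exact ⟨(h.affine_mem q).1 ht.1, (h.affine_mem q).2.2 ht.2⟩

lemma align_injective (h : LinearImpulsive a θ γ lo hi η η' A B) (q : ℤ) :
    Function.Injective (align θ q) := by
  intro s t hst
  have h1 := h.align_mem_Ioc q (h.impulseIndex_spec s)
  have h2 := h.align_mem_Ioc q (h.impulseIndex_spec t)
  rw [hst] at h1
  have h3 : impulseIndex θ s = impulseIndex θ t := by
    have := index_unique h.strictMono h1 h2; omega
  simp only [align, h3, add_right_inj] at hst
  have := mul_right_cancel₀ (h.alignSlope_pos q _).ne' hst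
  linarith

lemma hasDerivAt_align (h : LinearImpulsive a θ γ lo hi η η' A B) (q : ℤ) {t : ℝ} {k : ℤ}
    (ht : t ∈ Ioo (θ k) (θ (k + 1))) : HasDerivAt (align θ q) (alignSlope θ q k) t := by
  have h1 : HasDerivAt (fun t => θ (k + q) + (t - θ k) * alignSlope θ q k)
      (alignSlope θ q k) t := by
    simpa using (((hasDerivAt_id t).sub_const (θ k)).mul_const (alignSlope θ q k)).const_add
      (θ (k + q))
  refine h1.congr_of_eventuallyEq ?_
  filter_upwards [Ioo_mem_nhds ht.1 ht.2] with s hs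
  exact h.align_eq q ⟨hs.1, hs.2.le⟩

lemma continuousOn_align (h : LinearImpulsive a θ γ lo hi η η' A B) (q k : ℤ) :
    ContinuousOn (align θ q) (Ioc (θ k) (θ (k + 1))) := by
  have h1 : Continuous fun t => θ (k + q) + (t - θ k) * alignSlope θ q k := by fun_prop
  exact h1.continuousOn.congr fun t ht => h.align_eq q ht

lemma tendsto_align (h : LinearImpulsive a θ γ lo hi η η' A B) (q k : ℤ) :
    Tendsto (align θ q) (𝓝[>] (θ k)) (𝓝[>] (θ (k + q))) := by
  have hev : Ioc (θ k) (θ (k + 1)) ∈ 𝓝[>] (θ k) := Ioc_mem_nhdsGT (h.strictMono (by omega))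
  refine tendsto_nhdsWithin_iff.2 ⟨?_, ?_⟩
  · have h1 : Continuous fun t => θ (k + q) + (t - θ k) * alignSlope θ q k := by fun_prop
    have h2 := (h1.tendsto (θ k)).mono_left (nhdsWithin_le_nhds (s := Ioi (θ k)))
    simp only [sub_self, zero_mul, add_zero] at h2
    refine h2.congr' ?_
    filter_upwards [hev] with t ht using (h.align_eq q ht).symm
  · filter_upwards [hev] with t ht using (h.align_mem_Ioc q ht).1

/-- By affinity the deviation at `t` is a convex combination of those at the two neighbouring
impulses. -/
lemma abs_align_sub_le (h : LinearImpulsive a θ γ lo hi η η' A B) {q : ℤ} {ω d : ℝ}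
    (hq : ∀ k, |θ (k + q) - θ k - ω| ≤ d) (t : ℝ) : |align θ q t - t - ω| ≤ d := by
  have ht := h.impulseIndex_spec t
  set k := impulseIndex θ t
  have hg := h.gap_pos k
  set l := (t - θ k) / (θ (k + 1) - θ k)
  have hl0 : 0 ≤ l := div_nonneg (by linarith [ht.1]) hg.le
  have hl1 : l ≤ 1 := (div_le_one hg).2 (by linarith [ht.2])
  have hl : l * (θ (k + 1) - θ k) = t - θ k := div_mul_cancel₀ _ hg.ne'
  have e : align θ q t - t - ω = (1 - l) * (θ (k + q) - θ k - ω)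
      + l * (θ (k + 1 + q) - θ (k + 1) - ω) := by
    rw [h.align_eq q ht, alignSlope, mul_div_assoc', mul_comm (t - θ k), ← mul_div_assoc']
    change θ (k + q) + (θ (k + q + 1) - θ (k + q)) * l - t - ω = _
    rw [show k + 1 + q = k + q + 1 by ring]
    linarith
  rw [e]
  refine (abs_add_le _ _).trans ?_
  rw [abs_mul, abs_mul, abs_of_nonneg hl0, abs_of_nonneg (sub_nonneg.2 hl1)]
  have h1 := mul_le_mul_of_nonneg_left (hq k) (sub_nonneg.2 hl1)
  have h2 := mul_le_mul_of_nonneg_left (hq (k + 1)) hl0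
  linarith

lemma abs_alignSlope_sub_one_le (h : LinearImpulsive a θ γ lo hi η η' A B) {q k : ℤ} {d : ℝ}
    (hq : |(θ (k + q + 1) - θ (k + q)) - (θ (k + 1) - θ k)| ≤ d) :
    |alignSlope θ q k - 1| ≤ d / η := by
  have hg := h.gap_pos k
  have hd : 0 ≤ d := (abs_nonneg _).trans hq
  rw [alignSlope, div_sub_one hg.ne', abs_div, abs_of_pos hg]
  have := h.η_pos
  have := h.gap_ge k
  gcongr

/-- Away from the impulses, a time close to the translate of `t` lies in the same interval as the
aligned time. -/
lemma abs_sub_align_le (h : LinearImpulsive a θ γ lo hi η η' A B) {x : ℝ → ℝ} {Λ : ℝ}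
    (hx : ∀ k, ∀ s ∈ Ioc (θ k) (θ (k + 1)), ∀ t ∈ Ioc (θ k) (θ (k + 1)), |x t - x s| ≤ Λ * |t - s|)
    {q : ℤ} {ω d : ℝ} (hq : ∀ k, |θ (k + q) - θ k - ω| ≤ d) {t w : ℝ}
    (ht : t ∉ nearImpulse θ (3 * d)) (hw : |w - t - ω| ≤ 2 * d) (hΛ : 0 ≤ Λ) :
    |x w - x (align θ q t)| ≤ Λ * (3 * d) := by
  have hti := h.impulseIndex_spec t
  set k := impulseIndex θ t
  have ha := h.abs_align_sub_le hq t
  have hnear : ∀ k, 3 * d < |t - θ k| := fun k => not_le.1 fun hk => ht ⟨k, hk⟩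
  have h1 : 3 * d < t - θ k := by
    have := hnear k
    rwa [abs_of_pos (by linarith [hti.1])] at this
  have h2 : 3 * d < θ (k + 1) - t := by
    have := hnear (k + 1)
    rwa [abs_sub_comm, abs_of_nonneg (by linarith [hti.2])] at this
  have h3 := abs_le.1 (hq k)
  have h4 := abs_le.1 (hq (k + 1))
  rw [show k + 1 + q = k + q + 1 by ring] at h4
  have h5 := abs_le.1 hw
  -- The margin `3 * d` pays `2 * d` for the deviation of `w` and `d` for that of the endpoint.
  have hwm : w ∈ Ioc (θ (k + q)) (θ (k + q + 1)) := ⟨by linarith, by linarith⟩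
  refine (hx _ _ (h.align_mem_Ioc q hti) _ hwm).trans (mul_le_mul_of_nonneg_left ?_ hΛ)
  rw [abs_le] at ha ⊢
  constructor <;> linarith

lemma gap_le_mul (h : LinearImpulsive a θ γ lo hi η η' A B) (k : ℤ) (j : ℕ) :
    θ (k + j) - θ k ≤ j * η' := by
  induction j with
  | zero => simp
  | succ j ih =>
    have := h.gap_le (k + j)
    push_cast
    rw [← add_assoc]
    linarith

lemma relDenseReal_of_relDenseInt (h : LinearImpulsive a θ γ lo hi η η' A B) {S : Set ℤ}
    (hS : RelDenseInt S) : RelDenseReal ((fun q => θ q - θ 0) '' S) := by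
  obtain ⟨N, hN⟩ := hS
  have hη := h.η_pos.trans_le h.η_le
  refine ⟨(N + 1) * η', by positivity, fun r => ?_⟩
  obtain ⟨k, hk⟩ := exists_index h.strictMono h.tendsto_atTop h.tendsto_atBot (r + θ 0)
  obtain ⟨q, hqS, hq1, hq2⟩ := hN (k + 1)
  refine ⟨_, ⟨q, hqS, rfl⟩, ?_, ?_⟩
  · have := h.strictMono.monotone hq1
    simp only; linarith [hk.2]
  · have h1 := h.strictMono.monotone hq2
    have h2 := h.gap_le_mul k (N + 1)
    rw [show k + ((N + 1 : ℕ) : ℤ) = k + 1 + N by push_cast; ring] at h2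
    push_cast at h2
    simp only; linarith [hk.1]

end LinearImpulsive

/-! ### The equation for the deviation from the aligned translate. -/

namespace Model
namespace Admissible

variable {m : ℕ} {P : Model m}

variable (P) in
/-- The deviation between a solution and its aligned translate satisfies the linear equation with
this inhomogeneity. -/
noncomputable def alignResidual (x : ℝ → ℝ) (q : ℤ) (t : ℝ) : ℝ :=
  (alignSlope P.θ q (impulseIndex P.θ t) - 1) *
      (-P.a (align P.θ q t) * x (align P.θ q t) + P.production x (align P.θ q t))
    + (P.a t - P.a (align P.θ q t)) * x (align P.θ q t)
    + (P.production x (align P.θ q t) - P.production x t)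

variable (P) in
/-- The impulses of the deviation between a solution and its aligned translate. -/
noncomputable def alignImpulse (x : ℝ → ℝ) (q k : ℤ) : ℝ :=
  (P.γ (k + q) - P.γ k) * x (P.θ (k + q)) + (P.δ (k + q) - P.δ k)

lemma measurable_alignResidual (h : P.Admissible) {x : ℝ → ℝ} (hx : Measurable x)
    (hx0 : ∀ t, 0 ≤ x t) (q : ℤ) : Measurable (alignResidual P x q) := by
  have hl := h.linear
  have h1 := hl.measurable_align q
  have h2 := hl.measurable_alignSlope q
  have h3 := h.measurable_production hx hx0
  have h4 := hl.cont.measurable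
  exact (((h2.sub_const 1).mul (((h4.comp h1).neg.mul (hx.comp h1)).add (h3.comp h1))).add
    ((h4.sub (h4.comp h1)).mul (hx.comp h1))).add ((h3.comp h1).sub h3)

/-- Alignment matches impulses with impulses, so the deviation jumps only at the `θ k`, with the
same factor `1 + γ k`. By the chain rule the slope of `align` multiplies the right-hand side, and
regrouping around `-a` leaves the residual. -/
lemma mild_align_sub (h : P.Admissible) {x : ℝ → ℝ} (hx : P.IsSolution x) (hx0 : ∀ t, 0 ≤ x t)
    (q : ℤ) {K : ℝ} (hK : ∀ t, |alignResidual P x q t| ≤ K) :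
    Mild P.a P.θ P.γ (alignResidual P x q) (alignImpulse P x q)
      (fun t => x (align P.θ q t) - x t) := by
  have hl := h.linear
  have hcont := hx.plc.continuousOn hl.strictMono
  refine mild_of_hasDerivAt hl.cont (h.measurable_alignResidual hx.plc.measurable hx0 q) hK
    (fun k => ?_) (fun k => ?_)
    (C := exceptionalTimes P ∪ align P.θ q ⁻¹' exceptionalTimes P)
    (h.countable_exceptionalTimes.union
      (h.countable_exceptionalTimes.preimage_of_injOn (hl.align_injective q).injOn))
    (fun k t ht htC => ?_)
  · exact ((hcont (k + q)).comp (hl.continuousOn_align q k)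
      fun t ht => hl.align_mem_Ioc q ht).sub (hcont k)
  · have := ((hx.jump (k + q)).comp (hl.tendsto_align q k)).sub (hx.jump k)
    have e : ∀ X Y : ℝ, Y = X → Tendsto (fun t => x (align P.θ q t) - x t) (𝓝[>] (P.θ k)) (𝓝 X) →
        Tendsto (fun t => x (align P.θ q t) - x t) (𝓝[>] (P.θ k)) (𝓝 Y) := fun X Y h => h ▸ id
    refine e _ _ ?_ this
    rw [hl.align_impulse, alignImpulse]; ring
  · simp only [mem_union, mem_preimage, not_or] at htC
    have h1 := IsSolution.hasDerivAt hx (notMem_range_of_mem_Ioo hl.strictMono ht) htC.1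
    have h2 := IsSolution.hasDerivAt hx
      (notMem_range_of_mem_Ioo hl.strictMono (hl.align_mem_Ioo q ht)) htC.2
    refine ((h2.comp t (hl.hasDerivAt_align q ht)).sub h1).congr_deriv ?_
    rw [alignResidual, hl.impulseIndex_eq ⟨ht.1, ht.2.le⟩]
    ring

variable (P) in
/-- The functions of time whose almost periods enter the equation. -/
noncomputable def coefficient : Option (Fin m × Fin 5) → ℝ → ℝ → ℝ
  | none => fun t _ => P.a t
  | some (i, l) => ![fun t _ => P.b i t, fun t _ => P.c i t, fun t _ => P.τ i t,
      fun t _ => P.σ i t, P.H i] l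

lemma coefficient_ap (h : P.Admissible) (j : Option (Fin m × Fin 5)) :
    BohrAPUniformly (coefficient P j) (Ici 0) := by
  rcases j with _ | ⟨i, l⟩
  · exact h.a1.ap.uniformly _
  · fin_cases l
    · exact (h.a2.b_ap i).uniformly _
    · exact (h.a2.c_ap i).uniformly _
    · exact (h.a4.τ_ap i).uniformly _
    · exact (h.a4.σ_ap i).uniformly _
    · exact h.a3.ap i

end Admissible
end Model
-- Almost periodicity of bounded solutions.
lemma integral_exp_mul_indicators_le {J : Type} [Fintype J] {l : ℝ} (hl : 0 < l) {c μ : ℝ}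
    (hμ0 : 0 ≤ μ) {S : J → Set ℝ} {p : J → ℝ} (hS : ∀ j, MeasurableSet (S j)) (hp : ∀ j, 0 ≤ p j)
    (hμ : ∀ j r, MeasureTheory.volume (S j ∩ Icc r (r + 1)) ≤ ENNReal.ofReal μ) (t : ℝ) :
    ∫ s in Iic t, Real.exp (-l * (t - s)) * (c + ∑ j, p j * (S j).indicator (fun _ => (1 : ℝ)) s)
      ≤ c / l + ∑ j, p j * (μ / (1 - Real.exp (-l))) := by
  have hm : ∀ j, Measurable ((S j).indicator (fun _ => (1 : ℝ))) := fun j =>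
    measurable_const.indicator (hS j)
  have hb : ∀ j s, |(S j).indicator (fun _ => (1 : ℝ)) s| ≤ 1 := fun j s => by
    rw [abs_of_nonneg (indicator_nonneg (fun _ _ => zero_le_one) s)]
    exact indicator_le_self' (fun _ _ => zero_le_one) s
  have hint := fun j => integrableOn_exp_scale_mul hl t t (hm j) (hb j)
  have e : ∀ s, Real.exp (-l * (t - s)) * (c + ∑ j, p j * (S j).indicator (fun _ => (1 : ℝ)) s)
      = Real.exp (-l * (t - s)) * c
        + ∑ j, p j * (Real.exp (-l * (t - s)) * (S j).indicator (fun _ => (1 : ℝ)) s) := by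
    intro s
    rw [mul_add, Finset.mul_sum]
    congr 1
    exact Finset.sum_congr rfl fun j _ => by ring
  simp_rw [e]
  rw [MeasureTheory.integral_add ((integrableOn_exp_scale hl t t).mul_const c)
    (MeasureTheory.integrable_finsetSum _ fun j _ => (hint j).const_mul (p j)),
    MeasureTheory.integral_finsetSum _ fun j _ => (hint j).const_mul (p j),
    MeasureTheory.integral_mul_const, integral_Iic_exp_scale hl]
  simp_rw [MeasureTheory.integral_const_mul]
  refine add_le_add (le_of_eq (by simp [div_eq_inv_mul])) (Finset.sum_le_sum fun j _ => ?_)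
  exact mul_le_mul_of_nonneg_left (integral_exp_indicator_le hl (hS j) hμ0 (hμ j) t) (hp j)

namespace Model
namespace Admissible

variable {m : ℕ} {P : Model m}

variable (P) in
/-- The Lipschitz constant of a solution between consecutive impulses. -/
noncomputable def slope : ℝ := P.aM * P.M₁ + productionAbs P

variable (P) in
/-- The indicator of the times close to an impulse. -/
noncomputable def near (e t : ℝ) : ℝ := (nearImpulse P.θ e).indicator (fun _ => (1 : ℝ)) t

lemma near_nonneg (e t : ℝ) : 0 ≤ near P e t := indicator_nonneg (fun _ _ => zero_le_one) t

lemma near_le_one (e t : ℝ) : near P e t ≤ 1 := indicator_le_self' (fun _ _ => zero_le_one) t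

lemma measurable_near (e : ℝ) : Measurable (near P e) :=
  measurable_const.indicator (measurableSet_nearImpulse P.θ e)

variable (P) in
/-- `q` is an almost period, up to `ε`, of all the data of the model. -/
def IsAlmostPeriod (d ε : ℝ) (q : ℤ) : Prop :=
  CommonAlmostPeriod P.θ P.γ P.δ (coefficient P) (fun _ => Icc 0 P.M₁) d ε q

lemma IsAlmostPeriod.times {d ε : ℝ} {q : ℤ} (hq : IsAlmostPeriod P d ε q) (k : ℤ) :
    |P.θ (k + q) - P.θ k - (P.θ q - P.θ 0)| ≤ d := by
  have := (CommonAlmostPeriod.times hq 0 k).le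
  rw [zero_add, zero_add, add_comm q k] at this
  rw [show P.θ (k + q) - P.θ k - (P.θ q - P.θ 0) = P.θ (k + q) - P.θ q - (P.θ k - P.θ 0) by ring]
  exact this

lemma IsAlmostPeriod.gaps {d ε : ℝ} {q : ℤ} (hq : IsAlmostPeriod P d ε q) (k : ℤ) :
    |(P.θ (k + q + 1) - P.θ (k + q)) - (P.θ (k + 1) - P.θ k)| ≤ d :=
  (CommonAlmostPeriod.times hq k 1).le

lemma IsAlmostPeriod.coeff (h : P.Admissible) {d ε : ℝ} {q : ℤ} (hq : IsAlmostPeriod P d ε q)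
    (t : ℝ) :
    |P.a (align P.θ q t) - P.a t| ≤ ε ∧
    (∀ i, |P.b i (align P.θ q t) - P.b i t| ≤ ε) ∧
    (∀ i, |P.c i (align P.θ q t) - P.c i t| ≤ ε) ∧
    (∀ i, |P.τ i (align P.θ q t) - P.τ i t| ≤ ε) ∧
    (∀ i, |P.σ i (align P.θ q t) - P.σ i t| ≤ ε) ∧
    (∀ i, ∀ z ∈ Icc 0 P.M₁, |P.H i (align P.θ q t) z - P.H i t z| ≤ ε) := by
  have hal := h.linear.abs_align_sub_le hq.times t
  -- A dummy argument for the coefficients that depend on time only.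
  have h0 : (0 : ℝ) ∈ Icc 0 P.M₁ := ⟨le_rfl, h.M₁_nonneg⟩
  have key := fun j => CommonAlmostPeriod.functions hq j _ _ hal
  exact ⟨(key none 0 h0).le, fun i => (key (some (i, 0)) 0 h0).le,
    fun i => (key (some (i, 1)) 0 h0).le, fun i => (key (some (i, 2)) 0 h0).le,
    fun i => (key (some (i, 3)) 0 h0).le, fun i z hz => (key (some (i, 4)) z hz).le⟩

/-- A solution with values between the a priori bounds. -/
structure BoundedSolution (P : Model m) (x : ℝ → ℝ) : Prop where
  sol : P.IsSolution x
  mem : ∀ t, x t ∈ Icc P.M₂ P.M₁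

namespace BoundedSolution

lemma nonneg (h : P.Admissible) {x : ℝ → ℝ} (hx : BoundedSolution P x) (t : ℝ) : 0 ≤ x t :=
  h.M₂_pos.le.trans (hx.mem t).1

lemma abs_le (h : P.Admissible) {x : ℝ → ℝ} (hx : BoundedSolution P x) (t : ℝ) :
    |x t| ≤ P.M₁ := by
  rw [abs_of_nonneg (hx.nonneg h t)]; exact (hx.mem t).2

lemma abs_sub_le (h : P.Admissible) {x : ℝ → ℝ} (hx : BoundedSolution P x) (s t : ℝ) :
    |x s - x t| ≤ P.M₁ := by
  rw [_root_.abs_le]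
  constructor <;> linarith [(hx.mem t).1, (hx.mem t).2, (hx.mem s).1, (hx.mem s).2, h.M₂_pos]

lemma lipschitz (h : P.Admissible) {x : ℝ → ℝ} (hx : BoundedSolution P x) (k : ℤ) {s t : ℝ}
    (hs : s ∈ Ioc (P.θ k) (P.θ (k + 1))) (ht : t ∈ Ioc (P.θ k) (P.θ (k + 1))) :
    |x t - x s| ≤ slope P * |t - s| := by
  have hm := hx.sol.plc.measurable
  exact h.linear.lipschitz_mild (h.measurable_production hm (hx.nonneg h))
    (h.abs_production_le hm (hx.nonneg h)) (h.mild_of_isSolution hx.sol (hx.nonneg h))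
    (hx.abs_le h) hs ht

lemma slope_nonneg (h : P.Admissible) {x : ℝ → ℝ} (hx : BoundedSolution P x) : 0 ≤ slope P :=
  add_nonneg (mul_nonneg h.linear.hi_pos.le h.M₁_nonneg)
    ((abs_nonneg _).trans (h.abs_production_le hx.sol.plc.measurable (hx.nonneg h) 0))

lemma abs_sub_align_le (h : P.Admissible) {x : ℝ → ℝ} (hx : BoundedSolution P x) {q : ℤ}
    {d ε : ℝ} (hq : IsAlmostPeriod P d ε q) (hdε : d ≤ ε) {t w : ℝ}
    (ht : t ∉ nearImpulse P.θ (3 * ε)) (hw : |w - t - (P.θ q - P.θ 0)| ≤ 2 * ε) :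
    |x w - x (align P.θ q t)| ≤ slope P * (3 * ε) :=
  h.linear.abs_sub_align_le (fun k _ hs _ ht => hx.lipschitz h k hs ht)
    (fun k => (hq.times k).trans hdε) ht hw (hx.slope_nonneg h)

/-- Away from impulses the aligned time mediates between `w` and `t`. Close to an impulse `w` may
lie on the other side of a jump, and only the trivial bound `M₁` is available; the indicator records
its cost. -/
lemma abs_shift_sub_le (h : P.Admissible) {x : ℝ → ℝ} (hx : BoundedSolution P x) {q : ℤ}
    {d ε : ℝ} (hq : IsAlmostPeriod P d ε q) (hε : 0 ≤ ε) (hdε : d ≤ ε) {Z : ℝ}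
    (hZ : ∀ t, |x (align P.θ q t) - x t| ≤ Z) {t w : ℝ}
    (hw : |w - t - (P.θ q - P.θ 0)| ≤ 2 * ε) :
    |x w - x t| ≤ Z + slope P * (3 * ε) + P.M₁ * near P (3 * ε) t := by
  have hZ0 : 0 ≤ Z := (abs_nonneg _).trans (hZ 0)
  have hs := hx.slope_nonneg h
  by_cases ht : t ∈ nearImpulse P.θ (3 * ε)
  · rw [near, indicator_of_mem ht, mul_one]
    have := hx.abs_sub_le h w t
    have : 0 ≤ slope P * (3 * ε) := by positivity
    linarith
  · rw [near, indicator_of_notMem ht, mul_zero, add_zero]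
    have h1 := hx.abs_sub_align_le h hq hdε ht hw
    have h2 := _root_.abs_sub_le (x w) (x (align P.θ q t)) (x t)
    linarith [hZ t]

/-- Discrete delays keep their indicators, to be integrated later in time, whereas the distributed
delay already averages its indicator over `s` and yields `ε'` for every `t`. -/
lemma abs_alignResidual_le (h : P.Admissible) {x : ℝ → ℝ} (hx : BoundedSolution P x) {q : ℤ}
    {d ε : ℝ} (hq : IsAlmostPeriod P d ε q) (hε : 0 ≤ ε) (hdε : d ≤ ε) {Z : ℝ}
    (hZ : ∀ t, |x (align P.θ q t) - x t| ≤ Z) {ε' : ℝ}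
    (hv : ∀ i t, ∫ s in (0 : ℝ)..P.T, P.v i s * near P (3 * ε) (t - s) ≤ ε') (t : ℝ) :
    |alignResidual P x q t| ≤ ε / P.η * slope P + ε * P.M₁
      + ∑ i, (3 * ε
        + P.bM i * P.KStar i * (Z + slope P * (3 * ε) + P.M₁ * near P (3 * ε) (t - P.τ i t))
        + P.cM i * P.GStar i * (Z + slope P * (3 * ε) + P.M₁ * ε')
        + P.L i * (Z + slope P * (3 * ε) + P.M₁ * near P (3 * ε) (t - P.σ i t))) := by
  have hl := h.linear
  have hm := hx.sol.plc.measurable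
  have hx0 := hx.nonneg h
  obtain ⟨ca, cb, cc, cτ, cσ, cH⟩ := hq.coeff h t
  have hal := (hl.abs_align_sub_le hq.times t).trans hdε
  have hshift := fun {t w : ℝ} => hx.abs_shift_sub_le h hq hε hdε hZ (t := t) (w := w)
  -- One `ε` comes from the alignment and one from the variation of the delay.
  have hdelay : ∀ τ : ℝ → ℝ, |τ (align P.θ q t) - τ t| ≤ ε →
      |align P.θ q t - τ (align P.θ q t) - (t - τ t) - (P.θ q - P.θ 0)| ≤ 2 * ε := by
    intro τ hτ
    rw [_root_.abs_le] at *
    constructor <;> linarith [hal.1, hal.2, hτ.1, hτ.2]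
  have hprod := h.abs_production_sub_le hm hm hx.mem hx.mem cb cc cH
    (fun i => hshift (hdelay (P.τ i) (cτ i)))
    (d₂ := fun _ => Z + slope P * (3 * ε) + P.M₁ * ε') (fun i => ?_)
    (fun i => hshift (hdelay (P.σ i) (cσ i)))
  · have h1 : |(alignSlope P.θ q (impulseIndex P.θ t) - 1) *
        (-P.a (align P.θ q t) * x (align P.θ q t) + P.production x (align P.θ q t))|
        ≤ ε / P.η * slope P := by
      rw [abs_mul]
      refine mul_le_mul ?_ ?_ (abs_nonneg _) (div_nonneg hε hl.η_pos.le)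
      · exact hl.abs_alignSlope_sub_one_le ((hq.gaps _).trans hdε)
      · refine (abs_add_le _ _).trans (add_le_add ?_ (h.abs_production_le hm hx0 _))
        rw [abs_mul, abs_neg, abs_of_pos (hl.lo_pos.trans_le (hl.lo_le _))]
        exact mul_le_mul (hl.le_hi _) (hx.abs_le h _) (abs_nonneg _) hl.hi_pos.le
    have h2 : |(P.a t - P.a (align P.θ q t)) * x (align P.θ q t)| ≤ ε * P.M₁ := by
      rw [abs_mul, abs_sub_comm]
      exact mul_le_mul ca (hx.abs_le h _) (abs_nonneg _) hε
    unfold alignResidual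
    exact (abs_add_le _ _).trans (add_le_add ((abs_add_le _ _).trans (add_le_add h1 h2)) hprod)
  · have a1 : Measurable fun s => x (align P.θ q t - s) :=
      hm.comp (measurable_const.sub measurable_id)
    have a2 : Measurable fun s => x (t - s) := hm.comp (measurable_const.sub measurable_id)
    have a3 : Measurable fun s => near P (3 * ε) (t - s) :=
      (measurable_near _).comp (measurable_const.sub measurable_id)
    have a4 : ∀ s, |near P (3 * ε) (t - s)| ≤ 1 := fun s => by
      rw [abs_of_nonneg (near_nonneg _ _)]; exact near_le_one _ _
    set W := Z + slope P * (3 * ε)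
    have b1 := h.integral_v_mul_mono i (g := fun s => |x (align P.θ q t - s) - x (t - s)|)
      (g' := fun s => W + P.M₁ * near P (3 * ε) (t - s)) (C' := |W| + P.M₁)
      (a1.sub a2).abs ((a3.const_mul _).const_add _)
      (fun s => by rw [abs_abs]; exact hx.abs_sub_le h _ _)
      (fun s => by
        refine (abs_add_le _ _).trans (add_le_add le_rfl ?_)
        rw [abs_mul, abs_of_nonneg h.M₁_nonneg]
        exact mul_le_of_le_one_right h.M₁_nonneg (a4 s))
      (fun s => hshift (by
        rw [show align P.θ q t - s - (t - s) - (P.θ q - P.θ 0)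
          = align P.θ q t - t - (P.θ q - P.θ 0) by ring]
        linarith))
    refine b1.trans ?_
    have b2 : ∀ s, P.v i s * (W + P.M₁ * near P (3 * ε) (t - s))
        = P.v i s * W + P.M₁ * (P.v i s * near P (3 * ε) (t - s)) := fun s => by ring
    simp_rw [b2]
    rw [intervalIntegral.integral_add ((h.standing.v_integrable i).mul_const W)
      ((h.integrable_v_mul i a3 a4).const_mul _), intervalIntegral.integral_const_mul,
      h.integral_v_mul_const]
    have := mul_le_mul_of_nonneg_left (hv i t) h.M₁_nonneg
    linarith

lemma abs_alignImpulse_le (h : P.Admissible) {x : ℝ → ℝ} (hx : BoundedSolution P x) {q : ℤ}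
    {d ε : ℝ} (hq : IsAlmostPeriod P d ε q) (k : ℤ) :
    |alignImpulse P x q k| ≤ ε * (P.M₁ + 1) := by
  have h1 := (CommonAlmostPeriod.fst hq k).le
  have h2 := (CommonAlmostPeriod.snd hq k).le
  refine (abs_add_le _ _).trans ?_
  rw [abs_mul]
  have := mul_le_mul h1 (hx.abs_le h (P.θ (k + q))) (abs_nonneg _) ((abs_nonneg _).trans h1)
  linarith

/-- The deviation of a solution from its aligned translates by almost periods is small. -/
lemma exists_abs_align_sub_le (h : P.Admissible) {x : ℝ → ℝ} (hx : BoundedSolution P x) :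
    ∃ C, 0 ≤ C ∧ ∀ ε' > 0, ∃ ε > 0, ε ≤ ε' ∧ ∀ d ≤ ε, ∀ q, IsAlmostPeriod P d ε q →
      ∀ t, |x (align P.θ q t) - x t| ≤ C * ε' := by
  have hl := h.linear
  have hm := hx.sol.plc.measurable
  have hx0 := hx.nonneg h
  have hM := h.M₁_nonneg
  have hs := hx.slope_nonneg h
  have hA := hl.A_pos
  have hlo := hl.lo_pos
  have hη := hl.η_pos
  have hE := hl.one_sub_exp_pos
  have hE' : 0 < 1 - Real.exp (-P.aL) := by
    have : Real.exp (-P.aL) < 1 := by simpa using Real.exp_lt_exp.2 (show -P.aL < 0 by linarith)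
    linarith
  have hK0 : ∀ i, 0 ≤ P.KStar i := fun i => sSup_rpow_nonneg (h.standing.α_pos i) h.M₂_pos
  have hG0 : ∀ i, 0 ≤ P.GStar i := fun i => sSup_rpow_nonneg (h.standing.β_pos i) h.M₂_pos
  have hbK : ∀ i, 0 ≤ P.bM i * P.KStar i := fun i => mul_nonneg (h.bM_nonneg i) (hK0 i)
  have hcG : ∀ i, 0 ≤ P.cM i * P.GStar i := fun i => mul_nonneg (h.cM_nonneg i) (hG0 i)
  have hL : ∀ i, 0 ≤ P.L i := fun i => (h.a3.L_pos i).le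
  -- The measures of the times at which a discrete delay leads close to an impulse.
  let u : Fin m ⊕ Fin m → ℝ → ℝ := Sum.elim (fun i t => t - P.τ i t) (fun i t => t - P.σ i t)
  have hu : ∀ j, Measurable (u j) ∧ ∃ c, 0 ≤ c ∧ ∀ e, 0 ≤ e → e ≤ 1 → ∀ r,
      MeasureTheory.volume (u j ⁻¹' nearImpulse P.θ e ∩ Icc r (r + 1))
        ≤ ENNReal.ofReal (c * e) := by
    rintro (i | i)
    · obtain ⟨κ, C, hκ, hC, -, h1, h2⟩ := exists_bilipschitz (h.a4.τ_differentiable i)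
        (h.a4.τ_deriv_bounded i) (h.a4.τ_deriv i)
      obtain ⟨c, hc, hv⟩ := hl.exists_volume_nearImpulse_le hκ hC 1
      exact ⟨measurable_id.sub (h.a4.τ_ap i).1.measurable, c, hc, hv _ h1 h2⟩
    · obtain ⟨κ, C, hκ, hC, -, h1, h2⟩ := exists_bilipschitz (h.a4.σ_differentiable i)
        (h.a4.σ_deriv_bounded i) (h.a4.σ_deriv i)
      obtain ⟨c, hc, hv⟩ := hl.exists_volume_nearImpulse_le hκ hC 1
      exact ⟨measurable_id.sub (h.a4.σ_ap i).1.measurable, c, hc, hv _ h1 h2⟩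
  choose hum w hw0 hw using hu
  set W := ∑ j, w j
  have hW0 : 0 ≤ W := Finset.sum_nonneg fun j _ => hw0 j
  have hwW : ∀ j, w j ≤ W := fun j => Finset.single_le_sum (fun j _ => hw0 j) (Finset.mem_univ j)
  let p : Fin m ⊕ Fin m → ℝ :=
    Sum.elim (fun i => P.bM i * P.KStar i * P.M₁) (fun i => P.L i * P.M₁)
  have hp : ∀ j, 0 ≤ p j := by
    rintro (i | i)
    · exact mul_nonneg (hbK i) hM
    · exact mul_nonneg (hL i) hM
  set Q := lipschitzSum P
  have hQ0 : 0 ≤ Q := h.lipschitzSum_nonneg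
  set r := P.A / P.aL * Q
  have hr1 : r < 1 := h.contraction
  -- `c₁` collects the part of the residual bound containing neither `Z` nor indicators, `c₂` the
  -- weighted measure of the indicators, and `C` adds the impulses.
  set c₁ := 3 * Q * slope P + slope P / P.η + P.M₁ + 3 * m + ∑ i, P.cM i * P.GStar i * P.M₁
  set c₂ := ∑ j, p j * (3 * W / (1 - Real.exp (-P.aL)))
  set C := P.A * (c₁ / P.aL + c₂) + P.A * (P.M₁ + 1) / (1 - Real.exp (-P.aL * P.η))
  have hc₁ : 0 ≤ c₁ := by
    have : 0 ≤ ∑ i, P.cM i * P.GStar i * P.M₁ :=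
      Finset.sum_nonneg fun i _ => mul_nonneg (hcG i) hM
    positivity
  have hc₂ : 0 ≤ c₂ := Finset.sum_nonneg fun j _ => mul_nonneg (hp j) (by positivity)
  have hC : 0 ≤ C := by positivity
  refine ⟨C / (1 - r), div_nonneg hC (by linarith), fun ε' hε' => ?_⟩
  choose e₀ he₀ hv using fun i => hl.exists_integral_nearImpulse_le h.standing.T_pos.le
    (h.standing.v_integrable i) hε'
  obtain ⟨e₁, he₁, he₁'⟩ := exists_pos_forall_le he₀
  -- The neighbourhoods have radius `3 * ε`, which must be at most one for the measure bound and at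
  -- most `e₁` for the kernel bound.
  set ε := min ε' (min (1 / 3) (e₁ / 3))
  have hε : 0 < ε := by positivity
  have hεε' : ε ≤ ε' := min_le_left _ _
  have hε1 : 3 * ε ≤ 1 := by
    have : ε ≤ 1 / 3 := (min_le_right _ _).trans (min_le_left _ _)
    linarith
  have hεe : 3 * ε ≤ e₁ := by
    have : ε ≤ e₁ / 3 := (min_le_right _ _).trans (min_le_right _ _)
    linarith
  refine ⟨ε, hε, hεε', fun d hd q hq => ?_⟩
  set z : ℝ → ℝ := fun t => x (align P.θ q t) - x t
  have hzM : ∀ t, |z t| ≤ P.M₁ := fun t => hx.abs_sub_le h _ _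
  -- This supremum is finite because `x` has values in `[M₂, M₁]`; that is what permits absorbing `r
  -- * Z` with `r < 1` at the end.
  set Z := ⨆ t, |z t|
  have hzZ : ∀ t, |z t| ≤ Z := fun t => le_ciSup (f := fun t => |z t|)
    ⟨P.M₁, by rintro _ ⟨s, rfl⟩; exact hzM s⟩ t
  have hres := hx.abs_alignResidual_le h hq hε.le hd hzZ (ε' := ε')
    (fun i t => hv i (3 * ε) (by positivity) (hεe.trans (he₁' i)) t)
  -- The bound of the residual as a constant plus indicators.
  let S : Fin m ⊕ Fin m → Set ℝ := fun j => u j ⁻¹' nearImpulse P.θ (3 * ε)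
  have hS : ∀ j, MeasurableSet (S j) := fun j => (measurableSet_nearImpulse _ _).preimage (hum j)
  have hnear : ∀ j t, (S j).indicator (fun _ => (1 : ℝ)) t = near P (3 * ε) (u j t) := by
    intro j t
    by_cases ht : u j t ∈ nearImpulse P.θ (3 * ε)
    · rw [near, indicator_of_mem ht, indicator_of_mem (show t ∈ S j from ht)]
    · rw [near, indicator_of_notMem ht, indicator_of_notMem (show t ∉ S j from ht)]
  set c₀ := Q * Z + c₁ * ε'
  let R : ℝ → ℝ := fun t => c₀ + ∑ j, p j * (S j).indicator (fun _ => (1 : ℝ)) t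
  have hresR : ∀ t, |alignResidual P x q t| ≤ R t := by
    intro t
    refine (hres t).trans ?_
    have e1 : R t = c₀ + (∑ i, P.bM i * P.KStar i * P.M₁ * near P (3 * ε) (t - P.τ i t)
        + ∑ i, P.L i * P.M₁ * near P (3 * ε) (t - P.σ i t)) := by
      simp only [R, hnear, Fintype.sum_sum_type, p, u, Sum.elim_inl, Sum.elim_inr]
    have e2 : ∑ i, (3 * ε
        + P.bM i * P.KStar i * (Z + slope P * (3 * ε) + P.M₁ * near P (3 * ε) (t - P.τ i t))
        + P.cM i * P.GStar i * (Z + slope P * (3 * ε) + P.M₁ * ε')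
        + P.L i * (Z + slope P * (3 * ε) + P.M₁ * near P (3 * ε) (t - P.σ i t)))
        = 3 * m * ε + Q * (Z + slope P * (3 * ε)) + (∑ i, P.cM i * P.GStar i * P.M₁) * ε'
          + (∑ i, P.bM i * P.KStar i * P.M₁ * near P (3 * ε) (t - P.τ i t)
            + ∑ i, P.L i * P.M₁ * near P (3 * ε) (t - P.σ i t)) := by
      have e3 : 3 * (m : ℝ) * ε = ∑ _i : Fin m, 3 * ε := by
        rw [Finset.sum_const, Finset.card_univ, Fintype.card_fin, nsmul_eq_mul]; ring
      simp only [Q, lipschitzSum]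
      rw [e3, Finset.sum_mul, Finset.sum_mul, ← Finset.sum_add_distrib, ← Finset.sum_add_distrib,
        ← Finset.sum_add_distrib, ← Finset.sum_add_distrib]
      exact Finset.sum_congr rfl fun i _ => by ring
    rw [e1, e2]
    have i1 : (3 * Q * slope P + slope P / P.η + P.M₁ + 3 * m) * ε
        ≤ (3 * Q * slope P + slope P / P.η + P.M₁ + 3 * m) * ε' := by gcongr
    have i2 : c₀ = Q * Z + (3 * Q * slope P + slope P / P.η + P.M₁ + 3 * m) * ε'
        + (∑ i, P.cM i * P.GStar i * P.M₁) * ε' := by simp only [c₀, c₁]; ring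
    have i3 : ε / P.η * slope P = slope P / P.η * ε := by ring
    rw [i2, i3]
    linarith
  have hRm : Measurable R := measurable_const.add
    (Finset.measurable_sum _ fun j _ => (measurable_const.indicator (hS j)).const_mul _)
  have hRb : ∀ t, |R t| ≤ |c₀| + ∑ j, p j := by
    intro t
    refine (abs_add_le _ _).trans (add_le_add le_rfl ?_)
    refine (Finset.abs_sum_le_sum_abs _ _).trans (Finset.sum_le_sum fun j _ => ?_)
    rw [hnear, abs_mul, abs_of_nonneg (hp j), abs_of_nonneg (near_nonneg _ _)]
    exact mul_le_of_le_one_right (hp j) (near_le_one _ _)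
  have hμ : ∀ j r, MeasureTheory.volume (S j ∩ Icc r (r + 1)) ≤ ENNReal.ofReal (W * (3 * ε)) :=
    fun j r => (hw j (3 * ε) (by positivity) hε1 r).trans
      (ENNReal.ofReal_le_ofReal (mul_le_mul_of_nonneg_right (hwW j) (by positivity)))
  have hI := fun t => integral_exp_mul_indicators_le hlo (c := c₀) (μ := W * (3 * ε))
    (by positivity) hS hp hμ t
  have hz := hl.abs_mild_le_weighted
    (h.mild_align_sub hx.sol hx0 q fun t => (hresR t).trans ((le_abs_self _).trans (hRb t)))
    (recurrentlyBounded_of_bounded P.θ hzM) (h.measurable_alignResidual hm hx0 q)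
    (fun t => (hresR t).trans ((le_abs_self _).trans (hRb t))) hRm hRb hresR
    (hx.abs_alignImpulse_le h hq) hI
  have hfin : ∀ t, |z t| ≤ r * Z + C * ε' := by
    intro t
    refine (hz t).trans ?_
    have j1 : ∑ j, p j * (W * (3 * ε) / (1 - Real.exp (-P.aL))) = c₂ * ε := by
      have j0 : c₂ * ε = ∑ j, p j * (3 * W / (1 - Real.exp (-P.aL))) * ε :=
        Finset.sum_mul _ _ _
      rw [j0]
      exact Finset.sum_congr rfl fun j _ => by ring
    rw [j1]
    have j2 : c₂ * ε ≤ c₂ * ε' := by gcongr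
    have j3 : P.A * (ε * (P.M₁ + 1)) / (1 - Real.exp (-P.aL * P.η))
        ≤ P.A * (ε' * (P.M₁ + 1)) / (1 - Real.exp (-P.aL * P.η)) := by gcongr
    have j4 : r * Z + C * ε' = P.A * (c₀ / P.aL + c₂ * ε')
        + P.A * (ε' * (P.M₁ + 1)) / (1 - Real.exp (-P.aL * P.η)) := by
      simp only [r, C, c₀]; ring
    rw [j4]
    exact add_le_add (mul_le_mul_of_nonneg_left (add_le_add le_rfl j2) hA.le) j3
  have hZ : Z ≤ r * Z + C * ε' := ciSup_le hfin
  intro t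
  refine (hzZ t).trans ?_
  rw [div_mul_eq_mul_div, le_div_iff₀ (by linarith)]
  linarith

lemma piecewiseAP (h : P.Admissible) {x : ℝ → ℝ} (hx : BoundedSolution P x) :
    PiecewiseAP P.θ x := by
  have hs := hx.slope_nonneg h
  refine ⟨hx.sol.plc, h.a7.ap, fun ε hε => ?_, fun ε hε => ?_⟩
  · refine ⟨ε / (slope P + 1), by positivity, fun k t ht t' ht' htt => ?_⟩
    rw [lt_div_iff₀ (by positivity)] at htt
    have := hx.lipschitz h k ht' ht
    nlinarith [abs_nonneg (t - t')]
  · obtain ⟨C, hC, hmain⟩ := hx.exists_abs_align_sub_le h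
    -- The three summands pay for the aligned deviation, for the passage from aligned to translated
    -- time, and for `3 * ε₁ ≤ ε`, which keeps `t` out of the excluded neighbourhoods; the last also
    -- makes the final inequality strict.
    set ε' := ε / (C + 3 * slope P + 3)
    have hε' : 0 < ε' := by positivity
    have hεε' : ε' * (C + 3 * slope P + 3) = ε := div_mul_cancel₀ _ (by positivity)
    obtain ⟨ε₁, hε₁, hle, hz⟩ := hmain ε' hε'
    obtain ⟨d, hd, hdε, hrel⟩ := exists_common_almost_periods h.a7.ap h.a6.ap h.a5
      (fun j => h.coefficient_ap j) (K := fun _ => Icc 0 P.M₁) (fun _ => Icc_subset_Ici_self)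
      (fun _ => isCompact_Icc) hε₁
    obtain ⟨ℓ, hℓ, hS⟩ := h.linear.relDenseReal_of_relDenseInt hrel
    refine ⟨ℓ, hℓ, fun r => ?_⟩
    obtain ⟨_, ⟨q, hq, rfl⟩, hr⟩ := hS r
    refine ⟨_, fun t ht => ?_, hr⟩
    have h3 : 3 * ε₁ ≤ ε := by
      have : 0 ≤ ε' * (C + 3 * slope P) := by positivity
      linarith
    have hn : t ∉ nearImpulse P.θ (3 * ε₁) := by
      rintro ⟨k, hk⟩
      linarith [ht k]
    have h1 := hx.abs_sub_align_le h hq hdε hn (w := t + (P.θ q - P.θ 0)) (by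
      rw [show t + (P.θ q - P.θ 0) - t - (P.θ q - P.θ 0) = 0 by ring, abs_zero]; positivity)
    have h2 := hz d hdε q hq t
    have h4 := _root_.abs_sub_le (x (t + (P.θ q - P.θ 0))) (x (align P.θ q t)) (x t)
    have h5 : slope P * (3 * ε₁) ≤ slope P * (3 * ε') := by gcongr
    linarith

end BoundedSolution

end Admissible
end Model
end Hematopoiesis

theorem theorem3p2 {m : ℕ} (P : Hematopoiesis.Model m) (hS : P.Standing)
    (h1 : P.A1) (h2 : P.A2) (h3 : P.A3) (h4 : P.A4) (h5 : P.A5) (h6 : P.A6) (h7 : P.A7)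
    (hM₁ : 0 ≤ P.M₁) (hM₂ : 0 < P.M₂)
    (hcontr : P.A / P.aL * ∑ i, (P.bM i * P.KStar i + P.cM i * P.GStar i + P.L i) < 1) :
    ∃! x : ℝ → ℝ, P.IsSolution x ∧ Hematopoiesis.PiecewiseAP P.θ x ∧ ∀ t, 0 < x t := by
  have h : P.Admissible := ⟨hS, h1, h2, h3, h4, h5, h6, h7, hM₁, hM₂, hcontr⟩
  obtain ⟨x, hx, hxm, hxI⟩ := h.exists_mild_fixed_point
  have hsol := h.isSolution_of_mild hx hxm fun t => hM₂.le.trans (hxI t).1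
  have hap := Hematopoiesis.Model.Admissible.BoundedSolution.piecewiseAP h ⟨hsol, hxI⟩
  have hpos : ∀ t, 0 < x t := fun t => hM₂.trans_le (hxI t).1
  exact ⟨x, ⟨hsol, hap, hpos⟩, fun y ⟨hy, hyap, hy0⟩ =>
    h.unique_solution hy hyap hy0 hsol hap hpos⟩
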